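/- Let $\Omega$ be a set of constants, let $\mathcal{L}_r$ be a relational extension of $\{+,\cdot,-,{}^{-1},0,1\}\cup\Omega$, and let $\mathcal{L}$ be a (possibly multi-sorted) extension of $\mathcal{L}_r$ whose restriction to the field sort is $\mathcal{L}_r$; the other sorts are called auxiliary. Let $K_0$ be a field of characteristic $0$ endowed with an $\mathcal{L}$-structure (with $0^{-1}=0$), and let $\chi_\tau(x,z)$ be an $\mathcal{L}$-formula, $x$ a single field sort variable and $z$ a tuple of variables of arbitrary sorts, such that the sets $\chi_\tau(K_0,a)$, for $a\in S_z(K_0)$, form a basis of neighbourhoods of $0$ of a non-discrete Hausdorff field topology $\tau$ on $K_0$. Let $T$ be the complete $\mathcal{L}$-theory of $K_0$ (in every model of $T$ the formula $\chi_\tau$ then defines such a topology). Assume that $T$ is an open $\mathcal{L}$-theory of topological fields, that is: (i) $T$ eliminates field sort quantifiers in $\mathcal{L}$; (ii) for every tuple $x$ of field sort variables, every $\mathcal{L}$-formula $\varphi(x)$ without field sort quantifiers is equivalent modulo $T$ to a formula $\bigvee_{i\in I}\big(\bigwedge_{j\in J_i}P_{ij}(x)=0\wedge\theta_i(x)\big)$,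 where $I$ and all $J_i$ are finite (possibly empty), $P_{ij}\in\mathbb{Q}(\Omega)[x]\setminus\{0\}$, and the $\mathcal{L}$-formula $\theta_i(x)$ defines an open set in every model of $T$. Let $\mathcal{L}_\delta$ be $\mathcal{L}$ with a unary function symbol $\delta$ on the field sort, and let $T_\delta$ be $T$ together with the axioms $\delta(x+y)=\delta(x)+\delta(y)$, $\delta(xy)=\delta(x)y+x\delta(y)$, and $\delta(c)=0$ for $c\in\Omega$. Let $T_\delta^*$ be the $\mathcal{L}_\delta$-theory whose models are the models $K$ of $T_\delta$ such that, for every $m\ge 1$, every polynomial $P\in K[y_0,\dots,y_m]$ in which $y_m$ occurs, every $a\in K^{m+1}$ with $P(a)=0$ and $\frac{\partial P}{\partial y_m}(a)\neq 0$, and every $c\in S_z(K)$, there is $b\in K$ such that, writing $\bar\delta^m(b)=(b,\delta(b),\dots,\delta^m(b))$, $$P(\bar\delta^m(b))=0,\qquad \tfrac{\partial P}{\partial y_m}(\bar\delta^m(b))\neq 0,\qquad K\models\chi_\tau(\delta^i(b)-a_i,c)\ \text{ for all } 0\le i\le m .$$ Assume that $T_\delta^*$ is consistent. Then $T$ is NIP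 if and only if $T_\delta^*$ is NIP. Here a theory is NIP if there are no partitioned formula $\varphi(x;y)$, with $x,y$ tuples of variables of arbitrary sorts, and model $M$ of the theory such that for every $k\in\mathbb{N}$ there are $a_i\in S_x(M)$ ($i<k$) and $b_J\in S_y(M)$ ($J\subseteq\{0,\dots,k-1\}$) with $M\models\varphi(a_i;b_J)\Leftrightarrow i\in J$. -/

import Mathlib

universe u

/-! ### Many-sorted first-order logic -/

namespace MS

/-- A many-sorted first-order language: sorts, function symbols with the sorts of their arguments
and of their value, and relation symbols with the sorts of their arguments. Equality on every sort
is a logical symbol. -/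
structure Lang where
  /-- the sorts -/
  Srt : Type u
  /-- the function symbols (constants are function symbols of arity `0`) -/
  Fn : Type u
  arity : Fn → ℕ
  dom : ∀ f : Fn, Fin (arity f) → Srt
  cod : Fn → Srt
  /-- the relation symbols -/
  Rel : Type u
  relArity : Rel → ℕ
  relDom : ∀ r : Rel, Fin (relArity r) → Srt

/-- A structure for a many-sorted language (auxiliary sorts may be empty). -/
structure Lang.Struc (L : Lang.{u}) where
  carrier : L.Srt → Type u
  fn : ∀ f : L.Fn, (∀ i : Fin (L.arity f), carrier (L.dom f i)) → carrier (L.cod f)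
  rel : ∀ r : L.Rel, (∀ i : Fin (L.relArity r), carrier (L.relDom r i)) → Prop

/-- The list of sorts `Γ` with one more sort `s` put in front. -/
def extend {S : Type u} {n : ℕ} (s : S) (Γ : Fin n → S) : Fin (n + 1) → S :=
  fun i => Fin.cases s Γ i

/-- Terms of sort `s` in variables `0, …, n - 1`, the variable `i` being of sort `Γ i`. -/
inductive Lang.Term (L : Lang.{u}) {n : ℕ} (Γ : Fin n → L.Srt) : L.Srt → Type u
  | var (i : Fin n) : Lang.Term L Γ (Γ i)
  | app (f : L.Fn) (ts : ∀ i : Fin (L.arity f), Lang.Term L Γ (L.dom f i)) :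
      Lang.Term L Γ (L.cod f)

/-- First-order formulas whose free variables are among `0, …, n - 1`, the variable `i` being of
sort `Γ i`. In `all s φ` the bound variable is the variable `0` of `φ`. The other connectives and
the existential quantifier are the usual classical abbreviations. -/
inductive Lang.Formula (L : Lang.{u}) : {n : ℕ} → (Fin n → L.Srt) → Type u
  | falsum {n : ℕ} {Γ : Fin n → L.Srt} : Lang.Formula L Γ
  | eq {n : ℕ} {Γ : Fin n → L.Srt} {s : L.Srt} (t t' : L.Term Γ s) : Lang.Formula L Γ
  | rel {n : ℕ} {Γ : Fin n → L.Srt} (r : L.Rel)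
      (ts : ∀ i : Fin (L.relArity r), L.Term Γ (L.relDom r i)) : Lang.Formula L Γ
  | imp {n : ℕ} {Γ : Fin n → L.Srt} (φ ψ : Lang.Formula L Γ) : Lang.Formula L Γ
  | all {n : ℕ} {Γ : Fin n → L.Srt} (s : L.Srt) (φ : Lang.Formula L (extend s Γ)) :
      Lang.Formula L Γ

namespace Lang

variable {L : Lang.{u}}

/-- Assignments of elements of `M` to variables of sorts `Γ`, i.e. elements of `S_x(M)` for a tuple
of variables `x` of sorts `Γ`. -/
abbrev Struc.Val (M : L.Struc) {n : ℕ} (Γ : Fin n → L.Srt) : Type u :=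
  ∀ i : Fin n, M.carrier (Γ i)

/-- Put the value `a` in front of an assignment. -/
def Struc.Val.cons {M : L.Struc} {n : ℕ} {Γ : Fin n → L.Srt} {s : L.Srt} (a : M.carrier s)
    (v : M.Val Γ) : M.Val (extend s Γ) :=
  fun i => Fin.cases (motive := fun i => M.carrier (extend s Γ i)) a v i

/-- The value of a term. -/
def Term.val (M : L.Struc) {n : ℕ} {Γ : Fin n → L.Srt} (v : M.Val Γ) :
    {s : L.Srt} → L.Term Γ s → M.carrier s
  | _, .var i => v i
  | _, .app f ts => M.fn f (fun i => (ts i).val M v)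

/-- Satisfaction `M ⊨ φ(v)`. -/
def Formula.Holds (M : L.Struc) : {n : ℕ} → {Γ : Fin n → L.Srt} → L.Formula Γ → M.Val Γ → Prop
  | _, _, .falsum, _ => False
  | _, _, .eq t t', v => t.val M v = t'.val M v
  | _, _, .rel r ts, v => M.rel r (fun i => (ts i).val M v)
  | _, _, .imp φ ψ, v => φ.Holds M v → ψ.Holds M v
  | _, _, .all s φ, v => ∀ a : M.carrier s, φ.Holds M (Struc.Val.cons a v)

/-- `φ` has no quantifier over the sort `s₀` (quantifiers over the other sorts are allowed). -/
def Formula.NoQuantifier (s₀ : L.Srt) : {n : ℕ} → {Γ : Fin n → L.Srt} → L.Formula Γ → Prop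
  | _, _, .falsum => True
  | _, _, .eq _ _ => True
  | _, _, .rel _ _ => True
  | _, _, .imp φ ψ => φ.NoQuantifier s₀ ∧ ψ.NoQuantifier s₀
  | _, _, .all s φ => s ≠ s₀ ∧ φ.NoQuantifier s₀

/-- Sentences are formulas without free variables. -/
abbrev Sentence (L : Lang.{u}) : Type u := L.Formula (fun i : Fin 0 => i.elim0)

/-- Truth of a sentence in a structure. -/
def Struc.Sat (M : L.Struc) (σ : L.Sentence) : Prop := σ.Holds M (fun i => i.elim0)

/-- `M` is a model of the set of sentences `T`. -/
def Struc.Models (M : L.Struc) (T : Set L.Sentence) : Prop := ∀ σ ∈ T, M.Sat σ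

/-- The complete theory of a structure. -/
def Struc.theory (M : L.Struc) : Set L.Sentence := {σ | M.Sat σ}

/-- `φ` and `ψ` are equivalent modulo `T`. -/
def EquivMod (T : Set L.Sentence) {n : ℕ} {Γ : Fin n → L.Srt} (φ ψ : L.Formula Γ) : Prop :=
  ∀ M : L.Struc, M.Models T → ∀ v : M.Val Γ, φ.Holds M v ↔ ψ.Holds M v

/-- `T` eliminates quantifiers over the sort `s₀`: every formula (with free variables of arbitrary
sorts) is equivalent modulo `T` to one without quantifiers over `s₀`. -/
def EliminatesQuantifier (T : Set L.Sentence) (s₀ : L.Srt) : Prop :=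
  ∀ {n : ℕ} (Γ : Fin n → L.Srt) (φ : L.Formula Γ),
    ∃ ψ : L.Formula Γ, ψ.NoQuantifier s₀ ∧ EquivMod T φ ψ

/-- The partitioned formula `φ(x; y)`, where `x` consists of the variables in `X` and `y` of the
remaining ones, shatters a set of size `k` in `M`: there are `a₀, …, a_{k-1}` in `S_x(M)` and `b_J`
in `S_y(M)` for all `J ⊆ {0, …, k-1}` with `M ⊨ φ(a_i; b_J)` iff `i ∈ J`. (Only the `x`-part of
`a i` and the `y`-part of `b J` are used.) -/
def Formula.Shatters {n : ℕ} {Γ : Fin n → L.Srt} (φ : L.Formula Γ) (X : Finset (Fin n))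
    (M : L.Struc) (k : ℕ) : Prop :=
  ∃ (a : Fin k → M.Val Γ) (b : Set (Fin k) → M.Val Γ), ∀ (i : Fin k) (J : Set (Fin k)),
    φ.Holds M (fun j => if j ∈ X then a i j else b J j) ↔ i ∈ J

/-- No partitioned formula has the independence property in `M`; having the independence property
means shattering sets of every finite size. -/
def Struc.IsNIP (M : L.Struc) : Prop :=
  ∀ {n : ℕ} (Γ : Fin n → L.Srt) (φ : L.Formula Γ) (X : Finset (Fin n)),
    ¬ ∀ k : ℕ, φ.Shatters X M k

/-- The theory `T` is NIP: no partitioned formula has the independence property in a model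
of `T`. -/
def IsNIPTheory (T : Set L.Sentence) : Prop := ∀ M : L.Struc, M.Models T → M.IsNIP

/-- The language `L` with a new unary function symbol `none` on the sort `s`. -/
def addUnary (L : Lang.{u}) (s : L.Srt) : Lang.{u} where
  Srt := L.Srt
  Fn := Option L.Fn
  arity := fun f => match f with
    | none => 1
    | some f => L.arity f
  dom := fun f => match f with
    | none => fun _ => s
    | some f => L.dom f
  cod := fun f => match f with
    | none => s
    | some f => L.cod f
  Rel := L.Rel
  relArity := L.relArity
  relDom := L.relDom

/-- The expansion of `M` in which the new function symbol is interpreted by `d`. -/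
def Struc.addUnary (M : L.Struc) (s : L.Srt) (d : M.carrier s → M.carrier s) :
    (L.addUnary s).Struc where
  carrier := M.carrier
  fn := fun f => match f with
    | none => fun v => d (v (0 : Fin 1))
    | some f => M.fn f
  rel := M.rel

end Lang

/-! ### Languages and structures expanding fields -/

/-- The sorts of a language with a distinguished field sort and auxiliary sorts `A`. -/
inductive FSort (A : Type u) : Type u
  | field : FSort A
  | aux (a : A) : FSort A

/-- The universe of each sort, given the field and the auxiliary universes. -/
def FSort.carrier {A : Type u} (K : Type u) (aux : A → Type u) : FSort A → Type u
  | .field => K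
  | .aux a => aux a

/-- The data of a (possibly multi-sorted) extension of the language of fields whose restriction to
the field sort is a relational extension of `{+, ·, -, ⁻¹, 0, 1} ∪ Ω`, with `Ω` a set of
constants. Relation symbols are arbitrary; every function symbol other than those of the language
of fields and those in `Ω` involves an auxiliary sort. -/
structure FieldLang where
  /-- the auxiliary sorts -/
  Aux : Type u
  /-- the set `Ω` of additional constants of the field sort -/
  Const : Type u
  /-- the other function symbols -/
  Fn : Type u
  arity : Fn → ℕ
  dom : ∀ f : Fn, Fin (arity f) → FSort Aux
  cod : Fn → FSort Aux
  involves_aux : ∀ f : Fn, cod f ≠ FSort.field ∨ ∃ i, dom f i ≠ FSort.field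
  /-- the relation symbols -/
  Rel : Type u
  relArity : Rel → ℕ
  relDom : ∀ r : Rel, Fin (relArity r) → FSort Aux

/-- The function symbols of the language described by `L`. -/
inductive FieldLang.FnSym (L : FieldLang.{u}) : Type u
  | zero : FieldLang.FnSym L
  | one : FieldLang.FnSym L
  | neg : FieldLang.FnSym L
  | inv : FieldLang.FnSym L
  | add : FieldLang.FnSym L
  | mul : FieldLang.FnSym L
  | const (c : L.Const) : FieldLang.FnSym L
  | other (f : L.Fn) : FieldLang.FnSym L

/-- The many-sorted language `ℒ` described by `L`. -/
def FieldLang.base (L : FieldLang.{u}) : Lang.{u} where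
  Srt := FSort L.Aux
  Fn := L.FnSym
  arity := fun f => match f with
    | .zero => 0
    | .one => 0
    | .neg => 1
    | .inv => 1
    | .add => 2
    | .mul => 2
    | .const _ => 0
    | .other f => L.arity f
  dom := fun f => match f with
    | .zero => fun _ => .field
    | .one => fun _ => .field
    | .neg => fun _ => .field
    | .inv => fun _ => .field
    | .add => fun _ => .field
    | .mul => fun _ => .field
    | .const _ => fun _ => .field
    | .other f => L.dom f
  cod := fun f => match f with
    | .zero => .field
    | .one => .field
    | .neg => .field
    | .inv => .field
    | .add => .field
    | .mul => .field
    | .const _ => .field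
    | .other f => L.cod f
  Rel := L.Rel
  relArity := L.relArity
  relDom := L.relDom

/-- The language `ℒ_δ`: the language `ℒ` with a unary function symbol on the field sort. -/
def FieldLang.diff (L : FieldLang.{u}) : Lang.{u} := L.base.addUnary FSort.field

/-- A field `K` endowed with an `ℒ`-structure, the symbols of the language of fields having their
usual meaning (with `0⁻¹ = 0`). The models of the theory of such a structure are again of this
form, being a field is a first-order property. -/
structure FieldStruc (L : FieldLang.{u}) where
  /-- the field sort -/
  K : Type u
  [fieldK : Field K]
  /-- the auxiliary sorts -/
  aux : L.Aux → Type u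
  const : L.Const → K
  fn : ∀ f : L.Fn, (∀ i : Fin (L.arity f), (L.dom f i).carrier K aux) → (L.cod f).carrier K aux
  rel : ∀ r : L.Rel, (∀ i : Fin (L.relArity r), (L.relDom r i).carrier K aux) → Prop

attribute [instance] FieldStruc.fieldK

namespace FieldStruc

variable {L : FieldLang.{u}}

/-- The underlying `ℒ`-structure. -/
def toStruc (M : FieldStruc L) : L.base.Struc where
  carrier := FSort.carrier M.K M.aux
  fn := fun f => match f with
    | .zero => fun _ => (0 : M.K)
    | .one => fun _ => (1 : M.K)
    | .neg => fun v => (-(show M.K from v (0 : Fin 1)) : M.K)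
    | .inv => fun v => ((show M.K from v (0 : Fin 1))⁻¹ : M.K)
    | .add => fun v => ((show M.K from v (0 : Fin 2)) + (show M.K from v (1 : Fin 2)) : M.K)
    | .mul => fun v => ((show M.K from v (0 : Fin 2)) * (show M.K from v (1 : Fin 2)) : M.K)
    | .const c => fun _ => M.const c
    | .other f => M.fn f
  rel := M.rel

/-- The `ℒ_δ`-structure `(M, δ)`. -/
def withDer (M : FieldStruc L) (δ : M.K → M.K) : L.diff.Struc :=
  M.toStruc.addUnary FSort.field δ

/-- Satisfaction of a formula with field sort variables only. -/
def HoldsAt (M : FieldStruc L) {k : ℕ} (θ : L.base.Formula (fun _ : Fin k => FSort.field))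
    (x : Fin k → M.K) : Prop :=
  θ.Holds M.toStruc (fun i => x i)

/-- The set `χ(M, z)` for a formula `χ(x, z)` with `x` a single variable of field sort. -/
def fiber (M : FieldStruc L) {r : ℕ} {Γ : Fin r → FSort L.Aux}
    (χ : L.base.Formula (extend FSort.field Γ)) (z : M.toStruc.Val Γ) : Set M.K :=
  {a | χ.Holds M.toStruc (Lang.Struc.Val.cons (s := (FSort.field : L.base.Srt)) a z)}

/-- The sets `χ(M, z)` form a basis of neighbourhoods of `0` for a topology which makes the field
sort of `M` into a non-discrete Hausdorff topological field. -/
def DefinesFieldTopology (M : FieldStruc L) {r : ℕ} {Γ : Fin r → FSort L.Aux}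
    (χ : L.base.Formula (extend FSort.field Γ)) : Prop :=
  ∃ _τ : TopologicalSpace M.K, IsTopologicalDivisionRing M.K ∧ T2Space M.K ∧
    ¬ DiscreteTopology M.K ∧ (nhds (0 : M.K)).HasBasis (fun _ => True) (M.fiber χ)

/-- `U ⊆ K^k` is open for the product of the topology given by `χ`: every point `x` of `U` has a
basic neighbourhood `∏ (x_i + χ(M, z))` inside `U`. -/
def IsOpenSet (M : FieldStruc L) {r : ℕ} {Γ : Fin r → FSort L.Aux}
    (χ : L.base.Formula (extend FSort.field Γ)) {k : ℕ} (U : Set (Fin k → M.K)) : Prop :=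
  ∀ x ∈ U, ∃ z : M.toStruc.Val Γ, ∀ y : Fin k → M.K,
    (∀ i, y i - x i ∈ M.fiber χ z) → y ∈ U

/-- Polynomials over `ℚ(Ω)`, the field generated by the constants, are given up to a nonzero
factor in `ℚ(Ω)` by polynomials whose coefficients are integer polynomials in the constants; this
is the polynomial over the field sort of `M` obtained by interpreting the constants in `M`. -/
noncomputable def interpret (M : FieldStruc L) {k : ℕ}
    (P : MvPolynomial (Fin k) (MvPolynomial L.Const ℤ)) : MvPolynomial (Fin k) M.K :=
  MvPolynomial.map (MvPolynomial.aeval M.const).toRingHom P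

/-- `δ` makes `M` into a model of `T_δ`, for `M` a model of `T`: it is a derivation and vanishes on
the constants in `Ω`. -/
structure IsDer (M : FieldStruc L) (δ : M.K → M.K) : Prop where
  map_add : ∀ x y, δ (x + y) = δ x + δ y
  map_mul : ∀ x y, δ (x * y) = δ x * y + x * δ y
  map_const : ∀ c : L.Const, δ (M.const c) = 0

/-- The scheme (DL). A differential polynomial in one variable `x` of order `m` is `P(δ̄^m(x))` with
`P` (the polynomial `P^*` of the text) an ordinary polynomial in `m + 1` variables in which the last
variable occurs; its separant is the partial derivative with respect to the last variable. -/
def SatisfiesDL (M : FieldStruc L) (δ : M.K → M.K) {r : ℕ} {Γ : Fin r → FSort L.Aux}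
    (χ : L.base.Formula (extend FSort.field Γ)) : Prop :=
  ∀ (m : ℕ), 1 ≤ m → ∀ P : MvPolynomial (Fin (m + 1)) M.K, Fin.last m ∈ P.vars →
    ∀ (z : M.toStruc.Val Γ) (y : Fin (m + 1) → M.K),
      MvPolynomial.eval y P = 0 →
      MvPolynomial.eval y (MvPolynomial.pderiv (Fin.last m) P) ≠ 0 →
      ∃ x : M.K,
        MvPolynomial.eval (fun i : Fin (m + 1) => δ^[i] x) P = 0 ∧
        MvPolynomial.eval (fun i : Fin (m + 1) => δ^[i] x)
          (MvPolynomial.pderiv (Fin.last m) P) ≠ 0 ∧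
        ∀ i : Fin (m + 1), δ^[i] x - y i ∈ M.fiber χ z

/-- `(M, δ)` is a model of `T_δ^*`, where the topology is given by `χ`. -/
structure ModelsGeneric (M : FieldStruc L) (δ : M.K → M.K) (T : Set L.base.Sentence) {r : ℕ}
    {Γ : Fin r → FSort L.Aux} (χ : L.base.Formula (extend FSort.field Γ)) : Prop where
  models : M.toStruc.Models T
  isDer : M.IsDer δ
  dl : M.SatisfiesDL δ χ

end FieldStruc

/-- Assumption (A) on the theory `T`, with the topology given by `χ`. -/
structure IsOpenTheory {L : FieldLang.{u}} (T : Set L.base.Sentence) {r : ℕ}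
    {Γ : Fin r → FSort L.Aux} (χ : L.base.Formula (extend FSort.field Γ)) : Prop where
  /-- `T` eliminates field sort quantifiers. -/
  elim : Lang.EliminatesQuantifier T (FSort.field : L.base.Srt)
  /-- Every field sort quantifier-free formula `φ(x)`, `x` a tuple of field sort variables, is
  equivalent modulo `T` to a finite disjunction of formulas `⋀ P(x) = 0 ∧ θ(x)` with finitely many
  nonzero polynomials `P` over `ℚ(Ω)` and `θ` defining an open set in every model. -/
  form : ∀ (k : ℕ) (φ : L.base.Formula (fun _ : Fin k => FSort.field)),
    φ.NoQuantifier (FSort.field : L.base.Srt) →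
    ∃ (N : ℕ) (A : Fin N → Finset (MvPolynomial (Fin k) (MvPolynomial L.Const ℤ)))
      (θ : Fin N → L.base.Formula (fun _ : Fin k => FSort.field)),
      ∀ M : FieldStruc L, M.toStruc.Models T →
        (∀ i, ∀ P ∈ A i, M.interpret P ≠ 0) ∧
        (∀ i, M.IsOpenSet χ {x | M.HoldsAt (θ i) x}) ∧
        ∀ x : Fin k → M.K, M.HoldsAt φ x ↔
          ∃ i, (∀ P ∈ A i, MvPolynomial.eval x (M.interpret P) = 0) ∧ M.HoldsAt (θ i) x

/-- `T_δ^*` is consistent. -/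
def GenericConsistent {L : FieldLang.{u}} (T : Set L.base.Sentence) {r : ℕ}
    {Γ : Fin r → FSort L.Aux} (χ : L.base.Formula (extend FSort.field Γ)) : Prop :=
  ∃ (M : FieldStruc L) (δ : M.K → M.K), M.ModelsGeneric δ T χ

/-- `T_δ^*` is NIP: no partitioned `ℒ_δ`-formula has the independence property in a model of
`T_δ^*`. -/
def GenericIsNIP {L : FieldLang.{u}} (T : Set L.base.Sentence) {r : ℕ}
    {Γ : Fin r → FSort L.Aux} (χ : L.base.Formula (extend FSort.field Γ)) : Prop :=
  ∀ (M : FieldStruc L) (δ : M.K → M.K), M.ModelsGeneric δ T χ → (M.withDer δ).IsNIP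

end MS

/-! ### Relations defined by one formula in all structures of a many-sorted language. -/

namespace MS

namespace Lang

variable {L : Lang.{u}}

/-! The direction from $T_\delta^*$ to $T$ is soft. Some model of $T_\delta^*$ exists,
$\mathcal{L}$-formulas are $\mathcal{L}_\delta$-formulas, and shattering a set of given finite size
is a first-order property, so NIP spreads from one reduct to every model of the complete theory $T$.

For the converse let $M$ be a model of $T$ with a generic derivation. Its topology is obtained by
transferring first-order axioms from $K_0$. What is used about $M$ is collected in `IsTame`: a
definable basis of neighbourhoods, NIP, and the normal form of definable sets. The latter says that
a set definable without parameters has a finite list of nonzero polynomials over the ring generated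
by $\Omega$ such that, around a point of the set, every nearby point satisfying those listed
equations that the point satisfies is again in the set.

Tameness: boundaries of the members of a definable family lie on hypersurfaces of bounded degree
(`exists_boxEval_eq_zero_of_mem_frontier`). Near frontier points every pattern of membership occurs;
if the points avoid a suitable polynomial, every pattern already occurs at the points themselves,
and NIP bounds their number. This yields uniform finiteness, a notion of small sets, and
algebraicity of definable functions. Consequently the derivative of a definable function is a
definable function of the arguments, their derivatives, and derivatives of definable functions of
the parameters (`DefMap.exists_der_eq_pi`).

Elimination: every $\mathcal{L}_\delta$-formula is an $\mathcal{L}$-formula in its variables and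
terms $\delta^n(c(x))$ with $c$ definable (`good_formula`). The crucial case is $\exists b\,
X(b,\delta b,\dots,\delta^m b)$. If $X$ has interior, or contains locally a hypersurface with
nonvanishing separant, genericity provides $b$. Otherwise the projection of $X$ forgetting the last
coordinate is small (`exists_small_proj`), so that some derivative of $b$ lies in a finite set
defined from the lower ones, all higher derivatives are then determined, and the order drops
(`good_exists_jet_of_small`).

NIP: it remains to remove a term $\delta^m(c(a,b))$ from a shattered configuration without mixing
$a$ and $b$. Finitely many values $\tau_{ij}=c(a_i,b_j)$ can be moved, preserving prescribed
algebraic relations over $\Omega$, to their Taylor polynomials $\sum_k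
\delta^k(\tau_{ij})\varepsilon^k/k!$ up to an error small compared with $\varepsilon^m$
(`IsGeneric.exists_taylor`). Being an array of values of $c$ is definable without parameters, so the
moved values are again $c(a_i',b_j')$. Solving for the top Taylor coefficient approximates
$\delta^m(c(a_i,b_j))$ by a definable function of one tuple attached to $i$ and one attached to $j$
(`IsGeneric.exists_approx`). Membership in a set with finite frontier can be read off a good enough
approximation, so the terms disappear one after another and NIP of $M$ applies
(`IsGeneric.exists_not_shatter_of_jets`). -/

theorem Term.exists_var {m : ℕ} {Δ : Fin m → L.Srt} (i : Fin m) {s : L.Srt} (e : Δ i = s) :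
    ∃ t : L.Term Δ s, ∀ (M : L.Struc) (v : M.Val Δ),
      t.val M v = cast (congrArg M.carrier e) (v i) := by
  subst e
  exact ⟨.var i, fun M v => by simp [Term.val]⟩

theorem Term.exists_rename {n m : ℕ} {Γ : Fin n → L.Srt} {Δ : Fin m → L.Srt} (g : Fin n → Fin m)
    (h : ∀ k, Δ (g k) = Γ k) {s : L.Srt} (t : L.Term Γ s) :
    ∃ t' : L.Term Δ s, ∀ (M : L.Struc) (v : M.Val Δ),
      t'.val M v = t.val M (fun k => cast (congrArg M.carrier (h k)) (v (g k))) := by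
  induction t with
  | var i => exact Term.exists_var (g i) (h i)
  | app f ts ih =>
    choose ts' hts using ih
    refine ⟨.app f ts', fun M v => ?_⟩
    simp only [Term.val, hts]

/-- Renaming is specified only by its semantics: a syntactic operation would have to transport terms
along equalities of sorts, whereas here the casts stay on the side of the assignments. -/
theorem Formula.exists_rename {n : ℕ} {Γ : Fin n → L.Srt} (φ : L.Formula Γ) :
    ∀ {m : ℕ} {Δ : Fin m → L.Srt} (g : Fin n → Fin m) (h : ∀ k, Δ (g k) = Γ k),
    ∃ φ' : L.Formula Δ, ∀ (M : L.Struc) (v : M.Val Δ),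
      φ'.Holds M v ↔ φ.Holds M (fun k => cast (congrArg M.carrier (h k)) (v (g k))) := by
  induction φ with
  | falsum => exact fun _ _ => ⟨.falsum, fun M v => Iff.rfl⟩
  | eq t t' =>
    intro m Δ g h
    obtain ⟨t₁, h₁⟩ := t.exists_rename g h
    obtain ⟨t₂, h₂⟩ := t'.exists_rename g h
    exact ⟨.eq t₁ t₂, fun M v => by simp only [Formula.Holds, h₁, h₂]⟩
  | rel r ts =>
    intro m Δ g h
    choose ts' hts using fun i => (ts i).exists_rename g h
    exact ⟨.rel r ts', fun M v => by simp only [Formula.Holds, hts]⟩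
  | imp φ ψ ih₁ ih₂ =>
    intro m Δ g h
    obtain ⟨φ', h₁⟩ := ih₁ g h
    obtain ⟨ψ', h₂⟩ := ih₂ g h
    exact ⟨.imp φ' ψ', fun M v => by simp only [Formula.Holds, h₁, h₂]⟩
  | all s φ ih =>
    intro m Δ g h
    obtain ⟨φ', h'⟩ := ih (Δ := extend s Δ) (Fin.cases 0 (fun k => (g k).succ))
      (fun k => by refine Fin.cases ?_ (fun k => ?_) k; · rfl
                   · exact h k)
    refine ⟨.all s φ', fun M v => ?_⟩
    simp only [Formula.Holds, h']
    refine forall_congr' fun a => iff_of_eq (congrArg _ ?_)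
    funext k
    refine Fin.cases ?_ (fun k => ?_) k
    · rfl
    · rfl

/-- A predicate on assignments, given uniformly for all structures, which is defined by a
formula. -/
def UDef {ι : Type} (Γ : ι → L.Srt) (R : ∀ M : L.Struc, (∀ i, M.carrier (Γ i)) → Prop) : Prop :=
  ∃ (n : ℕ) (ρ : Fin n → ι) (φ : L.Formula (fun k => Γ (ρ k))),
    ∀ (M : L.Struc) (v : ∀ i, M.carrier (Γ i)), φ.Holds M (fun k => v (ρ k)) ↔ R M v

/-- Brings formulas with different lists of variables to a common list, so that a connective or a
quantifier can be applied to them. -/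
theorem Formula.exists_reindex {ι : Type} {Γ : ι → L.Srt} {n m : ℕ} (ρ : Fin n → ι)
    (ρ' : Fin m → ι) (hsub : ∀ k, ∃ l, ρ' l = ρ k) (φ : L.Formula (fun k => Γ (ρ k))) :
    ∃ φ' : L.Formula (fun k => Γ (ρ' k)), ∀ (M : L.Struc) (v : ∀ i, M.carrier (Γ i)),
      φ'.Holds M (fun k => v (ρ' k)) ↔ φ.Holds M (fun k => v (ρ k)) := by
  choose g hg using hsub
  obtain ⟨φ', h⟩ := φ.exists_rename (Δ := fun k => Γ (ρ' k)) g (fun k => by rw [hg])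
  refine ⟨φ', fun M v => ?_⟩
  rw [h]
  refine iff_of_eq (congrArg _ ?_)
  funext k
  have : ∀ i j (e : i = j) (e' : M.carrier (Γ i) = M.carrier (Γ j)), cast e' (v i) = v j := by
    intro i j e e'; subst e; rfl
  exact this _ _ (hg k) _

namespace UDef

variable {ι ι' : Type} {Γ : ι → L.Srt}

theorem congr {R R' : ∀ M : L.Struc, (∀ i, M.carrier (Γ i)) → Prop} (h : UDef Γ R)
    (hR : ∀ M v, R' M v ↔ R M v) : UDef Γ R' := by
  obtain ⟨n, ρ, φ, hφ⟩ := h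
  exact ⟨n, ρ, φ, fun M v => (hφ M v).trans (hR M v).symm⟩

theorem falsum : UDef Γ (fun _ _ => False) := ⟨0, Fin.elim0, .falsum, fun _ _ => Iff.rfl⟩

theorem imp {R R' : ∀ M : L.Struc, (∀ i, M.carrier (Γ i)) → Prop} (h : UDef Γ R)
    (h' : UDef Γ R') : UDef Γ (fun M v => R M v → R' M v) := by
  obtain ⟨n, ρ, φ, hφ⟩ := h
  obtain ⟨m, σ, ψ, hψ⟩ := h'
  obtain ⟨φ', h₁⟩ := Formula.exists_reindex ρ (Fin.append ρ σ)
    (fun k => ⟨Fin.castAdd m k, Fin.append_left ρ σ k⟩) φ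
  obtain ⟨ψ', h₂⟩ := Formula.exists_reindex σ (Fin.append ρ σ)
    (fun k => ⟨Fin.natAdd n k, Fin.append_right ρ σ k⟩) ψ
  refine ⟨n + m, Fin.append ρ σ, .imp φ' ψ', fun M v => ?_⟩
  simp only [Formula.Holds, h₁, h₂, hφ, hψ]

theorem not {R : ∀ M : L.Struc, (∀ i, M.carrier (Γ i)) → Prop} (h : UDef Γ R) :
    UDef Γ (fun M v => ¬ R M v) := h.imp falsum

theorem and {R R' : ∀ M : L.Struc, (∀ i, M.carrier (Γ i)) → Prop} (h : UDef Γ R)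
    (h' : UDef Γ R') : UDef Γ (fun M v => R M v ∧ R' M v) :=
  (h.imp h'.not).not.congr fun M v => by tauto

theorem verum : UDef Γ (fun _ _ => True) := falsum.not.congr fun _ _ => by simp

theorem const (p : Prop) : UDef Γ (fun _ _ => p) := by
  by_cases h : p
  · exact verum.congr fun _ _ => by simp [h]
  · exact falsum.congr fun _ _ => by simp [h]

theorem rename {Γ' : ι' → L.Srt} (f : ι → ι') (hf : ∀ i, Γ' (f i) = Γ i)
    {R : ∀ M : L.Struc, (∀ i, M.carrier (Γ i)) → Prop} (h : UDef Γ R) :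
    UDef Γ' (fun M v => R M (fun i => cast (congrArg M.carrier (hf i)) (v (f i)))) := by
  obtain rfl : Γ = fun i => Γ' (f i) := funext fun i => (hf i).symm
  obtain ⟨n, ρ, φ, hφ⟩ := h
  exact ⟨n, fun k => f (ρ k), φ, fun M v => hφ M (fun i => v (f i))⟩

/-- The list `ρ` may repeat the bound variable or omit it. Its ordinary variables are therefore
collected without repetition in `σ`, and the formula is rewritten over the list with the bound
variable in front, where the syntactic quantifier acts. -/
theorem forall_one {s : L.Srt} {R : ∀ M : L.Struc, (∀ i, M.carrier (Γ i)) → M.carrier s → Prop}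
    (h : UDef (fun o : Option ι => o.elim s Γ) (fun M v => R M (fun i => v (some i)) (v none))) :
    UDef Γ (fun M v => ∀ a, R M v a) := by
  obtain ⟨n, ρ, φ, hφ⟩ := h
  let S := {i : ι // ∃ k, ρ k = some i}
  have : Finite S := Finite.of_injective (fun s : S => s.2.choose) (by
    rintro ⟨i, hi⟩ ⟨j, hj⟩ h
    have := hi.choose_spec
    have := hj.choose_spec
    simp only at h
    simp_all)
  obtain ⟨m, ⟨e⟩⟩ := Finite.exists_equiv_fin S
  let σ : Fin m → ι := fun k => (e.symm k).1
  have hg : ∀ k : Fin n, ∃ l : Fin (m + 1), (Fin.cases none (fun j => some (σ j)) l : Option ι) =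
      ρ k := by
    intro k
    rcases hk : ρ k with _ | i
    · exact ⟨0, rfl⟩
    · exact ⟨(e ⟨i, k, hk⟩).succ, by simp [σ]⟩
  obtain ⟨φ', h'⟩ := Formula.exists_reindex (Γ := fun o : Option ι => o.elim s Γ) ρ _ hg φ
  have hext : (fun l : Fin (m + 1) => Option.elim
      (Fin.cases none (fun j => some (σ j)) l : Option ι) s Γ)
      = extend s (fun k => Γ (σ k)) := by
    funext l
    refine Fin.cases rfl (fun j => rfl) l
  have key : ∃ ψ : L.Formula (extend s (fun k => Γ (σ k))), ∀ (M : L.Struc)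
      (v : ∀ i, M.carrier (Γ i)) (a : M.carrier s),
      ψ.Holds M (Struc.Val.cons a (fun k => v (σ k))) ↔ R M v a := by
    obtain ⟨ψ, hψ⟩ := φ'.exists_rename (Δ := extend s (fun k => Γ (σ k))) id
      (fun l => (congrFun hext l).symm)
    refine ⟨ψ, fun M v a => ?_⟩
    let w : ∀ o : Option ι, M.carrier (o.elim s Γ) := fun o => match o with
      | none => a
      | some i => v i
    rw [hψ]
    refine Iff.trans ?_ ((h' M w).trans (hφ M w))
    refine iff_of_eq (congrArg _ ?_)
    funext l
    refine Fin.cases ?_ (fun j => ?_) l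
    · rfl
    · rfl
  obtain ⟨ψ, hψ⟩ := key
  exact ⟨m, σ, .all s ψ, fun M v => by simp only [Formula.Holds, hψ]⟩

theorem forall_block (ι' : Type) [Finite ι'] : ∀ {ι : Type} {Γ : ι → L.Srt} (Γ' : ι' → L.Srt)
    {R : ∀ M : L.Struc, (∀ i, M.carrier (Γ i)) → (∀ i, M.carrier (Γ' i)) → Prop},
    UDef (Sum.elim Γ Γ') (fun M v => R M (fun i => v (.inl i)) (fun i => v (.inr i))) →
    UDef Γ (fun M v => ∀ v', R M v v') := by
  induction ι' using Finite.induction_empty_option with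
  | @of_equiv α β e ih =>
    intro ι Γ Γ' R h
    have h₁ := ih (Γ := Γ) (fun i => Γ' (e i))
      (R := fun M v v' => R M v (fun j => cast (congrArg (fun j => M.carrier (Γ' j))
          (e.apply_symm_apply j)) (v' (e.symm j)))) ?_
    · refine h₁.congr fun M v => ⟨fun H v' => H _, fun H v' => ?_⟩
      convert H (fun i => v' (e i)) using 2
      have : ∀ i j (h : i = j) (h' : M.carrier (Γ' i) = M.carrier (Γ' j)), cast h' (v' i) = v' j :=
          by
        intro i j e e'; subst e; rfl
      rename_i j
      exact (this _ _ (e.apply_symm_apply j) _).symm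
    · refine (h.rename (Γ' := Sum.elim Γ (fun i => Γ' (e i))) (Sum.map id e.symm) ?_).congr ?_
      · rintro (i | j)
        · rfl
        · simp
      · intro M v
        rfl
  | h_empty =>
    intro ι Γ Γ' R h
    refine (h.rename (Γ' := Γ) (Sum.elim id PEmpty.elim) ?_).congr ?_
    · rintro (i | ⟨⟨⟩⟩)
      rfl
    · intro M v
      have e : ∀ a b : (∀ i : PEmpty, M.carrier (Γ' i)), a = b := fun a b => funext fun i => i.elim
      exact ⟨fun H => H _, fun H v' => (e v' _) ▸ H⟩
  | @h_option α _ ih =>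
    intro ι Γ Γ' R h
    have h₁ := ih (Γ := Γ) (fun i => Γ' (some i))
      (R := fun M v v' => ∀ a : M.carrier (Γ' none), R M v (fun o => match o with
        | none => a
        | some i => v' i)) ?_
    · refine h₁.congr fun M v => ⟨fun H v' a => H _, fun H v' => ?_⟩
      convert H (fun i => v' (some i)) (v' none) using 2
      rename_i o
      cases o <;> rfl
    · apply forall_one (Γ := Sum.elim Γ fun i => Γ' (some i)) (s := Γ' none)
        (R := fun M v a => R M (fun i => v (.inl i)) (fun o => match o with
        | none => a
        | some i => v (.inr i)))
      refine (h.rename (Γ' := fun o : Option (ι ⊕ α) => o.elim (Γ' none) (Sum.elim Γ fun i => Γ'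
          (some i)))
        (Sum.elim (fun i => some (.inl i)) (fun o => o.elim none (fun i => some (.inr i))))
            ?_).congr ?_
      · rintro (i | (_ | j)) <;> rfl
      · intro M v
        refine iff_of_eq (congrArg _ ?_)
        funext o
        cases o <;> rfl

theorem exists_block (ι' : Type) [Finite ι'] {ι : Type} {Γ : ι → L.Srt} (Γ' : ι' → L.Srt)
    {R : ∀ M : L.Struc, (∀ i, M.carrier (Γ i)) → (∀ i, M.carrier (Γ' i)) → Prop}
    (h : UDef (Sum.elim Γ Γ') (fun M v => R M (fun i => v (.inl i)) (fun i => v (.inr i)))) :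
    UDef Γ (fun M v => ∃ v', R M v v') :=
  (forall_block ι' (Γ := Γ) Γ' (R := fun M v v' => ¬ R M v v') h.not).not.congr
    fun M v => by push Not; rfl

theorem forall_finite {κ : Type} [Finite κ] {R : κ → ∀ M : L.Struc, (∀ i, M.carrier (Γ i)) → Prop}
    (h : ∀ k, UDef Γ (R k)) : UDef Γ (fun M v => ∀ k, R k M v) := by
  induction κ using Finite.induction_empty_option with
  | of_equiv e ih =>
    exact (ih (R := fun i => R (e i)) fun k => h _).congr fun M v => e.surjective.forall
  | h_empty => exact verum.congr fun M v => by simp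
  | h_option ih =>
    exact ((h none).and (ih fun k => h (some k))).congr fun M v => Option.forall

theorem of_formula {n : ℕ} {Γ : Fin n → L.Srt} (φ : L.Formula Γ) :
    UDef Γ (fun M v => φ.Holds M v) :=
  ⟨n, id, φ, fun _ _ => Iff.rfl⟩

theorem eq {i j : ι} (h : Γ i = Γ j) :
    UDef Γ (fun M v => cast (congrArg M.carrier h) (v i) = v j) := by
  have key : ∀ s (h : Γ i = s), UDef (fun b : Bool => if b then Γ i else s)
      (fun M v => cast (congrArg M.carrier h) (v true) = v false) := by
    rintro s rfl
    refine ⟨2, fun k => if k = 0 then true else false, .eq (s := Γ i) (.var 0) (.var 1),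
        fun M v => ?_⟩
    simp [Formula.Holds, Term.val]
  refine ((key _ h).rename (Γ' := Γ) (fun b => if b then i else j) ?_).congr ?_
  · rintro (_ | _) <;> rfl
  · intro M v
    rfl

/-- Graphs of single function symbols suffice: compositions are later expressed by quantifying over
intermediate values, so nested terms never have to be built. -/
theorem fn_graph (f : L.Fn) : UDef (fun o : Option (Fin (L.arity f)) => o.elim (L.cod f) (L.dom f))
    (fun M v => v none = M.fn f (fun i => v (some i))) := by
  refine ⟨L.arity f + 1, Fin.cases none some, .eq (s := L.cod f) (.var 0) (.app f (fun i => .var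
      i.succ)),
    fun M v => ?_⟩
  simp [Formula.Holds, Term.val]

theorem rel_graph (r : L.Rel) : UDef (L.relDom r) (fun M v => M.rel r v) :=
  ⟨_, id, .rel r (fun i => .var i), fun M v => by simp [Formula.Holds, Term.val]⟩

/-- Uniformly definable properties without parameters have the same truth value in a structure and
in the models of its theory. -/
theorem iff_of_models {Γ : PEmpty.{1} → L.Srt} {R : ∀ M : L.Struc, (∀ i, M.carrier (Γ i)) → Prop}
    (h : UDef Γ R) {M N : L.Struc} (hM : M.Models N.theory) :
    R M (fun i => i.elim) ↔ R N (fun i => i.elim) := by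
  obtain ⟨n, ρ, φ, hφ⟩ := h
  cases n with
  | succ n => exact (ρ 0).elim
  | zero =>
    rw [← hφ, ← hφ]
    obtain ⟨φ', h'⟩ := φ.exists_rename (Δ := fun i : Fin 0 => i.elim0) id (fun k => k.elim0)
    have h1 : ∀ M : L.Struc, M.Sat φ' ↔ φ.Holds M (fun k => (ρ k).elim) := by
      intro M
      rw [Struc.Sat, h']
      refine iff_of_eq (congrArg _ (funext fun k => k.elim0))
    constructor
    · intro h
      by_contra hN
      have := hM (.imp φ' .falsum) (fun H => hN ((h1 N).1 H))
      exact this ((h1 M).2 h)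
    · intro h
      exact (h1 M).1 (hM φ' ((h1 N).2 h))

end UDef

end Lang

end MS

/-! ### Relations and maps definable without parameters in a fixed structure. -/

namespace MS

namespace FieldStruc

variable {L : FieldLang.{u}} (M : FieldStruc L)

/-- A type whose elements are finite tuples of elements of the sorts of `M`. -/
class Ctx (E : Type u) where
  ι : Type
  Γ : ι → L.base.Srt
  equiv : E ≃ ∀ i, M.toStruc.carrier (Γ i)
  fin : Finite ι

attribute [instance] Ctx.fin

variable {E F G : Type u} [Ctx M E] [Ctx M F] [Ctx M G]

instance instCtxSort (s : L.base.Srt) : Ctx M (M.toStruc.carrier s) where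
  ι := Unit
  Γ := fun _ => s
  equiv := (Equiv.funUnique Unit (M.toStruc.carrier s)).symm
  fin := inferInstance

instance instCtxField : Ctx M M.K := instCtxSort M FSort.field

instance instCtxProd : Ctx M (E × F) where
  ι := Ctx.ι M E ⊕ Ctx.ι M F
  Γ := Sum.elim (Ctx.Γ (M := M)) (Ctx.Γ (M := M))
  equiv :=
    { toFun := fun p i => match i with
        | .inl i => Ctx.equiv p.1 i
        | .inr i => Ctx.equiv p.2 i
      invFun := fun v => (Ctx.equiv.symm fun i => v (.inl i), Ctx.equiv.symm fun i => v (.inr i))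
      left_inv := fun p => by simp
      right_inv := fun v => by
        funext i
        cases i
        · exact congrFun (Ctx.equiv.apply_symm_apply _) _
        · exact congrFun (Ctx.equiv.apply_symm_apply _) _ }
  fin := inferInstance

instance instCtxPi {κ : Type} [Finite κ] : Ctx M (κ → E) where
  ι := κ × Ctx.ι M E
  Γ := fun i => Ctx.Γ i.2
  equiv :=
    { toFun := fun f i => Ctx.equiv (f i.1) i.2
      invFun := fun v k => Ctx.equiv.symm fun i => v (k, i)
      left_inv := fun p => by simp
      right_inv := fun v => by simp }
  fin := inferInstance

instance instCtxVal {n : ℕ} (Γ : Fin n → L.base.Srt) : Ctx M (M.toStruc.Val Γ) where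
  ι := Fin n
  Γ := Γ
  equiv := Equiv.refl _
  fin := inferInstance

instance instCtxFieldVal {n : ℕ} (Γ : Fin n → FSort L.Aux) :
    Ctx M (Lang.Struc.Val (L := L.base) M.toStruc Γ) :=
  instCtxVal M Γ

/-- Predicates definable in `M` without parameters. -/
def Def (R : E → Prop) : Prop :=
  ∃ U : ∀ S : L.base.Struc, (∀ i, S.carrier (Ctx.Γ (M := M) (E := E) i)) → Prop,
    Lang.UDef (Ctx.Γ (M := M) (E := E)) U ∧ ∀ e, R e ↔ U M.toStruc (Ctx.equiv e)

/-- Maps whose graph is definable in `M` without parameters. -/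
@[fun_prop]
def DefMap (g : E → F) : Prop := M.Def (fun p : E × F => p.2 = g p.1)

variable {M}

namespace Def

theorem congr {R R' : E → Prop} (h : M.Def R) (hR : ∀ e, R' e ↔ R e) : M.Def R' := by
  obtain ⟨U, hU, h⟩ := h
  exact ⟨U, hU, fun e => (hR e).trans (h e)⟩

theorem imp {R R' : E → Prop} (h : M.Def R) (h' : M.Def R') : M.Def (fun e => R e → R' e) := by
  obtain ⟨U, hU, h⟩ := h
  obtain ⟨U', hU', h'⟩ := h'
  exact ⟨_, hU.imp hU', fun e => imp_congr (h e) (h' e)⟩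

theorem const (p : Prop) : M.Def (fun _ : E => p) :=
  ⟨_, Lang.UDef.const p, fun _ => Iff.rfl⟩

theorem not {R : E → Prop} (h : M.Def R) : M.Def (fun e => ¬ R e) := h.imp (const False)

theorem and {R R' : E → Prop} (h : M.Def R) (h' : M.Def R') : M.Def (fun e => R e ∧ R' e) :=
  (h.imp h'.not).not.congr fun e => by tauto

theorem or {R R' : E → Prop} (h : M.Def R) (h' : M.Def R') : M.Def (fun e => R e ∨ R' e) :=
  (h.not.imp h').congr fun e => by tauto

theorem iff {R R' : E → Prop} (h : M.Def R) (h' : M.Def R') : M.Def (fun e => R e ↔ R' e) :=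
  ((h.imp h').and (h'.imp h)).congr fun e => by tauto

theorem all {R : E → F → Prop} (h : M.Def (fun p : E × F => R p.1 p.2)) :
    M.Def (fun e => ∀ f, R e f) := by
  obtain ⟨U, hU, h⟩ := h
  refine ⟨_, Lang.UDef.forall_block (Ctx.ι M F) (Γ := Ctx.Γ (M := M) (E := E))
    (Ctx.Γ (M := M) (E := F)) (R := fun S v v' => U S (fun i => match i with
      | .inl i => v i
      | .inr i => v' i)) (hU.congr fun S v => iff_of_eq (congrArg _ ?_)), fun e => ?_⟩
  · funext i
    cases i <;> rfl
  · rw [← (Ctx.equiv (M := M) (E := F)).forall_congr_right]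
    exact forall_congr' fun f => h (e, f)

theorem ex {R : E → F → Prop} (h : M.Def (fun p : E × F => R p.1 p.2)) :
    M.Def (fun e => ∃ f, R e f) :=
  (all (R := fun e f => ¬ R e f) h.not).not.congr fun e => by push Not; rfl

theorem forall_finite {κ : Type} [Finite κ] {R : κ → E → Prop} (h : ∀ k, M.Def (R k)) :
    M.Def (fun e => ∀ k, R k e) := by
  choose U hU h using h
  exact ⟨_, Lang.UDef.forall_finite hU, fun e => forall_congr' fun k => h k e⟩

theorem exists_finite {κ : Type} [Finite κ] {R : κ → E → Prop} (h : ∀ k, M.Def (R k)) :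
    M.Def (fun e => ∃ k, R k e) :=
  (forall_finite fun k => (h k).not).not.congr fun e => by push Not; rfl

/-- A map that merely selects coordinates needs no quantifier, only a renaming of variables.
Composition with arbitrary definable maps is derived from this case. -/
theorem reindex {R : F → Prop} (h : M.Def R) (g : E → F) (σ : Ctx.ι M F → Ctx.ι M E)
    (hσ : ∀ j, Ctx.Γ (M := M) (E := E) (σ j) = Ctx.Γ (M := M) (E := F) j)
    (hg : ∀ e j, Ctx.equiv (M := M) (g e) j
      = cast (congrArg M.toStruc.carrier (hσ j)) (Ctx.equiv (M := M) e (σ j))) :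
    M.Def (fun e => R (g e)) := by
  obtain ⟨U, hU, h⟩ := h
  refine ⟨_, hU.rename (Γ' := Ctx.Γ (M := M) (E := E)) σ hσ, fun e => ?_⟩
  exact (h _).trans (iff_of_eq (congrArg _ (funext fun j => hg e j)))

theorem comp_fst {R : E → Prop} (h : M.Def R) : M.Def (fun p : E × F => R p.1) :=
  h.reindex _ Sum.inl (fun _ => rfl) (fun _ _ => rfl)

theorem comp_snd {R : F → Prop} (h : M.Def R) : M.Def (fun p : E × F => R p.2) :=
  h.reindex _ Sum.inr (fun _ => rfl) (fun _ _ => rfl)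

theorem eq : M.Def (fun p : E × E => p.1 = p.2) := by
  refine ⟨_, Lang.UDef.forall_finite fun i : Ctx.ι M E =>
    Lang.UDef.eq (Γ := Ctx.Γ (M := M) (E := E × E)) (i := .inl i) (j := .inr i) rfl, fun p => ?_⟩
  show p.1 = p.2 ↔ _
  rw [← (Ctx.equiv (M := M) (E := E)).injective.eq_iff, funext_iff]
  exact Iff.rfl

theorem comp {R : F → Prop} (h : M.Def R) {g : E → F} (hg : M.DefMap g) :
    M.Def (fun e => R (g e)) :=
  (ex (R := fun e f => f = g e ∧ R f) (hg.and h.comp_snd)).congr fun e => by simp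

end Def

namespace DefMap

theorem of_reindex (g : E → F) (σ : Ctx.ι M F → Ctx.ι M E)
    (hσ : ∀ j, Ctx.Γ (M := M) (E := E) (σ j) = Ctx.Γ (M := M) (E := F) j)
    (hg : ∀ e j, Ctx.equiv (M := M) (g e) j
      = cast (congrArg M.toStruc.carrier (hσ j)) (Ctx.equiv (M := M) e (σ j))) : M.DefMap g := by
  refine (Def.eq (M := M) (E := F)).reindex (fun p : E × F => (p.2, g p.1))
    (Sum.elim Sum.inr fun j => Sum.inl (σ j)) ?_ ?_
  · rintro (j | j)
    · rfl
    · exact hσ j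
  · rintro e (j | j)
    · rfl
    · exact hg _ _

-- With the rules from here on, `fun_prop` recognises maps built from field operations, tuples and
-- projections as definable.
@[fun_prop]
theorem id : M.DefMap (fun e : E => e) := of_reindex _ (fun j => j) (fun _ => rfl) (fun _ _ => rfl)

@[fun_prop]
theorem comp {f : F → G} {g : E → F} (hf : M.DefMap f) (hg : M.DefMap g) :
    M.DefMap (fun e => f (g e)) := by
  refine (Def.ex (E := E × G) (F := F) (R := fun p y => y = g p.1 ∧ p.2 =
      f y) (Def.and ?_ ?_)).congr
    fun p => by simp
  · exact Def.reindex hg (fun p : (E × G) × F => (p.1.1, p.2))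
      (Sum.elim (fun i => .inl (.inl i)) .inr) (by rintro (_ | _) <;> rfl)
      (by rintro _ (_ | _) <;> rfl)
  · exact Def.reindex hf (fun p : (E × G) × F => (p.2, p.1.2))
      (Sum.elim .inr (fun i => .inl (.inr i))) (by rintro (_ | _) <;> rfl)
      (by rintro _ (_ | _) <;> rfl)

@[fun_prop]
theorem fst' : M.DefMap (fun p : E × F => p.1) :=
  of_reindex _ .inl (fun _ => rfl) (fun _ _ => rfl)

@[fun_prop]
theorem snd' : M.DefMap (fun p : E × F => p.2) :=
  of_reindex _ .inr (fun _ => rfl) (fun _ _ => rfl)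

@[fun_prop]
theorem prodMk {f : E → F} {g : E → G} (hf : M.DefMap f) (hg : M.DefMap g) :
    M.DefMap (fun e => (f e, g e)) := by
  refine (Def.and (Def.comp hf (g := fun p : E × (F × G) => (p.1, p.2.1)) ?_)
    (Def.comp hg (g := fun p : E × (F × G) => (p.1, p.2.2)) ?_)).congr fun p => by
      rw [Prod.ext_iff]
  · exact of_reindex _ (Sum.elim .inl (fun i => .inr (.inl i))) (by rintro (_ | _) <;> rfl)
      (by rintro _ (_ | _) <;> rfl)
  · exact of_reindex _ (Sum.elim .inl (fun i => .inr (.inr i))) (by rintro (_ | _) <;> rfl)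
      (by rintro _ (_ | _) <;> rfl)

@[fun_prop]
theorem fst {g : E → F × G} (hg : M.DefMap g) : M.DefMap (fun p => (g p).1) := fst'.comp hg

@[fun_prop]
theorem snd {g : E → F × G} (hg : M.DefMap g) : M.DefMap (fun p => (g p).2) := snd'.comp hg

variable {κ : Type} [Finite κ]

@[fun_prop]
theorem apply (k : κ) : M.DefMap (fun f : κ → E => f k) :=
  of_reindex _ (fun i => (k, i)) (fun _ => rfl) (fun _ _ => rfl)

@[fun_prop]
theorem pi {f : E → κ → F} (hf : ∀ k, M.DefMap (fun e => f e k)) : M.DefMap f := by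
  refine (Def.forall_finite fun k => Def.comp (hf k) (g := fun p : E × (κ → F) => (p.1, p.2 k))
    ?_).congr fun p => by rw [funext_iff]
  fun_prop

theorem val_apply {n : ℕ} {Γ : Fin n → L.base.Srt} (k : Fin n) :
    M.DefMap (fun f : M.toStruc.Val Γ => f k) :=
  of_reindex _ (fun _ => k) (fun _ => rfl) (fun _ _ => rfl)

theorem val_pi {n : ℕ} {Γ : Fin n → L.base.Srt} {f : E → M.toStruc.Val Γ}
    (hf : ∀ k, M.DefMap (fun e => f e k)) : M.DefMap f := by
  refine (Def.forall_finite fun k => Def.comp (hf k)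
    (g := fun p : E × (M.toStruc.Val Γ) => (p.1, p.2 k)) ?_).congr fun p => by rw [funext_iff]
  have := (val_apply (M := M) (Γ := Γ) k).comp (snd' (E := E))
  fun_prop

theorem fn (f : L.base.Fn) :
    M.DefMap (fun v : M.toStruc.Val (L.base.dom f) => M.toStruc.fn f v) := by
  refine ⟨_, (Lang.UDef.fn_graph f).rename
    (Γ' := Ctx.Γ (M := M) (E := M.toStruc.Val (L.base.dom f) × M.toStruc.carrier (L.base.cod f)))
    (fun o => match o with
      | none => .inr ()
      | some i => .inl i) ?_, ?_⟩
  · rintro (_ | _) <;> rfl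
  · intro p
    exact Iff.rfl

theorem rel (r : L.base.Rel) :
    M.Def (fun v : M.toStruc.Val (L.base.relDom r) => M.toStruc.rel r v) :=
  ⟨_, Lang.UDef.rel_graph r, fun _ => Iff.rfl⟩

theorem add' : M.DefMap (fun p : M.K × M.K => p.1 + p.2) :=
  (fn .add).comp (val_pi (Γ := fun _ : Fin 2 => (FSort.field : L.base.Srt))
    (f := fun p : M.K × M.K => fun i => (if i = 0 then p.1 else p.2 : M.K))
    (by
      intro k
      fin_cases k
      · exact fst' (E := M.K) (F := M.K)
      · exact snd' (E := M.K) (F := M.K)))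

theorem mul' : M.DefMap (fun p : M.K × M.K => p.1 * p.2) :=
  (fn .mul).comp (val_pi (Γ := fun _ : Fin 2 => (FSort.field : L.base.Srt))
    (f := fun p : M.K × M.K => fun i => (if i = 0 then p.1 else p.2 : M.K))
    (by
      intro k
      fin_cases k
      · exact fst' (E := M.K) (F := M.K)
      · exact snd' (E := M.K) (F := M.K)))

theorem neg' : M.DefMap (fun p : M.K => -p) :=
  (fn .neg).comp (val_pi (Γ := fun _ : Fin 1 => (FSort.field : L.base.Srt))
    (f := fun p : M.K => fun _ => p) (fun _ => id))

theorem inv' : M.DefMap (fun p : M.K => p⁻¹) :=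
  (fn .inv).comp (val_pi (Γ := fun _ : Fin 1 => (FSort.field : L.base.Srt))
    (f := fun p : M.K => fun _ => p) (fun _ => id))

@[fun_prop]
theorem add {f g : E → M.K} (hf : M.DefMap f) (hg : M.DefMap g) :
    M.DefMap (fun e => f e + g e) := add'.comp (hf.prodMk hg)

@[fun_prop]
theorem mul {f g : E → M.K} (hf : M.DefMap f) (hg : M.DefMap g) :
    M.DefMap (fun e => f e * g e) := mul'.comp (hf.prodMk hg)

@[fun_prop]
theorem neg {f : E → M.K} (hf : M.DefMap f) : M.DefMap (fun e => - f e) := neg'.comp hf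

@[fun_prop]
theorem inv {f : E → M.K} (hf : M.DefMap f) : M.DefMap (fun e => (f e)⁻¹) := inv'.comp hf

@[fun_prop]
theorem sub {f g : E → M.K} (hf : M.DefMap f) (hg : M.DefMap g) :
    M.DefMap (fun e => f e - g e) := by
  simp only [sub_eq_add_neg]; fun_prop

@[fun_prop]
theorem div {f g : E → M.K} (hf : M.DefMap f) (hg : M.DefMap g) :
    M.DefMap (fun e => f e / g e) := by
  simp only [div_eq_mul_inv]; fun_prop

/-- An arbitrary constant map is not definable without parameters, so there can be no general rule
for constants; the ones needed come from `0` and `1`. -/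
theorem zero : M.DefMap (fun _ : E => (0 : M.K)) :=
  (fn .zero).comp (val_pi (Γ := fun _ : Fin 0 => (FSort.field : L.base.Srt))
    (f := fun _ : E => fun i => i.elim0) (fun k => k.elim0))

theorem one : M.DefMap (fun _ : E => (1 : M.K)) :=
  (fn .one).comp (val_pi (Γ := fun _ : Fin 0 => (FSort.field : L.base.Srt))
    (f := fun _ : E => fun i => i.elim0) (fun k => k.elim0))

theorem natCast (n : ℕ) : M.DefMap (fun _ : E => (n : M.K)) := by
  induction n with
  | zero => simpa using zero
  | succ n ih => simpa using ih.add one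

theorem natCast_mul (n : ℕ) {f : E → M.K} (hf : M.DefMap f) :
    M.DefMap (fun e => (n : M.K) * f e) := (natCast n).mul hf

@[fun_prop]
theorem pow {f : E → M.K} (hf : M.DefMap f) (n : ℕ) : M.DefMap (fun e => f e ^ n) := by
  induction n with
  | zero => simpa using one
  | succ n ih => simpa [pow_succ] using ih.mul hf

@[fun_prop]
theorem sum {κ : Type} {f : E → κ → M.K} (s : Finset κ) (hf : ∀ k, M.DefMap (fun e => f e k)) :
    M.DefMap (fun e => ∑ k ∈ s, f e k) := by
  classical
  induction s using Finset.induction_on with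
  | empty => simpa using zero
  | insert a s ha ih => simpa [Finset.sum_insert ha] using (hf a).add ih

@[fun_prop]
theorem prod {κ : Type} {f : E → κ → M.K} (s : Finset κ) (hf : ∀ k, M.DefMap (fun e => f e k)) :
    M.DefMap (fun e => ∏ k ∈ s, f e k) := by
  classical
  induction s using Finset.induction_on with
  | empty => simpa using one
  | insert a s ha ih => simpa [Finset.prod_insert ha] using (hf a).mul ih

@[fun_prop]
theorem snoc {n : ℕ} {f : E → Fin n → F} {g : E → F} (hf : M.DefMap f) (hg : M.DefMap g) :
    M.DefMap (fun e => (Fin.snoc (f e) (g e) : Fin (n + 1) → F)) := by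
  refine pi fun k => ?_
  refine Fin.lastCases ?_ (fun i => ?_) k
  · simpa using hg
  · simp only [Fin.snoc_castSucc]; fun_prop

theorem ite {p : E → Prop} [DecidablePred p] {f g : E → F} (hp : M.Def p) (hf : M.DefMap f)
    (hg : M.DefMap g) : M.DefMap (fun e => if p e then f e else g e) := by
  refine ((Def.and (hp.comp_fst) hf).or (Def.and (hp.comp_fst (F := F)).not hg)).congr fun x => ?_
  by_cases h : p x.1 <;> simp [h]

end DefMap

theorem Def.eq_fun {f g : E → F} (hf : M.DefMap f) (hg : M.DefMap g) :
    M.Def (fun e => f e = g e) :=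
  Def.eq.comp (hf.prodMk hg)

theorem Def.formula {n : ℕ} {Γ : Fin n → L.base.Srt} (φ : L.base.Formula Γ) :
    M.Def (fun v : M.toStruc.Val Γ => φ.Holds M.toStruc v) :=
  ⟨_, Lang.UDef.of_formula φ, fun _ => Iff.rfl⟩

theorem DefMap.val_cons {r : ℕ} {s : L.base.Srt} {Γ : Fin r → L.base.Srt}
    {f : E → M.toStruc.carrier s} {g : E → M.toStruc.Val Γ} (hf : M.DefMap f) (hg : M.DefMap g) :
    M.DefMap (fun e => Lang.Struc.Val.cons (f e) (g e)) := by
  refine DefMap.val_pi fun k => ?_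
  refine Fin.cases ?_ (fun k => ?_) k
  · exact hf
  · exact (DefMap.val_apply k).comp hg

theorem Def.fiber {r : ℕ} {Γ : Fin r → FSort L.Aux}
    (χ : L.base.Formula (extend FSort.field Γ)) {f : E → M.K} {g : E → M.toStruc.Val Γ}
    (hf : M.DefMap f) (hg : M.DefMap g) : M.Def (fun e => f e ∈ M.fiber χ (g e)) :=
  (Def.formula (M := M) χ).comp (DefMap.val_cons (s := (FSort.field : L.base.Srt))
    (Γ := (Γ : Fin r → L.base.Srt)) hf hg)

/-- A definable relation which is functional at `e` is given there by the value of a definable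
function. -/
theorem Def.exists_defMap {R : E → M.K → Prop} (hR : M.Def (fun p : E × M.K => R p.1 p.2)) :
    ∃ g : E → M.K, M.DefMap g ∧ ∀ e x, R e x → (∀ y, R e y → y = x) → g e = x := by
  classical
  have hU : M.Def (fun p : E × M.K => R p.1 p.2 ∧ ∀ y, R p.1 y → y = p.2) := by
    refine hR.and (Def.all (Def.imp ?_ ?_))
    · exact hR.comp (g := fun p : (E × M.K) × M.K => (p.1.1, p.2)) (by fun_prop)
    · exact Def.eq_fun (by fun_prop) (by fun_prop)
  -- The default value `0` is used where `R` has no unique value; it is definable, so the function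
  -- stays definable without parameters.
  refine ⟨fun e => if h : ∃ x, R e x ∧ ∀ y, R e y → y = x then h.choose else 0, ?_, ?_⟩
  · have hex : M.Def (fun e : E => ∃ x, R e x ∧ ∀ y, R e y → y = x) := Def.ex hU
    refine ((Def.and (hex.comp_fst) hU).or (Def.and (hex.comp_fst (F := M.K)).not
      (Def.eq_fun (f := fun p : E × M.K => p.2) (by fun_prop) DefMap.zero))).congr fun p => ?_
    by_cases h : ∃ x, R p.1 x ∧ ∀ y, R p.1 y → y = x
    · simp only [h, dite_true, true_and, not_true_eq_false, false_and, or_false]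
      constructor
      · intro h'
        rw [h']
        exact h.choose_spec
      · intro h'
        exact h.choose_spec.2 _ h'.1
    · simp only [h, dite_false, not_false_eq_true, true_and, false_and, false_or]
  · intro e x hx hy
    have h : ∃ x, R e x ∧ ∀ y, R e y → y = x := ⟨x, hx, hy⟩
    simp only [h, dite_true]
    exact hy _ h.choose_spec.1

end FieldStruc

end MS

/-! ### Transfer of the axioms of topological fields between models. -/

namespace MS

namespace FieldStruc

variable {L : FieldLang.{u}}

/-- Predicates on assignments in structures expanding fields which are defined by one formula for
all structures. -/
def FDef {ι : Type} (Γ : ι → L.base.Srt)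
    (R : ∀ N : FieldStruc L, (∀ i, N.toStruc.carrier (Γ i)) → Prop) : Prop :=
  ∃ U : ∀ S : L.base.Struc, (∀ i, S.carrier (Γ i)) → Prop,
    Lang.UDef Γ U ∧ ∀ N v, R N v ↔ U N.toStruc v

namespace FDef

variable {ι : Type} {Γ : ι → L.base.Srt}
  {R R' : ∀ N : FieldStruc L, (∀ i, N.toStruc.carrier (Γ i)) → Prop}

theorem imp (h : FDef Γ R) (h' : FDef Γ R') : FDef Γ (fun N v => R N v → R' N v) := by
  obtain ⟨U, hU, h⟩ := h
  obtain ⟨U', hU', h'⟩ := h'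
  exact ⟨_, hU.imp hU', fun N v => imp_congr (h N v) (h' N v)⟩

theorem and (h : FDef Γ R) (h' : FDef Γ R') : FDef Γ (fun N v => R N v ∧ R' N v) := by
  obtain ⟨U, hU, h⟩ := h
  obtain ⟨U', hU', h'⟩ := h'
  exact ⟨_, hU.and hU', fun N v => and_congr (h N v) (h' N v)⟩

theorem rename {ι' : Type} {Γ' : ι' → L.base.Srt} (f : ι → ι') (hf : ∀ i, Γ' (f i) = Γ i)
    (h : FDef Γ R) :
    FDef Γ' (fun N v => R N (fun i => cast (congrArg N.toStruc.carrier (hf i)) (v (f i)))) := by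
  obtain ⟨U, hU, h⟩ := h
  exact ⟨_, hU.rename (Γ' := Γ') f hf, fun N v => h N _⟩

theorem not (h : FDef Γ R) : FDef Γ (fun N v => ¬ R N v) := by
  obtain ⟨U, hU, h⟩ := h
  exact ⟨_, hU.not, fun N v => not_congr (h N v)⟩

theorem forall_block {ι' : Type} [Finite ι'] (Γ' : ι' → L.base.Srt)
    {R : ∀ N : FieldStruc L, (∀ i, N.toStruc.carrier (Γ i)) →
      (∀ i, N.toStruc.carrier (Γ' i)) → Prop}
    (h : FDef (Sum.elim Γ Γ') (fun N v => R N (fun i => v (.inl i)) (fun i => v (.inr i)))) :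
    FDef Γ (fun N v => ∀ v', R N v v') := by
  obtain ⟨U, hU, h⟩ := h
  refine ⟨_, Lang.UDef.forall_block ι' (Γ := Γ) Γ' (R := fun S v v' => U S (fun i => match i with
      | .inl i => v i
      | .inr i => v' i)) (hU.congr fun S v => iff_of_eq (congrArg _ ?_)), fun N v =>
      forall_congr' fun v' => ?_⟩
  · funext i
    cases i <;> rfl
  · exact h N (fun i => match i with
      | .inl i => v i
      | .inr i => v' i)

theorem exists_block {ι' : Type} [Finite ι'] (Γ' : ι' → L.base.Srt)
    {R : ∀ N : FieldStruc L, (∀ i, N.toStruc.carrier (Γ i)) →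
      (∀ i, N.toStruc.carrier (Γ' i)) → Prop}
    (h : FDef (Sum.elim Γ Γ') (fun N v => R N (fun i => v (.inl i)) (fun i => v (.inr i)))) :
    FDef Γ (fun N v => ∃ v', R N v v') := by
  obtain ⟨U, hU, h⟩ := (forall_block (Γ := Γ) Γ' (R := fun N v v' => ¬ R N v v') h.not).not
  exact ⟨U, hU, fun N v => by rw [← h]; push Not; rfl⟩

variable {r : ℕ} {Δ : Fin r → FSort L.Aux}

/-- The value of a variable of the field sort. -/
def fld (N : FieldStruc L) (v : ∀ i, N.toStruc.carrier (Γ i)) {i : ι}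
    (h : Γ i = (FSort.field : FSort L.Aux)) : N.K :=
  cast (congrArg N.toStruc.carrier h) (v i)

theorem fiber (χ : L.base.Formula (extend FSort.field Δ)) {x : ι}
    (hx : Γ x = (FSort.field : FSort L.Aux)) (z : Fin r → ι) (hz : ∀ i, Γ (z i) = Δ i) :
    FDef Γ (fun N v => fld N v hx ∈ N.fiber χ (fun i => cast (congrArg N.toStruc.carrier (hz i)) (v
        (z i)))) := by
  refine ⟨_, (Lang.UDef.of_formula χ).rename (Fin.cases x z)
    (fun i => by refine Fin.cases ?_ (fun i => ?_) i; exacts [hx, hz i]), fun N v => ?_⟩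
  refine iff_of_eq (congrArg _ (funext fun i => ?_))
  refine Fin.cases ?_ (fun i => ?_) i <;> rfl

theorem add {i j k : ι} (hi : Γ i = (FSort.field : FSort L.Aux))
    (hj : Γ j = (FSort.field : FSort L.Aux)) (hk : Γ k = (FSort.field : FSort L.Aux)) :
    FDef Γ (fun N v => fld N v hi = fld N v hj + fld N v hk) := by
  refine ⟨_, (Lang.UDef.fn_graph (L := L.base) .add).rename
    (fun o => o.elim i (fun l : Fin 2 => if l = 0 then j else k)) ?_, fun N v => ?_⟩
  · rintro (_ | l)
    · exact hi
    · change Fin 2 at l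
      fin_cases l
      exacts [hj, hk]
  · rfl

theorem mul {i j k : ι} (hi : Γ i = (FSort.field : FSort L.Aux))
    (hj : Γ j = (FSort.field : FSort L.Aux)) (hk : Γ k = (FSort.field : FSort L.Aux)) :
    FDef Γ (fun N v => fld N v hi = fld N v hj * fld N v hk) := by
  refine ⟨_, (Lang.UDef.fn_graph (L := L.base) .mul).rename
    (fun o => o.elim i (fun l : Fin 2 => if l = 0 then j else k)) ?_, fun N v => ?_⟩
  · rintro (_ | l)
    · exact hi
    · change Fin 2 at l
      fin_cases l
      exacts [hj, hk]
  · rfl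

theorem neg {i j : ι} (hi : Γ i = (FSort.field : FSort L.Aux))
    (hj : Γ j = (FSort.field : FSort L.Aux)) :
    FDef Γ (fun N v => fld N v hi = - fld N v hj) := by
  refine ⟨_, (Lang.UDef.fn_graph (L := L.base) .neg).rename
    (fun o => o.elim i (fun _ : Fin 1 => j)) ?_, fun N v => Iff.rfl⟩
  rintro (_ | l)
  exacts [hi, hj]

theorem inv {i j : ι} (hi : Γ i = (FSort.field : FSort L.Aux))
    (hj : Γ j = (FSort.field : FSort L.Aux)) :
    FDef Γ (fun N v => fld N v hi = (fld N v hj)⁻¹) := by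
  refine ⟨_, (Lang.UDef.fn_graph (L := L.base) .inv).rename
    (fun o => o.elim i (fun _ : Fin 1 => j)) ?_, fun N v => Iff.rfl⟩
  rintro (_ | l)
  exacts [hi, hj]

theorem zero {i : ι} (hi : Γ i = (FSort.field : FSort L.Aux)) :
    FDef Γ (fun N v => fld N v hi = 0) := by
  refine ⟨_, (Lang.UDef.fn_graph (L := L.base) .zero).rename
    (fun o => o.elim i (fun l : Fin 0 => l.elim0)) ?_, fun N v => Iff.rfl⟩
  rintro (_ | l)
  exacts [hi, l.elim0]

theorem one {i : ι} (hi : Γ i = (FSort.field : FSort L.Aux)) :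
    FDef Γ (fun N v => fld N v hi = 1) := by
  refine ⟨_, (Lang.UDef.fn_graph (L := L.base) .one).rename
    (fun o => o.elim i (fun l : Fin 0 => l.elim0)) ?_, fun N v => Iff.rfl⟩
  rintro (_ | l)
  exacts [hi, l.elim0]

theorem iff_of_models {Γ : PEmpty.{1} → L.base.Srt}
    {R : ∀ N : FieldStruc L, (∀ i, N.toStruc.carrier (Γ i)) → Prop} (h : FDef Γ R)
    {M N : FieldStruc L} (hM : M.toStruc.Models N.toStruc.theory) :
    R M (fun i => i.elim) ↔ R N (fun i => i.elim) := by
  obtain ⟨U, hU, h⟩ := h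
  rw [h, h]
  exact hU.iff_of_models hM

end FDef

/-- The fibres of `χ` satisfy the axioms of a basis of neighbourhoods of `0` of a topological
field. -/
def RingBasisAxioms (N : FieldStruc L) {r : ℕ} {Γ : Fin r → FSort L.Aux}
    (χ : L.base.Formula (extend FSort.field Γ)) : Prop :=
  ∀ z₁ z₂ : N.toStruc.Val (L := L.base) Γ, ∀ p : Fin 1 → N.K,
    ∃ z' : N.toStruc.Val (L := L.base) Γ, ∀ v : Fin 11 → N.K,
    v 2 = v 0 + v 1 → v 3 = - v 0 → v 4 = v 0 * v 1 → v 5 = p 0 * v 0 → v 6 = p 0 + v 0 →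
    v 7 = (v 6)⁻¹ → v 8 = (p 0)⁻¹ → v 7 = v 8 + v 9 → v 10 = 0 →
    v 0 ∈ N.fiber χ z' → v 1 ∈ N.fiber χ z' →
    v 0 ∈ N.fiber χ z₁ ∧ v 0 ∈ N.fiber χ z₂ ∧ v 2 ∈ N.fiber χ z₁ ∧ v 3 ∈ N.fiber χ z₁ ∧
    v 4 ∈ N.fiber χ z₁ ∧ v 5 ∈ N.fiber χ z₁ ∧ (¬ p 0 = 0 → v 9 ∈ N.fiber χ z₁) ∧
    v 10 ∈ N.fiber χ z₁

/-- In `RingBasisAxioms` every intermediate value has a variable of its own, tied to the others by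
equations. The formula can therefore be assembled from graphs of field operations and fibres at
variables. The variable `9` stands for the difference of two inverses, which expresses continuity of
inversion. -/
theorem fDef_ringBasisAxioms {r : ℕ} {Γ : Fin r → FSort L.Aux}
    (χ : L.base.Formula (extend FSort.field Γ)) :
    FDef (L := L) (fun i : PEmpty => i.elim) (fun N _ => N.RingBasisAxioms χ) := by
  refine FDef.forall_block Γ (FDef.forall_block Γ (FDef.forall_block (ι' := Fin 1)
    (fun _ => FSort.field) (FDef.exists_block Γ (FDef.forall_block (ι' := Fin 11)
    (fun _ => FSort.field) ?_))))
  refine FDef.imp (FDef.add (i := Sum.inr 2) (j := Sum.inr 0) (k := Sum.inr 1) rfl rfl rfl) ?_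
  refine FDef.imp (FDef.neg (i := Sum.inr 3) (j := Sum.inr 0) rfl rfl) ?_
  refine FDef.imp (FDef.mul (i := Sum.inr 4) (j := Sum.inr 0) (k := Sum.inr 1) rfl rfl rfl) ?_
  refine FDef.imp (FDef.mul (i := Sum.inr 5) (j := Sum.inl (Sum.inl (Sum.inr 0))) (k :=
      Sum.inr 0) rfl rfl rfl) ?_
  refine FDef.imp (FDef.add (i := Sum.inr 6) (j := Sum.inl (Sum.inl (Sum.inr 0))) (k :=
      Sum.inr 0) rfl rfl rfl) ?_
  refine FDef.imp (FDef.inv (i := Sum.inr 7) (j := Sum.inr 6) rfl rfl) ?_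
  refine FDef.imp (FDef.inv (i := Sum.inr 8) (j := Sum.inl (Sum.inl (Sum.inr 0))) rfl rfl) ?_
  refine FDef.imp (FDef.add (i := Sum.inr 7) (j := Sum.inr 8) (k := Sum.inr 9) rfl rfl rfl) ?_
  refine FDef.imp (FDef.zero (i := Sum.inr 10) rfl) ?_
  have h' : ∀ k : Fin 11, _ := fun k => FDef.fiber (Γ := Sum.elim (Sum.elim (Sum.elim (Sum.elim
    (Sum.elim (fun i : PEmpty => i.elim) Γ) Γ) (fun _ : Fin 1 => FSort.field)) Γ)
    (fun _ : Fin 11 => FSort.field)) χ (x := Sum.inr k) rfl (fun i => Sum.inl (Sum.inr i)) (fun i =>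
        rfl)
  have h₁ : ∀ k : Fin 11, _ := fun k => FDef.fiber (Γ := Sum.elim (Sum.elim (Sum.elim (Sum.elim
    (Sum.elim (fun i : PEmpty => i.elim) Γ) Γ) (fun _ : Fin 1 => FSort.field)) Γ)
    (fun _ : Fin 11 => FSort.field)) χ (x := Sum.inr k) rfl
    (fun i => Sum.inl (Sum.inl (Sum.inl (Sum.inl (Sum.inr i))))) (fun i => rfl)
  have h₂ : ∀ k : Fin 11, _ := fun k => FDef.fiber (Γ := Sum.elim (Sum.elim (Sum.elim (Sum.elim
    (Sum.elim (fun i : PEmpty => i.elim) Γ) Γ) (fun _ : Fin 1 => FSort.field)) Γ)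
    (fun _ : Fin 11 => FSort.field)) χ (x := Sum.inr k) rfl
    (fun i => Sum.inl (Sum.inl (Sum.inl (Sum.inr i)))) (fun i => rfl)
  refine FDef.imp (h' 0) (FDef.imp (h' 1) (FDef.and (h₁ 0) (FDef.and (h₂ 0) (FDef.and (h₁ 2)
    (FDef.and (h₁ 3) (FDef.and (h₁ 4) (FDef.and (h₁ 5) (FDef.and (FDef.imp ?_ (h₁ 9))
    (h₁ 10)))))))))
  exact FDef.not (FDef.zero (i := Sum.inl (Sum.inl (Sum.inr 0))) rfl)

theorem fDef_separated {r : ℕ} {Γ : Fin r → FSort L.Aux}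
    (χ : L.base.Formula (extend FSort.field Γ)) :
    FDef (L := L) (fun i : PEmpty => i.elim) (fun N _ => ∀ x : Fin 1 → N.K, ¬ x 0 = 0 →
      ∃ z : N.toStruc.Val (L := L.base) Γ, ¬ x 0 ∈ N.fiber χ z) := by
  refine FDef.forall_block (ι' := Fin 1) (fun _ => FSort.field)
    (FDef.imp (FDef.not (FDef.zero (i := Sum.inr 0) rfl)) (FDef.exists_block Γ (FDef.not ?_)))
  exact FDef.fiber (Γ := Sum.elim (Sum.elim (fun i : PEmpty => i.elim)
    (fun _ : Fin 1 => FSort.field)) Γ) χ (x := Sum.inl (Sum.inr 0)) rfl (fun i => Sum.inr i) (fun i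
        => rfl)

theorem fDef_nondiscrete {r : ℕ} {Γ : Fin r → FSort L.Aux}
    (χ : L.base.Formula (extend FSort.field Γ)) :
    FDef (L := L) (fun i : PEmpty => i.elim) (fun N _ => ∀ z : N.toStruc.Val (L := L.base) Γ,
      ∃ x : Fin 1 → N.K, ¬ x 0 = 0 ∧ x 0 ∈ N.fiber χ z) := by
  refine FDef.forall_block Γ (FDef.exists_block (ι' := Fin 1) (fun _ => FSort.field)
    (FDef.and (FDef.not (FDef.zero (i := Sum.inr 0) rfl)) ?_))
  exact FDef.fiber (Γ := Sum.elim (Sum.elim (fun i : PEmpty => i.elim) Γ)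
    (fun _ : Fin 1 => FSort.field)) χ (x := Sum.inr 0) rfl (fun i => Sum.inl (Sum.inr i)) (fun i =>
        rfl)

theorem fDef_natCast (n : ℕ) : FDef (L := L) (fun _ : Unit => FSort.field)
    (fun N v => FDef.fld N v (i := ()) rfl = (n : N.K)) := by
  induction n with
  | zero =>
    obtain ⟨U, hU, h⟩ := FDef.zero (L := L) (Γ := fun _ : Unit => FSort.field) (i := ()) rfl
    exact ⟨U, hU, fun N v => by rw [← h]; simp⟩
  | succ n ih =>
    have h := FDef.exists_block (ι' := Fin 2) (Γ := fun _ : Unit => (FSort.field : L.base.Srt))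
      (fun _ => FSort.field) (R := fun N v w => (show N.K from w 0) = n ∧ (show N.K from w 1) = 1 ∧
        FDef.fld N v (i := ()) rfl = (show N.K from w 0) + (show N.K from w 1)) ?_
    · obtain ⟨U, hU, h⟩ := h
      refine ⟨U, hU, fun N v => ?_⟩
      rw [← h]
      constructor
      · intro h
        exact ⟨fun i : Fin 2 => if i = 0 then (n : N.K) else (1 : N.K), rfl, rfl, by
          rw [h]; push_cast; rfl⟩
      · rintro ⟨w, h0, h1, h⟩
        rw [h, h0, h1]
        push_cast
        rfl
    · refine FDef.and ?_ (FDef.and ?_ ?_)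
      · exact ih.rename (Γ' := Sum.elim (fun _ : Unit => (FSort.field : L.base.Srt))
          (fun _ : Fin 2 => FSort.field)) (fun _ => Sum.inr 0) (fun _ => rfl)
      · exact FDef.one (i := Sum.inr 1) rfl
      · exact FDef.add (i := Sum.inl ()) (j := Sum.inr 0) (k := Sum.inr 1) rfl rfl rfl

theorem charZero_of_models {M N : FieldStruc L} (hM : M.toStruc.Models N.toStruc.theory)
    [CharZero N.K] : CharZero M.K := by
  refine charZero_of_inj_zero fun n hn => ?_
  have h' : FDef (L := L) (fun i : PEmpty => i.elim) (fun N _ => ∃ x : Fin 1 → N.K,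
      x 0 = n ∧ x 0 = 0) := by
    refine FDef.exists_block (ι' := Fin 1) (fun _ => FSort.field)
      (FDef.and ?_ (FDef.zero (i := Sum.inr 0) rfl))
    exact (fDef_natCast (L := L) n).rename (Γ' := Sum.elim
      (fun i : PEmpty => (i.elim : L.base.Srt)) (fun _ : Fin 1 => FSort.field))
      (fun _ => Sum.inr 0) (fun _ => rfl)
  obtain ⟨x, h1, h2⟩ := (h'.iff_of_models hM).1 ⟨fun _ => 0, hn.symm, rfl⟩
  exact_mod_cast h1.symm.trans h2

end FieldStruc

end MS

namespace MS

namespace FieldStruc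

open Topology Filter

variable {L : FieldLang.{u}}

/-! ### The topology on the models -/

section Transfer

variable {r : ℕ} {Γ : Fin r → FSort L.Aux} {χ : L.base.Formula (extend FSort.field Γ)}

theorem DefinesFieldTopology.ringBasisAxioms {N : FieldStruc L} (h : N.DefinesFieldTopology χ) :
    N.RingBasisAxioms χ := by
  obtain ⟨_, _, _, -, hb⟩ := h
  intro z₁ z₂ p
  have hV : ∀ z, N.fiber χ z ∈ 𝓝 (0 : N.K) := fun z => hb.mem_of_mem trivial
  have h1 : ∀ {f : N.K → N.K}, ContinuousAt f 0 → f 0 = 0 → ∀ z, ∀ᶠ v in 𝓝 0, f v ∈ N.fiber χ z :=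
      by
    intro f hf h0 z
    exact hf.tendsto.eventually (by rw [h0]; exact hV z)
  have h2 : ∀ {f : N.K × N.K → N.K}, Continuous f → f 0 = 0 → ∀ z, ∀ᶠ v in 𝓝 0 ×ˢ 𝓝 0,
      f v ∈ N.fiber χ z := by
    intro f hf h0 z
    rw [← nhds_prod_eq]
    exact hf.tendsto _ |>.eventually (by rw [show f (0, 0) = 0 from h0]; exact hV z)
  have e1 := (h1 continuousAt_id rfl z₁).and <| (h1 continuousAt_id rfl z₂).and <|
    (h1 (f := fun v => -v) (by fun_prop) (by simp) z₁).and <|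
    (h1 (f := fun v => p 0 * v) (by fun_prop) (by simp) z₁).and <|
    (show ∀ᶠ v in 𝓝 (0 : N.K), ¬ p 0 = 0 → (p 0 + v)⁻¹ - (p 0)⁻¹ ∈ N.fiber χ z₁ from by
      by_cases hp : p 0 = 0
      · simp [hp]
      · simp only [hp, not_false_eq_true, forall_const]
        refine h1 (f := fun v => (p 0 + v)⁻¹ - (p 0)⁻¹) ?_ (by simp) z₁
        exact (ContinuousAt.inv₀ (by fun_prop) (by simpa using hp)).sub (by fun_prop))
  have e2 := (h2 (f := fun v => v.1 + v.2) (by fun_prop) (by simp) z₁).and <|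
    (h2 (f := fun v => v.1 * v.2) (by fun_prop) (by simp) z₁)
  obtain ⟨z', -, hz'⟩ := (hb.prod_self).eventually_iff.1 (e2.and (tendsto_fst.eventually e1))
  refine ⟨z', fun v c2 c3 c4 c5 c6 c7 c8 c9 c10 m0 m1 => ?_⟩
  obtain ⟨⟨a2, a4⟩, a0, a0', a3, a5, a9⟩ := hz' (x := (v 0, v 1)) ⟨m0, m1⟩
  rw [c2, c3, c4, c5, c10]
  refine ⟨a0, a0', a2, a3, a4, a5, fun hp => ?_, mem_of_mem_nhds (hV z₁)⟩
  have : v 9 = (p 0 + v 0)⁻¹ - (p 0)⁻¹ := by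
    rw [← c6, ← c7, ← c8, c9]; ring
  rw [this]
  exact a9 hp

theorem RingBasisAxioms.exists_topology {N : FieldStruc L} (h : N.RingBasisAxioms χ)
    (hsep : ∀ x : Fin 1 → N.K, ¬ x 0 = 0 → ∃ z : N.toStruc.Val (L := L.base) Γ, ¬ x 0 ∈ N.fiber χ z)
    (hnd : ∀ z : N.toStruc.Val (L := L.base) Γ, ∃ x : Fin 1 → N.K, ¬ x 0 = 0 ∧ x 0 ∈ N.fiber χ z) :
    ∃ _τ : TopologicalSpace N.K, IsTopologicalDivisionRing N.K ∧ T2Space N.K ∧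
      (𝓝[≠] (0 : N.K)).NeBot ∧
      (𝓝 (0 : N.K)).HasBasis (fun _ => True) (N.fiber χ) := by
  have h' : ∀ z₁ z₂ p, ∃ z', ∀ a ∈ N.fiber χ z', ∀ b ∈ N.fiber χ z', a ∈ N.fiber χ z₁ ∧
      a ∈ N.fiber χ z₂ ∧ a + b ∈ N.fiber χ z₁ ∧ -a ∈ N.fiber χ z₁ ∧ a * b ∈ N.fiber χ z₁ ∧
      p * a ∈ N.fiber χ z₁ ∧ (¬ p = 0 → (p + a)⁻¹ - p⁻¹ ∈ N.fiber χ z₁) ∧ 0 ∈ N.fiber χ z₁ := by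
    intro z₁ z₂ p
    obtain ⟨z', hz'⟩ := h z₁ z₂ (fun _ => p)
    refine ⟨z', fun a ha b hb => ?_⟩
    exact hz' ![a, b, a + b, -a, a * b, p * a, p + a, (p + a)⁻¹, p⁻¹, (p + a)⁻¹ - p⁻¹, 0]
      rfl rfl rfl rfl rfl rfl rfl (by simp) rfl ha hb
  have h0 : ∀ z, (0 : N.K) ∈ N.fiber χ z := by
    intro z
    obtain ⟨z', hz'⟩ := h' z z 0
    -- The axioms only speak about elements of the smaller fibre; non-discreteness ensures that
    -- there is one.
    obtain ⟨x, -, hx⟩ := hnd z'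
    exact (hz' _ hx _ hx).2.2.2.2.2.2.2
  obtain ⟨z₀, -⟩ := hsep (fun _ => 1) one_ne_zero
  let B : RingFilterBasis N.K :=
    { sets := Set.range (N.fiber χ)
      nonempty := ⟨_, z₀, rfl⟩
      inter_sets := by
        rintro _ _ ⟨z₁, rfl⟩ ⟨z₂, rfl⟩
        obtain ⟨z', hz'⟩ := h' z₁ z₂ 0
        exact ⟨_, ⟨z', rfl⟩, fun a ha => ⟨(hz' a ha a ha).1, (hz' a ha a ha).2.1⟩⟩
      zero' := by
        rintro _ ⟨z, rfl⟩
        exact h0 z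
      add' := by
        rintro _ ⟨z, rfl⟩
        obtain ⟨z', hz'⟩ := h' z z 0
        refine ⟨_, ⟨z', rfl⟩, ?_⟩
        rintro _ ⟨a, ha, b, hb, rfl⟩
        exact (hz' a ha b hb).2.2.1
      neg' := by
        rintro _ ⟨z, rfl⟩
        obtain ⟨z', hz'⟩ := h' z z 0
        exact ⟨_, ⟨z', rfl⟩, fun a ha => (hz' a ha a ha).2.2.2.1⟩
      conj' := by
        rintro x _ ⟨z, rfl⟩
        exact ⟨_, ⟨z, rfl⟩, fun a ha => by simpa using ha⟩
      mul' := by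
        rintro _ ⟨z, rfl⟩
        obtain ⟨z', hz'⟩ := h' z z 0
        refine ⟨_, ⟨z', rfl⟩, ?_⟩
        rintro _ ⟨a, ha, b, hb, rfl⟩
        exact (hz' a ha b hb).2.2.2.2.1
      mul_left' := by
        rintro p _ ⟨z, rfl⟩
        obtain ⟨z', hz'⟩ := h' z z p
        exact ⟨_, ⟨z', rfl⟩, fun a ha => (hz' a ha a ha).2.2.2.2.2.1⟩
      mul_right' := by
        rintro p _ ⟨z, rfl⟩
        obtain ⟨z', hz'⟩ := h' z z p
        exact ⟨_, ⟨z', rfl⟩, fun a ha => by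
          simpa [mul_comm] using (hz' a ha a ha).2.2.2.2.2.1⟩ }
  let := B.topology
  have hb : (𝓝 (0 : N.K)).HasBasis (fun _ => True) (N.fiber χ) := by
    refine B.toAddGroupFilterBasis.nhds_zero_hasBasis.to_hasBasis ?_ ?_
    · rintro _ ⟨z, rfl⟩
      exact ⟨z, trivial, subset_rfl⟩
    · intro z _
      exact ⟨_, ⟨z, rfl⟩, subset_rfl⟩
  have : IsTopologicalRing N.K := B.isTopologicalRing
  refine ⟨inferInstance, { continuousAt_inv₀ := ?_ }, ?_, ?_, hb⟩
  rotate_left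
  · refine IsTopologicalAddGroup.t2Space_of_zero_sep fun x hx => ?_
    obtain ⟨z, hz⟩ := hsep (fun _ => x) hx
    exact ⟨_, hb.mem_of_mem trivial, hz⟩
  · refine nhdsWithin_neBot.2 fun t ht => ?_
    obtain ⟨z, -, hz⟩ := hb.mem_iff.1 ht
    obtain ⟨x, hx, hx'⟩ := hnd z
    exact ⟨x 0, hz hx', hx⟩
  intro p hp
  have : Tendsto (fun a => (p + a)⁻¹ - p⁻¹) (𝓝 0) (𝓝 0) := by
    rw [hb.tendsto_iff hb]
    intro z _
    obtain ⟨z', hz'⟩ := h' z z p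
    exact ⟨z', trivial, fun a ha => (hz' a ha a ha).2.2.2.2.2.2.1 hp⟩
  rw [ContinuousAt]
  have h3 : Tendsto (fun x : N.K => (p + (x - p))⁻¹ - p⁻¹ + p⁻¹) (𝓝 p) (𝓝 (0 + p⁻¹)) := by
    refine Tendsto.add_const _ (this.comp ?_)
    have : Tendsto (fun x : N.K => x - p) (𝓝 p) (𝓝 (p - p)) := Continuous.tendsto (by fun_prop) p
    simpa using this
  simpa using h3

theorem DefinesFieldTopology.separated {N : FieldStruc L} (h : N.DefinesFieldTopology χ)
    (x : Fin 1 → N.K) (hx : ¬ x 0 = 0) :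
    ∃ z : N.toStruc.Val (L := L.base) Γ, ¬ x 0 ∈ N.fiber χ z := by
  obtain ⟨_, _, _, -, hb⟩ := h
  have : {x 0}ᶜ ∈ 𝓝 (0 : N.K) := isOpen_compl_singleton.mem_nhds (fun h => hx h.symm)
  obtain ⟨z, -, hz⟩ := hb.mem_iff.1 this
  exact ⟨z, fun h => hz h rfl⟩

theorem DefinesFieldTopology.nondiscrete {N : FieldStruc L} (h : N.DefinesFieldTopology χ)
    (z : N.toStruc.Val (L := L.base) Γ) : ∃ x : Fin 1 → N.K, ¬ x 0 = 0 ∧ x 0 ∈ N.fiber χ z := by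
  obtain ⟨_, _, _, hd, hb⟩ := h
  by_contra! hz
  refine hd (discreteTopology_of_isOpen_singleton_zero ?_)
  have h0 : N.fiber χ z ∈ 𝓝 (0 : N.K) := hb.mem_of_mem trivial
  rw [isOpen_singleton_iff_punctured_nhds, ← not_neBot, nhdsWithin_neBot]
  intro H
  obtain ⟨x, hx, hx'⟩ := H h0
  exact hz (fun _ => x) hx' hx

end Transfer

/-- Topological fields with the structure of a model of a NIP open theory. -/
class IsTame (M : FieldStruc L) [TopologicalSpace M.K] : Prop
    extends IsTopologicalDivisionRing M.K, T2Space M.K, CharZero M.K where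
  neBot : (𝓝[≠] (0 : M.K)).NeBot
  exists_basis : ∃ (Z : Type u) (_ : Ctx M Z) (B : Z → Set M.K),
    M.Def (fun p : M.K × Z => p.1 ∈ B p.2) ∧ (𝓝 (0 : M.K)).HasBasis (fun _ => True) B
  exists_polynomials : ∀ {k : ℕ} {R : (Fin k → M.K) → Prop}, M.Def R →
    ∃ A : Finset (MvPolynomial (Fin k) M.K),
      (∀ P ∈ A, P ≠ 0 ∧ P ∈ Set.range
        (MvPolynomial.map (σ := Fin k) (MvPolynomial.aeval M.const :
            MvPolynomial L.Const ℤ →ₐ[ℤ] M.K).toRingHom)) ∧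
      ∀ x, R x → ∀ᶠ y in 𝓝 x, (∀ P ∈ A, MvPolynomial.eval x P = 0 → MvPolynomial.eval y P = 0) →
        R y
  nip : ∀ {E F : Type u} [Ctx M E] [Ctx M F] {R : E → F → Prop},
    M.Def (fun p : E × F => R p.1 p.2) →
    ∃ N, ¬ ∃ (a : Fin N → E) (b : Set (Fin N) → F), ∀ i J, R (a i) (b J) ↔ i ∈ J

attribute [instance] IsTame.neBot

theorem Def.exists_formula {M : FieldStruc L} {k : ℕ} {R : (Fin k → M.K) → Prop} (hR : M.Def R) :
    ∃ φ : L.base.Formula (fun _ : Fin k => FSort.field), ∀ x, R x ↔ M.HoldsAt φ x := by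
  obtain ⟨U, ⟨n, ρ, φ, hφ⟩, h⟩ := hR
  obtain ⟨φ', h'⟩ := φ.exists_rename (Δ := fun _ : Fin k => (FSort.field : L.base.Srt))
    (fun i => (ρ i).1) (fun i => rfl)
  refine ⟨φ', fun x => ?_⟩
  exact (h x).trans ((hφ M.toStruc _).symm.trans (h' M.toStruc (fun i => x i)).symm)

theorem _root_.MS.Lang.Struc.IsNIP.exists_not_shatter {M : FieldStruc L} (hM : M.toStruc.IsNIP)
    {E F : Type u} [Ctx M E] [Ctx M F] {R : E → F → Prop}
    (hR : M.Def (fun p : E × F => R p.1 p.2)) :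
    ∃ N, ¬ ∃ (a : Fin N → E) (b : Set (Fin N) → F), ∀ i J, R (a i) (b J) ↔ i ∈ J := by
  classical
  by_contra! H
  obtain ⟨U, ⟨n, ρ, φ, hφ⟩, h⟩ := hR
  refine hM _ φ (Finset.univ.filter fun k => (ρ k).isLeft) fun N => ?_
  -- Only one half of each assignment matters. The configuration of size one provides values for the
  -- other half.
  obtain ⟨a₀, b₀, -⟩ := H 1
  obtain ⟨a, b, hab⟩ := H N
  refine ⟨fun i k => Ctx.equiv (M := M) (a i, b₀ ∅) (ρ k),
    fun J k => Ctx.equiv (M := M) (a₀ 0, b J) (ρ k), fun i J => ?_⟩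
  refine Iff.trans ?_ (((h (a i, b J)).trans (hφ _ _).symm).symm.trans (hab i J))
  refine iff_of_eq (congrArg _ (funext fun k => ?_))
  simp only [Finset.mem_filter, Finset.mem_univ, true_and]
  rcases ρ k with j | j
  · simp only [Sum.isLeft_inl, if_true]; rfl
  · simp only [Sum.isLeft_inr, Bool.false_eq_true, if_false]; rfl

/-- A point of a definable set satisfies one disjunct of the normal form. Nearby points satisfying
the equations of that disjunct remain in the set because `θ` is open. Collecting the polynomials of
all disjuncts gives the condition on polynomials in `IsTame`. -/
theorem isTame_of_models {r : ℕ} {Γ : Fin r → FSort L.Aux}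
    {χ : L.base.Formula (extend FSort.field Γ)} {N : FieldStruc L} (hN : N.DefinesFieldTopology χ)
    [CharZero N.K] (hA : IsOpenTheory N.toStruc.theory χ) {M : FieldStruc L}
    (hM : M.toStruc.Models N.toStruc.theory) (hnip : M.toStruc.IsNIP) :
    ∃ _ : TopologicalSpace M.K, M.IsTame ∧ (𝓝 (0 : M.K)).HasBasis (fun _ => True) (M.fiber χ) := by
  obtain ⟨τ, h1, h2, h3, hb⟩ := RingBasisAxioms.exists_topology (N := M) (χ := χ)
    (((fDef_ringBasisAxioms χ).iff_of_models hM).2 hN.ringBasisAxioms)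
    (((fDef_separated χ).iff_of_models hM).2 hN.separated)
    (((fDef_nondiscrete χ).iff_of_models hM).2 hN.nondiscrete)
  have h4 := charZero_of_models hM
  refine ⟨τ, { neBot := h3, exists_basis := ?_, exists_polynomials := ?_, nip := ?_ }, hb⟩
  · exact ⟨M.toStruc.Val (L := L.base) Γ, inferInstance, M.fiber χ,
      Def.fiber χ (by fun_prop) (by fun_prop), hb⟩
  · intro k R hR
    classical
    obtain ⟨φ, hφ⟩ := hR.exists_formula
    obtain ⟨ψ, hψ, hψ'⟩ := hA.elim _ φ
    obtain ⟨n, A, θ, h⟩ := hA.form k ψ hψ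
    obtain ⟨hA0, hθ, h⟩ := h M hM
    refine ⟨Finset.univ.biUnion fun i => (A i).image M.interpret, ?_, fun x hx => ?_⟩
    · intro P hP
      simp only [Finset.mem_biUnion, Finset.mem_univ, true_and, Finset.mem_image] at hP
      obtain ⟨i, Q, hQ, rfl⟩ := hP
      exact ⟨hA0 i Q hQ, Q, rfl⟩
    · have h' : ∀ x, R x ↔ ∃ i, (∀ P ∈ A i, MvPolynomial.eval x (M.interpret P) = 0) ∧
          M.HoldsAt (θ i) x := fun x => (hφ x).trans ((hψ' M.toStruc hM _).trans (h x))
      obtain ⟨i, hi, hx⟩ := (h' x).1 hx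
      obtain ⟨z, hz⟩ := hθ i x hx
      have : ∀ᶠ y in 𝓝 x, ∀ j, y j - x j ∈ M.fiber χ z := by
        refine eventually_all.2 fun j => ?_
        have : Tendsto (fun y : Fin k → M.K => y j - x j) (𝓝 x) (𝓝 (x j - x j)) :=
          Continuous.tendsto (by fun_prop) x
        rw [sub_self] at this
        exact this.eventually (hb.mem_of_mem trivial)
      filter_upwards [this] with y hy hP
      refine (h' y).2 ⟨i, fun P hP' => hP _ ?_ (hi P hP'), hz y hy⟩
      simp only [Finset.mem_biUnion, Finset.mem_univ, true_and, Finset.mem_image]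
      exact ⟨i, P, hP', rfl⟩
  · intro E F _ _ R hR
    exact hnip.exists_not_shatter hR

end FieldStruc

end MS

namespace MS

open Topology Filter

/-! ### Polynomials with bounded exponents and small sets -/

section Small

variable {K : Type*}

/-- Sets of dimension less than `n`. -/
def Small : ∀ {n : ℕ}, Set (Fin n → K) → Prop
  | 0, X => X = ∅
  | n + 1, X => Small {x : Fin n → K | {y | (Fin.snoc x y : Fin (n + 1) → K) ∈ X}.Infinite}

theorem small_succ {n : ℕ} {X : Set (Fin (n + 1) → K)} :
    Small X ↔ Small {x : Fin n → K | {y | (Fin.snoc x y : Fin (n + 1) → K) ∈ X}.Infinite} :=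
  Iff.rfl

theorem Small.mono : ∀ {n : ℕ} {X Y : Set (Fin n → K)}, Small Y → X ⊆ Y → Small X
  | 0, _, _, h, hXY => Set.subset_eq_empty hXY h
  | _ + 1, _, _, h, hXY => small_succ.2 <| Small.mono (small_succ.1 h) fun _ hx =>
    Set.Infinite.mono (fun _ hy => hXY hy) (Set.mem_ofPred.1 hx)

theorem Small.union {n : ℕ} {X Y : Set (Fin n → K)} (h : Small X) (h' : Small Y) :
    Small (X ∪ Y) := by
  induction n with
  | zero =>
    simp only [Small] at h h' ⊢
    rw [h, h', Set.union_empty]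
  | succ n ih =>
    refine small_succ.2 ((ih (small_succ.1 h) (small_succ.1 h')).mono fun x hx => ?_)
    exact Set.infinite_union.1 (Set.mem_ofPred.1 hx)

theorem small_empty : ∀ {n : ℕ}, Small (∅ : Set (Fin n → K))
  | 0 => rfl
  | n + 1 => by
    refine small_succ.2 ((small_empty (n := n)).mono fun x hx => ?_)
    simp at hx

theorem Small.biUnion {ι : Type*} {n : ℕ} {X : ι → Set (Fin n → K)} (s : Finset ι)
    (h : ∀ i ∈ s, Small (X i)) : Small (⋃ i ∈ s, X i) := by
  classical
  induction s using Finset.induction_on with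
  | empty => simpa using small_empty
  | insert a s ha ih =>
    rw [Finset.set_biUnion_insert]
    exact (h a (by simp)).union (ih fun i hi => h i (by simp [hi]))

variable [Field K]

/-- The value at `x` of the polynomial with exponents at most `D` whose coefficients are `p`. -/
def boxEval {n D : ℕ} (p : (Fin n → Fin (D + 1)) → K) (x : Fin n → K) : K :=
  ∑ s, p s * ∏ i, x i ^ (s i : ℕ)

theorem boxEval_snoc {n D : ℕ} (p : (Fin (n + 1) → Fin (D + 1)) → K) (x : Fin n → K) (y : K) :
    boxEval p (Fin.snoc x y)
      = ∑ j : Fin (D + 1), boxEval (fun s => p (Fin.snoc s j)) x * y ^ (j : ℕ) := by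
  simp only [boxEval, Finset.sum_mul]
  rw [← (Fin.snocEquiv (fun _ : Fin (n + 1) => Fin (D + 1))).sum_comp, Fintype.sum_prod_type]
  refine Finset.sum_congr rfl fun j _ => Finset.sum_congr rfl fun s _ => ?_
  simp [Fin.snocEquiv, Fin.prod_univ_castSucc, mul_assoc]

theorem finite_of_sum_pow_eq_zero {D : ℕ} {c : Fin (D + 1) → K} (hc : c ≠ 0) :
    {y : K | ∑ j, c j * y ^ (j : ℕ) = 0}.Finite ∧
      {y : K | ∑ j, c j * y ^ (j : ℕ) = 0}.ncard ≤ D := by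
  classical
  let P : Polynomial K := ∑ j : Fin (D + 1), Polynomial.monomial (j : ℕ) (c j)
  have hP : P ≠ 0 := by
    obtain ⟨j, hj⟩ := Function.ne_iff.1 hc
    intro h
    refine hj ?_
    have := congrArg (fun Q => Q.coeff (j : ℕ)) h
    simpa [P, Polynomial.finsetSum_coeff, Polynomial.coeff_monomial, Fin.val_inj] using this
  have hD : P.natDegree ≤ D := by
    refine Polynomial.natDegree_sum_le_of_forall_le _ _ fun j _ => ?_
    exact (Polynomial.natDegree_monomial_le _).trans (Nat.lt_succ_iff.1 j.2)
  have hS : {y : K | ∑ j, c j * y ^ (j : ℕ) = 0} = ↑P.roots.toFinset := by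
    ext y
    simp [hP, P, Polynomial.eval_finsetSum, Polynomial.IsRoot]
  rw [hS]
  refine ⟨Finset.finite_toSet _, ?_⟩
  rw [Set.ncard_coe_finset]
  exact (Multiset.toFinset_card_le _).trans ((Polynomial.card_roots' _).trans hD)

/-- Expand in powers of the last variable. Where some coefficient is nonzero the fibre is finite, so
infinite fibres lie over the zero set of a nonzero polynomial in fewer variables. -/
theorem small_boxEval_eq_zero : ∀ {n D : ℕ} {p : (Fin n → Fin (D + 1)) → K}, p ≠ 0 →
    Small {x | boxEval p x = 0}
  | 0, D, p, hp => by
    refine Set.eq_empty_iff_forall_notMem.2 fun x hx => hp (funext fun s => ?_)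
    simp only [boxEval, Set.mem_ofPred_eq, Finset.univ_unique, Finset.sum_singleton,
      Finset.univ_eq_empty, Finset.prod_empty, mul_one] at hx
    exact (congrArg p (Subsingleton.elim _ _)).trans hx
  | n + 1, D, p, hp => by
    obtain ⟨s, hs⟩ := Function.ne_iff.1 hp
    have : (fun s' => p (Fin.snoc s' (s (Fin.last n)))) ≠ 0 := by
      refine Function.ne_iff.2 ⟨Fin.init s, ?_⟩
      rwa [Fin.snoc_init_self]
    refine (small_boxEval_eq_zero this).mono fun x hx => ?_
    by_contra h
    refine hx ?_
    simp only [Set.mem_ofPred_eq, boxEval_snoc]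
    exact (finite_of_sum_pow_eq_zero (c := fun j => boxEval (fun s => p (Fin.snoc s j)) x)
      (Function.ne_iff.2 ⟨_, h⟩)).1

theorem neBot_nhdsNE [TopologicalSpace K] [IsTopologicalRing K] [h : (𝓝[≠] (0 : K)).NeBot]
    (a : K) : (𝓝[≠] a).NeBot := by
  rw [nhdsWithin_neBot] at h ⊢
  intro t ht
  have h2 : (fun z => a + z) ⁻¹' t ∈ 𝓝 (0 : K) :=
    (Continuous.tendsto (by fun_prop : Continuous fun z : K => a + z) 0) (by simpa using ht)
  obtain ⟨z, hz, hz'⟩ := h h2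
  exact ⟨a + z, hz, by simpa using hz'⟩

/-- If the monomials with exponents at most `D` are linearly independent on `S`, then so are their
products in several groups of variables on the powers of `S`. -/
theorem eq_zero_of_sum_prod_eq_zero {n D : ℕ} {S : Set (Fin n → K)}
    (hS : ∀ p : (Fin n → Fin (D + 1)) → K, (∀ x ∈ S, boxEval p x = 0) → p = 0) {N : ℕ}
    {c : (Fin N → Fin n → Fin (D + 1)) → K}
    (hc : ∀ x : Fin N → Fin n → K, (∀ j, x j ∈ S) →
      ∑ σ, c σ * ∏ j, ∏ i, x j i ^ (σ j i : ℕ) = 0) : c = 0 := by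
  induction N with
  | zero =>
    funext σ
    have := hc (fun j => j.elim0) (fun j => j.elim0)
    simp only [Finset.univ_unique, Finset.sum_singleton, Finset.univ_eq_empty, Finset.prod_empty,
      mul_one] at this
    exact (congrArg c (Subsingleton.elim _ _)).trans this
  | succ N ih =>
    have key : ∀ s : Fin n → Fin (D + 1), (fun σ => c (Fin.cons s σ)) = 0 := by
      intro s
      refine ih fun x hx => ?_
      have := hS (fun s => ∑ σ : Fin N → Fin n → Fin (D + 1),
        c (Fin.cons s σ) * ∏ j, ∏ i, x j i ^ (σ j i : ℕ)) fun x₀ hx₀ => ?_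
      · exact congrFun this s
      · have h := hc (Fin.cons x₀ x) (fun j => by refine Fin.cases ?_ ?_ j; exacts [hx₀, hx])
        rw [← (Fin.consEquiv (fun _ : Fin (N + 1) => Fin n → Fin (D + 1))).sum_comp,
          Fintype.sum_prod_type] at h
        rw [← h, boxEval]
        refine Finset.sum_congr rfl fun s _ => ?_
        rw [Finset.sum_mul]
        refine Finset.sum_congr rfl fun σ _ => ?_
        simp [Fin.consEquiv, Fin.prod_univ_succ]
        ring
    funext σ
    rw [← Fin.cons_self_tail σ]
    exact congrFun (key (σ 0)) (Fin.tail σ)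

/-- If the monomials with exponents at most `D` were independent on `S`, their products would be
independent on the power of `S`, and `Q` could not vanish there. Since `D` depends on `Q` alone and
not on `S`, this is the origin of the uniform bounds below. -/
theorem exists_boxEval_eq_zero_of_eval_eq_zero {N n : ℕ} {Q : MvPolynomial (Fin N × Fin n) K}
    (hQ : Q ≠ 0) : ∃ D : ℕ, ∀ S : Set (Fin n → K),
      (∀ x : Fin N → Fin n → K, (∀ j, x j ∈ S) → MvPolynomial.eval (fun i => x i.1 i.2) Q = 0) →
      ∃ p : (Fin n → Fin (D + 1)) → K, p ≠ 0 ∧ ∀ x ∈ S, boxEval p x = 0 := by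
  classical
  obtain ⟨D, hD⟩ : ∃ D, ∀ d ∈ Q.support, ∀ i, d i ≤ D :=
    ⟨Q.totalDegree, fun d hd i =>
      ((Finsupp.le_degree i d).trans (MvPolynomial.le_totalDegree hd))⟩
  refine ⟨D, fun S hS => ?_⟩
  by_contra! H
  let e : (Fin N → Fin n → Fin (D + 1)) → (Fin N × Fin n →₀ ℕ) := fun σ =>
    Finsupp.equivFunOnFinite.symm fun i => (σ i.1 i.2 : ℕ)
  have he : Function.Injective e := by
    intro σ τ h
    funext j i
    have := DFunLike.congr_fun h (j, i)
    exact Fin.ext this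
  have hsup : ∀ d ∈ Q.support, ∃ σ, e σ = d := fun d hd =>
    ⟨fun j i => ⟨d (j, i), Nat.lt_succ_of_le (hD d hd _)⟩, by ext i; rfl⟩
  have hc := eq_zero_of_sum_prod_eq_zero (S := S) (D := D) (N := N) (c := fun σ => Q.coeff (e σ))
    (fun p hp => by
      by_contra h
      obtain ⟨x, hx, hx'⟩ := H p h
      exact hx' (hp x hx)) fun x hx => ?_
  · refine hQ (MvPolynomial.ext _ _ fun d => ?_)
    by_contra hd
    obtain ⟨σ, rfl⟩ := hsup d (MvPolynomial.mem_support_iff.2 (by simpa using hd))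
    exact hd (by simpa using congrFun hc σ)
  · rw [← hS x hx, MvPolynomial.eval_eq',
      Finset.sum_subset (s₂ := Finset.univ.image e) (fun d hd => ?_) (fun d _ hd => ?_),
      Finset.sum_image he.injOn]
    · refine Finset.sum_congr rfl fun σ _ => ?_
      rw [← Finset.univ_product_univ, Finset.prod_product]
      rfl
    · obtain ⟨σ, rfl⟩ := hsup d hd
      exact Finset.mem_image_of_mem _ (Finset.mem_univ _)
    · rw [MvPolynomial.notMem_support_iff.1 hd, zero_mul]

end Small

end MS

namespace MS

open Topology Filter

namespace FieldStruc

variable {L : FieldLang.{u}} {M : FieldStruc L} [TopologicalSpace M.K] [M.IsTame]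
variable {E F W : Type u} [Ctx M E] [Ctx M F] [Ctx M W]

/-! ### Topological notions are definable -/

variable (M) in
/-- A definable family of sets forming a basis of neighbourhoods of `0` in all finite powers. -/
theorem exists_basis : ∃ (Z : Type u) (_ : Ctx M Z) (B : Z → Set M.K),
    M.Def (fun p : M.K × Z => p.1 ∈ B p.2) ∧
    (𝓝 (0 : M.K)).HasBasis (fun _ => True) B ∧
    (∀ x : M.K, (𝓝 x).HasBasis (fun _ => True) fun z => {y | y - x ∈ B z}) ∧
    ∀ {κ : Type} [Finite κ] (x : κ → M.K),
      (𝓝 x).HasBasis (fun _ => True) fun z => {y | ∀ i, y i - x i ∈ B z} := by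
  obtain ⟨Z, hZ, B, hB, hb⟩ := IsTame.exists_basis (M := M)
  refine ⟨Z, hZ, B, hB, hb, fun x => ?_, fun {κ} _ x => ?_⟩
  · rw [← nhds_translation_sub x]
    exact hb.comap _
  · have h0 : (𝓝 (0 : κ → M.K)).HasBasis (fun _ => True) fun z => {y | ∀ i, y i ∈ B z} := by
      rw [nhds_pi]
      refine hb.pi_self.to_hasBasis (fun I _ => ⟨I.2, trivial, fun y hy i _ => hy i⟩)
        (fun z _ => ⟨(Set.univ, z), ⟨Set.finite_univ, trivial⟩, fun y hy i => hy i trivial⟩)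
    rw [← nhds_translation_sub x]
    exact h0.comap _

namespace Def

theorem eventually {R : E → M.K → Prop} (hR : M.Def (fun p : E × M.K => R p.1 p.2)) {g : E → M.K}
    (hg : M.DefMap g) : M.Def (fun e => ∀ᶠ y in 𝓝 (g e), R e y) := by
  obtain ⟨Z, _, B, hB, -, hb, -⟩ := exists_basis M
  refine (Def.ex (E := E) (F := Z) (R := fun e z => ∀ y, y - g e ∈ B z → R e y)
    (Def.all (Def.imp ?_ ?_))).congr fun e => ?_
  · exact hB.comp (g := fun p : (E × Z) × M.K => (p.2 - g p.1.1, p.1.2)) (by fun_prop)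
  · exact hR.comp (g := fun p : (E × Z) × M.K => (p.1.1, p.2)) (by fun_prop)
  · simp [(hb (g e)).eventually_iff]

theorem eventually_pi {κ : Type} [Finite κ] {R : E → (κ → M.K) → Prop}
    (hR : M.Def (fun p : E × (κ → M.K) => R p.1 p.2)) {g : E → κ → M.K} (hg : M.DefMap g) :
    M.Def (fun e => ∀ᶠ y in 𝓝 (g e), R e y) := by
  obtain ⟨Z, _, B, hB, -, -, hb⟩ := exists_basis M
  refine (Def.ex (E := E) (F := Z) (R := fun e z => ∀ y : κ → M.K, (∀ i, y i - g e i ∈ B z) → R e y)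
    (Def.all (Def.imp (Def.forall_finite fun i => ?_) ?_))).congr fun e => ?_
  · exact hB.comp (g := fun p : (E × Z) × (κ → M.K) => (p.2 i - g p.1.1 i, p.1.2)) (by fun_prop)
  · exact hR.comp (g := fun p : (E × Z) × (κ → M.K) => (p.1.1, p.2)) (by fun_prop)
  · simp [(hb (g e)).eventually_iff]

end Def

/-! ### Boundaries of definable sets -/

theorem exists_polynomials {κ : Type} [Finite κ] {R : (κ → M.K) → Prop} (hR : M.Def R) :
    ∃ A : Finset (MvPolynomial κ M.K),
      (∀ P ∈ A, P ≠ 0 ∧ P ∈ Set.range (MvPolynomial.map (σ := κ)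
        (MvPolynomial.aeval M.const : MvPolynomial L.Const ℤ →ₐ[ℤ] M.K).toRingHom)) ∧
      ∀ x, R x → ∀ᶠ y in 𝓝 x, (∀ P ∈ A, MvPolynomial.eval x P = 0 → MvPolynomial.eval y P = 0) →
        R y := by
  classical
  obtain ⟨k, ⟨e⟩⟩ := Finite.exists_equiv_fin κ
  obtain ⟨A, hA, h⟩ := IsTame.exists_polynomials (M := M) (k := k)
    (hR.comp (g := fun x : Fin k → M.K => fun i => x (e i)) (by fun_prop))
  refine ⟨A.image (MvPolynomial.rename e.symm), ?_, fun x hx => ?_⟩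
  · simp only [Finset.mem_image, forall_exists_index, and_imp]
    rintro _ P hP rfl
    refine ⟨fun h0 => (hA P hP).1 ?_, ?_⟩
    · exact MvPolynomial.rename_injective _ e.symm.injective (by simpa using h0)
    · obtain ⟨Q, hQ⟩ := (hA P hP).2
      exact ⟨MvPolynomial.rename e.symm Q, by rw [MvPolynomial.map_rename, hQ]⟩
  · have h1 := h (fun i => x (e.symm i)) (by simpa using hx)
    have h2 : Tendsto (fun (y : κ → M.K) (i : Fin k) => y (e.symm i)) (𝓝 x)
        (𝓝 fun i => x (e.symm i)) := Continuous.tendsto (by fun_prop) x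
    filter_upwards [h2.eventually h1] with y hy hP
    have := hy fun P hP' h0 => by
      have := hP _ (Finset.mem_image_of_mem _ hP') (by rw [MvPolynomial.eval_rename]; exact h0)
      rwa [MvPolynomial.eval_rename] at this
    simpa using this

/-- The boundaries of the members of a definable family of sets lie in zero sets of polynomials of
bounded degree. -/
theorem exists_boxEval_eq_zero_of_mem_frontier {n : ℕ} {X : W → (Fin n → M.K) → Prop}
    (hX : M.Def (fun p : W × (Fin n → M.K) => X p.1 p.2)) :
    ∃ D : ℕ, ∀ w, ∃ p : (Fin n → Fin (D + 1)) → M.K, p ≠ 0 ∧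
      ∀ x ∈ frontier {x | X w x}, boxEval p x = 0 := by
  obtain ⟨N, hN⟩ := IsTame.nip (M := M) (R := fun (x : Fin n → M.K) (w : W) => X w x)
    (hX.comp (g := fun p : (Fin n → M.K) × W => (p.2, p.1)) (by fun_prop))
  -- The parameter `w` is quantified away, so failure of a pattern is definable without parameters.
  -- Off the zero set of the finitely many polynomials attached to the patterns, failure of a
  -- pattern is then an open condition.
  have hW : ∀ s : Set (Fin N), M.Def (fun x : Fin N × Fin n → M.K =>
      ¬ ∃ w, ∀ j, (X w fun i => x (j, i)) ↔ j ∈ s) := fun s =>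
    (Def.ex (Def.forall_finite fun j => (hX.comp
      (g := fun p : (Fin N × Fin n → M.K) × W => (p.2, fun i => p.1 (j, i)))
      (by fun_prop)).iff (Def.const _))).not
  choose A hA h using fun s => exists_polynomials (hW s)
  have hQ0 : (∏ s, ∏ P ∈ A s, P) ≠ 0 := Finset.prod_ne_zero_iff.2 fun s _ =>
    Finset.prod_ne_zero_iff.2 fun P hP => (hA s P hP).1
  obtain ⟨D, hD⟩ := exists_boxEval_eq_zero_of_eval_eq_zero hQ0
  refine ⟨D, fun w => hD _ fun x hx => ?_⟩
  by_contra hQ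
  refine hN ⟨x, ?_⟩
  have hs : ∀ s : Set (Fin N), ∃ w, ∀ j, X w (x j) ↔ j ∈ s := by
    intro s
    by_contra hs
    have h1 := h s (fun i => x i.1 i.2) hs
    have h2 : Tendsto (fun (y : Fin N → Fin n → M.K) (i : Fin N × Fin n) => y i.1 i.2) (𝓝 x)
        (𝓝 fun i => x i.1 i.2) := Continuous.tendsto (by fun_prop) x
    have h3 : ∀ᶠ y in 𝓝 x, ¬ ∃ w, ∀ j, X w (y j) ↔ j ∈ s := by
      filter_upwards [h2.eventually h1] with y hy
      refine hy fun P hP h0 => (hQ ?_).elim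
      rw [map_prod]
      refine Finset.prod_eq_zero (Finset.mem_univ s) ?_
      rw [map_prod]
      exact Finset.prod_eq_zero hP h0
    -- Each point of the tuple is a frontier point, so it has neighbours inside and outside the set
    -- for the given `w`. They can be chosen independently in a product neighbourhood, which
    -- realises the pattern `s` and contradicts the openness of its failure.
    rw [nhds_pi, Filter.eventually_iff, Filter.mem_pi'] at h3
    obtain ⟨I, t, ht, h3⟩ := h3
    have : ∀ j, ∃ y ∈ t j, X w y ↔ j ∈ s := by
      intro j
      have hj := hx j
      rw [frontier_eq_closure_inter_closure] at hj
      by_cases hjs : j ∈ s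
      · obtain ⟨y, hy, hy'⟩ := mem_closure_iff_nhds.1 hj.1 _ (ht j)
        exact ⟨y, hy, iff_of_true hy' hjs⟩
      · obtain ⟨y, hy, hy'⟩ := mem_closure_iff_nhds.1 hj.2 _ (ht j)
        exact ⟨y, hy, iff_of_false hy' hjs⟩
    choose y hy hy' using this
    exact h3 (fun j _ => hy j) ⟨w, hy'⟩
  choose b hb using hs
  exact ⟨b, fun i J => hb J i⟩

theorem small_of_interior_eq_empty {n : ℕ} {X : W → (Fin n → M.K) → Prop}
    (hX : M.Def (fun p : W × (Fin n → M.K) => X p.1 p.2)) {w : W}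
    (h : ∀ x, ¬ ∀ᶠ y in 𝓝 x, X w y) : Small {x | X w x} := by
  obtain ⟨D, hD⟩ := exists_boxEval_eq_zero_of_mem_frontier hX
  obtain ⟨p, hp, h'⟩ := hD w
  refine (small_boxEval_eq_zero hp).mono fun x hx => h' x ⟨subset_closure hx, fun hx' => ?_⟩
  exact h x (mem_interior_iff_mem_nhds.1 hx')

/-- Uniform finiteness of the boundary in dimension one. -/
theorem exists_ncard_frontier_le {X : W → M.K → Prop}
    (hX : M.Def (fun p : W × M.K => X p.1 p.2)) :
    ∃ D : ℕ, ∀ w, (frontier {x | X w x}).Finite ∧ (frontier {x | X w x}).ncard ≤ D := by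
  obtain ⟨D, hD⟩ := exists_boxEval_eq_zero_of_mem_frontier (n := 1) (X := fun w x => X w (x 0))
    (hX.comp (g := fun p : W × (Fin 1 → M.K) => (p.1, p.2 0)) (by fun_prop))
  refine ⟨D, fun w => ?_⟩
  obtain ⟨p, hp, h⟩ := hD w
  let c : Fin (D + 1) → M.K := fun j => p fun _ => j
  have hc : c ≠ 0 := by
    obtain ⟨s, hs⟩ := Function.ne_iff.1 hp
    refine Function.ne_iff.2 ⟨s 0, ?_⟩
    have : (fun _ => s 0) = s := funext fun i => by rw [Subsingleton.elim i 0]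
    simpa [c, this] using hs
  have hsub : frontier {x | X w x} ⊆ {y | ∑ j, c j * y ^ (j : ℕ) = 0} := by
    intro y hy
    have h1 := h (fun _ => y) ?_
    · rw [boxEval, ← (Equiv.funUnique (Fin 1) (Fin (D + 1))).symm.sum_comp] at h1
      have e : ∀ j : Fin (D + 1), (Equiv.funUnique (Fin 1) (Fin (D + 1))).symm j = fun _ => j :=
        fun j => rfl
      simpa [c, e] using h1
    · have := (Homeomorph.funUnique (Fin 1) M.K).preimage_frontier {x | X w x}
      have h2 : (fun _ => y) ∈ (Homeomorph.funUnique (Fin 1) M.K) ⁻¹' frontier {x | X w x} := hy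
      rw [this] at h2
      exact h2
  obtain ⟨h1, h2⟩ := finite_of_sum_pow_eq_zero hc
  exact ⟨h1.subset hsub, (Set.ncard_le_ncard hsub h1).trans h2⟩

/-- A set without interior is contained in its frontier, which is finite, while nonempty open sets
are infinite. Finiteness thus becomes a definable condition on the parameter. -/
theorem finite_iff {X : W → M.K → Prop} (hX : M.Def (fun p : W × M.K => X p.1 p.2)) (w : W) :
    {x | X w x}.Finite ↔ ∀ x, ¬ ∀ᶠ y in 𝓝 x, X w y := by
  constructor
  · intro h x hx
    have := neBot_nhdsNE x
    exact infinite_of_mem_nhds x hx h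
  · intro h
    obtain ⟨D, hD⟩ := exists_ncard_frontier_le hX
    refine (hD w).1.subset fun x hx => ⟨subset_closure hx, fun hx' => ?_⟩
    exact h x (mem_interior_iff_mem_nhds.1 hx')

theorem exists_ncard_le {X : W → M.K → Prop} (hX : M.Def (fun p : W × M.K => X p.1 p.2)) :
    ∃ D : ℕ, ∀ w, {x | X w x}.Finite → {x | X w x}.ncard ≤ D := by
  obtain ⟨D, hD⟩ := exists_ncard_frontier_le hX
  refine ⟨D, fun w h => ?_⟩
  refine le_trans (Set.ncard_le_ncard (t := frontier {x | X w x})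
    (fun x hx => ⟨subset_closure hx, fun hx' => ?_⟩) (hD w).1) (hD w).2
  exact (finite_iff hX w).1 h x (mem_interior_iff_mem_nhds.1 hx')

theorem Def.finite {X : W → M.K → Prop} (hX : M.Def (fun p : W × M.K => X p.1 p.2)) :
    M.Def (fun w => {x | X w x}.Finite) := by
  refine (Def.all (Def.not (Def.eventually (E := W × M.K) (R := fun p y => X p.1 y)
    (g := fun p => p.2) ?_ (by fun_prop)))).congr (finite_iff hX)
  exact hX.comp (g := fun p : (W × M.K) × M.K => (p.1.1, p.2)) (by fun_prop)

/-- Finite fibres in a definable family have at most `D` points for a fixed `D`, so a directed union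
of them still has at most `D` points. Hence a fibre of the union is infinite only if it is infinite
at some stage, and the induction runs on the sets of base points with infinite fibre. -/
theorem small_iUnion_of_directed {n : ℕ} {X : W → (Fin n → M.K) → Prop}
    (hX : M.Def (fun p : W × (Fin n → M.K) => X p.1 p.2)) {ι : Type*} [Nonempty ι] {g : ι → W}
    (hd : Directed (· ⊆ ·) fun i => {x | X (g i) x}) (hs : ∀ i, Small {x | X (g i) x}) :
    Small {x | ∃ i, X (g i) x} := by
  induction n with
  | zero =>
    refine Set.eq_empty_iff_forall_notMem.2 ?_
    rintro x ⟨i, hx⟩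
    exact Set.eq_empty_iff_forall_notMem.1 (show _ = _ from hs i) x hx
  | succ n ih =>
    have hX' : M.Def (fun p : (W × (Fin n → M.K)) × M.K => X p.1.1 (Fin.snoc p.1.2 p.2)) :=
      hX.comp (g := fun p : (W × (Fin n → M.K)) × M.K => (p.1.1, Fin.snoc p.1.2 p.2))
        (by fun_prop)
    obtain ⟨D, hD⟩ := exists_ncard_le (W := W × (Fin n → M.K))
      (X := fun p y => X p.1 (Fin.snoc p.2 y)) hX'
    refine small_succ.2 ((ih (X := fun w x => {y | X w (Fin.snoc x y)}.Infinite)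
      (Def.not (Def.finite (W := W × (Fin n → M.K)) hX')) (fun i j => ?_) fun i => hs i).mono ?_)
    · obtain ⟨k, hik, hjk⟩ := hd i j
      exact ⟨k, fun x hx => Set.Infinite.mono (fun y hy => hik hy) (Set.mem_ofPred.1 hx),
        fun x hx => Set.Infinite.mono (fun y hy => hjk hy) (Set.mem_ofPred.1 hx)⟩
    · intro x hx
      by_contra hfin
      have hfin : ∀ i, {y | X (g i) (Fin.snoc x y)}.Finite := by
        simpa using hfin
      refine hx ?_
      have hsub : {y | (Fin.snoc x y : Fin (n + 1) → M.K) ∈ {x | ∃ i, X (g i) x}}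
          = ⋃ i, {y | X (g i) (Fin.snoc x y)} := by ext y; simp
      rw [hsub]
      by_contra hinf
      obtain ⟨t, ht, htc⟩ := Set.Infinite.exists_subset_card_eq hinf (D + 1)
      obtain ⟨i, hi⟩ := Directed.exists_mem_subset_of_finset_subset_biUnion
        (f := fun i => {y | X (g i) (Fin.snoc x y)}) (fun i j => by
          obtain ⟨k, hik, hjk⟩ := hd i j
          exact ⟨k, fun y hy => hik hy, fun y hy => hjk hy⟩) ht
      have h1 := Set.ncard_le_ncard hi (hfin i)
      rw [Set.ncard_coe_finset, htc] at h1
      have h2 : {y | X (g i) (Fin.snoc x y)}.ncard ≤ D := hD (g i, x) (hfin i)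
      omega

end FieldStruc

end MS

namespace MS

open Topology Filter

namespace FieldStruc

variable {L : FieldLang.{u}} {M : FieldStruc L}
variable {E F W : Type u} [Ctx M E] [Ctx M F] [Ctx M W]

/-! ### Canonical elements of definable subspaces -/

theorem Def.exists_defMap_pi {κ : Type} [Finite κ] {R : E → (κ → M.K) → Prop}
    (hR : M.Def (fun p : E × (κ → M.K) => R p.1 p.2)) :
    ∃ g : E → κ → M.K, M.DefMap g ∧ ∀ e x, R e x → (∀ y, R e y → y = x) → g e = x := by
  choose g hg h using fun k => Def.exists_defMap (E := E) (R := fun e t => ∃ x, R e x ∧ x k = t)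
    (Def.ex (E := E × M.K) (F := κ → M.K) (R := fun p x => R p.1 x ∧ x k = p.2)
      ((hR.comp (g := fun p : (E × M.K) × (κ → M.K) => (p.1.1, p.2)) (by fun_prop)).and
        (Def.eq_fun (by fun_prop) (by fun_prop))))
  refine ⟨fun e k => g k e, by fun_prop, fun e x hx hu => funext fun k => ?_⟩
  refine h k e (x k) ⟨x, hx, rfl⟩ ?_
  rintro _ ⟨y, hy, rfl⟩
  rw [hu y hy]

theorem Def.eq_zero {f : E → M.K} (hf : M.DefMap f) : M.Def (fun e => f e = 0) :=
  Def.eq_fun hf DefMap.zero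

/-- A definable family of nonzero subspaces has a definable choice of nonzero elements. -/
theorem exists_defMap_mem_submodule {κ : Type} [Finite κ] {G : W → (κ → M.K) → Prop}
    (hG : M.Def (fun p : W × (κ → M.K) => G p.1 p.2)) :
    ∃ c : W → κ → M.K, M.DefMap c ∧ ∀ w, (∃ V : Submodule M.K (κ → M.K), ∀ x, G w x ↔ x ∈ V) →
      (∃ x ≠ 0, G w x) → G w (c w) ∧ c w ≠ 0 := by
  classical
  obtain ⟨m, ⟨o⟩⟩ := Finite.exists_equiv_fin κ
  -- This singles out the last vector of the echelon basis: its leading position is as late as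
  -- possible and its leading coefficient is `1`. Two such vectors have the same leading position,
  -- and their difference would lead even later.
  let R : W → (κ → M.K) → Prop := fun w x => G w x ∧ ∃ k, x k = 1 ∧ (∀ j, o j < o k → x j = 0) ∧
    ∀ y, G w y → (∀ j, o j ≤ o k → y j = 0) → ∀ j, y j = 0
  have hR : M.Def (fun p : W × (κ → M.K) => R p.1 p.2) := by
    refine hG.and (Def.exists_finite fun k => Def.and (Def.eq_fun (by fun_prop) DefMap.one)
      (Def.and (Def.forall_finite fun j => (Def.const _).imp (Def.eq_zero (by fun_prop))) ?_))
    refine Def.all (E := W × (κ → M.K)) (F := κ → M.K) (R := fun p y => G p.1 y →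
      (∀ j, o j ≤ o k → y j = 0) → ∀ j, y j = 0) (Def.imp ?_ (Def.imp ?_ ?_))
    · exact hG.comp (g := fun p : (W × (κ → M.K)) × (κ → M.K) => (p.1.1, p.2)) (by fun_prop)
    · exact Def.forall_finite fun j => (Def.const _).imp (Def.eq_zero (by fun_prop))
    · exact Def.forall_finite fun j => (Def.eq_zero (by fun_prop))
  obtain ⟨c, hc, h⟩ := Def.exists_defMap_pi hR
  refine ⟨c, hc, ?_⟩
  rintro w ⟨V, hV⟩ ⟨x₀, hx₀, hx₀'⟩
  have := Fintype.ofFinite κ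
  let I : Finset κ := Finset.univ.filter fun k => ∃ x, G w x ∧ x k ≠ 0 ∧ ∀ j, o j < o k → x j = 0
  have hlead : ∀ x : κ → M.K, x ≠ 0 → ∃ k, x k ≠ 0 ∧ ∀ j, o j < o k → x j = 0 := by
    intro x hx
    have hne : (Finset.univ.filter fun j => x j ≠ 0).Nonempty := by
      obtain ⟨j, hj⟩ := Function.ne_iff.1 hx
      exact ⟨j, by simpa using hj⟩
    obtain ⟨k, hk, hmin⟩ := Finset.exists_min_image _ o hne
    refine ⟨k, (Finset.mem_filter.1 hk).2, fun j hj => ?_⟩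
    by_contra h
    exact absurd (hmin j (by simpa using h)) (not_le.2 hj)
  have hI : I.Nonempty := by
    obtain ⟨k, hk, hk'⟩ := hlead x₀ hx₀
    exact ⟨k, by simpa [I] using ⟨x₀, hx₀', hk, hk'⟩⟩
  obtain ⟨k, hk, hmax⟩ := Finset.exists_max_image I o hI
  obtain ⟨x, hx, hxk, hxj⟩ := (Finset.mem_filter.1 hk).2
  have hkey : ∀ y, G w y → (∀ j, o j ≤ o k → y j = 0) → y = 0 := by
    intro y hy hyj
    by_contra hy0
    obtain ⟨l, hl, hl'⟩ := hlead y hy0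
    have := hmax l (by simpa [I] using ⟨y, hy, hl, hl'⟩)
    exact hl (hyj l this)
  have hRx : R w ((x k)⁻¹ • x) := by
    refine ⟨(hV _).2 (V.smul_mem _ ((hV x).1 hx)), k, by simp [hxk], fun j hj => by simp [hxj j hj],
      fun y hy hyj j => by rw [hkey y hy hyj]; rfl⟩
  have hu : ∀ y z, R w y → R w z → y = z := by
    have : ∀ y z, R w y → R w z → ∀ k l, y k = 1 → (∀ j, o j < o k → y j = 0) →
        z l = 1 → (∀ j, o j < o l → z j = 0) →
        (∀ y, G w y → (∀ j, o j ≤ o k → y j = 0) → ∀ j, y j = 0) → o k ≤ o l → y = z := by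
      intro y z hy hz k l h1 h2 h3 h4 h5 hkl
      rcases hkl.lt_or_eq with hkl | hkl
      · have := h5 z hz.1 (fun j hj => h4 j (lt_of_le_of_lt hj hkl)) l
        rw [h3] at this
        exact absurd this one_ne_zero
      · obtain rfl := o.injective hkl
        have h6 := h5 (y - z) ((hV _).2 (V.sub_mem ((hV y).1 hy.1) ((hV z).1 hz.1))) fun j hj => by
          rcases hj.lt_or_eq with hj | hj
          · simp [h2 j hj, h4 j hj]
          · obtain rfl := o.injective hj
            simp [h1, h3]
        exact funext fun j => sub_eq_zero.1 (h6 j)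
    intro y z hy hz
    obtain ⟨k, h1, h2, h3⟩ := hy.2
    obtain ⟨l, h4, h5, h6⟩ := hz.2
    rcases le_total (o k) (o l) with h | h
    · exact this y z hy hz k l h1 h2 h4 h5 h3 h
    · exact (this z y hz hy l k h4 h5 h1 h2 h6 h).symm
  rw [h w _ hRx fun y hy => hu _ _ hy hRx]
  refine ⟨hRx.1, fun h0 => ?_⟩
  have := congrFun h0 k
  simp [hxk] at this

/-! ### Derivatives of roots -/

/-- The value at `y` of the `i`-th derivative of the polynomial with coefficients `c`. -/
def evalDeriv {K : Type*} [Field K] {D : ℕ} (c : Fin (D + 1) → K) (i : ℕ) (y : K) : K :=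
  ∑ j : Fin (D + 1), c j * (((j : ℕ).descFactorial i : ℕ) * y ^ ((j : ℕ) - i))

theorem evalDeriv_zero {K : Type*} [Field K] {D : ℕ} (c : Fin (D + 1) → K) (y : K) :
    evalDeriv c 0 y = ∑ j, c j * y ^ (j : ℕ) := by
  simp [evalDeriv]

theorem exists_evalDeriv_ne_zero {K : Type*} [Field K] [CharZero K] {D : ℕ} {c : Fin (D + 1) → K}
    (hc : c ≠ 0) (y : K) : ∃ i : Fin (D + 1), evalDeriv c i y ≠ 0 := by
  classical
  obtain ⟨k, hk⟩ : ∃ k, c k ≠ 0 ∧ ∀ j > k, c j = 0 := by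
    have hne : (Finset.univ.filter fun j => c j ≠ 0).Nonempty := by
      obtain ⟨j, hj⟩ := Function.ne_iff.1 hc
      exact ⟨j, by simpa using hj⟩
    refine ⟨_, (Finset.mem_filter.1 (Finset.max'_mem _ hne)).2, fun j hj => ?_⟩
    by_contra h
    exact absurd (Finset.le_max' _ j (by simpa using h)) (not_le.2 hj)
  refine ⟨k, ?_⟩
  rw [evalDeriv, Finset.sum_eq_single k]
  · simp [hk.1, Nat.descFactorial_self, Nat.factorial_ne_zero]
  · intro j _ hj
    rcases lt_or_gt_of_ne hj with h | h
    · rw [Nat.descFactorial_of_lt (by exact_mod_cast h)]; simp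
    · rw [hk.2 j h, zero_mul]
  · simp

/-- Take `i + 1` to be the order of the first derivative not vanishing at `y`; one exists in
characteristic zero. Every root is thus a simple root of some derivative, which replaces the use of
minimal polynomials. -/
theorem exists_evalDeriv_eq_zero_ne_zero {K : Type*} [Field K] [CharZero K] {D : ℕ}
    {c : Fin (D + 1) → K} (hc : c ≠ 0) {y : K} (hy : ∑ j, c j * y ^ (j : ℕ) = 0) :
    ∃ i : Fin (D + 1), evalDeriv c i y = 0 ∧ evalDeriv c (i + 1) y ≠ 0 := by
  classical
  obtain ⟨i₁, hi₁⟩ := exists_evalDeriv_ne_zero hc y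
  have hex : ∃ i : ℕ, evalDeriv c i y ≠ 0 := ⟨_, hi₁⟩
  obtain ⟨i, hi⟩ : ∃ i, Nat.find hex = i + 1 := by
    refine Nat.exists_eq_succ_of_ne_zero fun h0 => Nat.find_spec hex ?_
    rw [h0, evalDeriv_zero, hy]
  have hlt : i < D + 1 := by
    have := Nat.find_min' hex hi₁
    have := i₁.2
    omega
  refine ⟨⟨i, hlt⟩, ?_, hi ▸ Nat.find_spec hex⟩
  by_contra h0
  have := Nat.find_min' hex h0
  simp only at this
  omega

theorem finite_evalDeriv_eq_zero {K : Type*} [Field K] {D : ℕ} {c : Fin (D + 1) → K} {i : ℕ}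
    {y : K} (hy : evalDeriv c (i + 1) y ≠ 0) : {t | evalDeriv c i t = 0}.Finite := by
  let P : Polynomial K := ∑ j : Fin (D + 1), Polynomial.C (c j) * Polynomial.X ^ (j : ℕ)
  have h : ∀ i t, evalDeriv c i t = (Polynomial.derivative^[i] P).eval t := by
    intro i t
    simp [P, evalDeriv, Polynomial.iterate_derivative_sum, Polynomial.iterate_derivative_C_mul,
      Polynomial.iterate_derivative_X_pow_eq_natCast_mul, Polynomial.eval_finsetSum]
  have hP : Polynomial.derivative^[i] P ≠ 0 := by
    intro h0
    rw [h, Function.iterate_succ', Function.comp, h0] at hy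
    simp at hy
  refine (Polynomial.derivative^[i] P).roots.finite_toSet.subset fun t ht => ?_
  have ht' : evalDeriv c i t = 0 := ht
  rw [h] at ht'
  exact (Polynomial.mem_roots hP).2 ht'

theorem der_evalDeriv {K : Type*} [Field K] (δ : Derivation ℤ K K) {D : ℕ} (c : Fin (D + 1) → K)
    (i : ℕ) (y : K) :
    δ (evalDeriv c i y) = evalDeriv (fun j => δ (c j)) i y + evalDeriv c (i + 1) y * δ y := by
  simp only [evalDeriv, map_sum, Finset.sum_mul, ← Finset.sum_add_distrib]
  refine Finset.sum_congr rfl fun j _ => ?_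
  rw [Derivation.leibniz, Derivation.leibniz, Derivation.map_natCast, Derivation.leibniz_pow,
    Nat.descFactorial_succ, ← Nat.sub_sub]
  simp only [smul_eq_mul, nsmul_eq_mul]
  push_cast
  ring

theorem DefMap.evalDeriv {D : ℕ} {c : E → Fin (D + 1) → M.K} {y : E → M.K}
    (hc : M.DefMap c) (hy : M.DefMap y) (i : ℕ) :
    M.DefMap (fun e => FieldStruc.evalDeriv (c e) i (y e)) := by
  have := fun (n : ℕ) (k : ℕ) => natCast_mul n (hy.pow k)
  unfold FieldStruc.evalDeriv
  fun_prop

variable (δ : Derivation ℤ M.K M.K)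

/-- Differentiating $c^{(i)}(y)=0$ at an order where $y$ is a simple root gives a linear equation
with the unique solution $\delta y$. The relation `R` imposes the equation for all orders at which
$y$ is a root, so no choice of the order has to be made definably. -/
theorem exists_defMap_der_root [CharZero M.K] (D : ℕ) :
    ∃ G : (Fin (D + 1) → M.K) × (Fin (D + 1) → M.K) × M.K → M.K, M.DefMap G ∧
      ∀ (c : Fin (D + 1) → M.K) (y : M.K), c ≠ 0 → ∑ j, c j * y ^ (j : ℕ) = 0 →
        δ y = G (c, fun j => δ (c j), y) := by
  let R : (Fin (D + 1) → M.K) × (Fin (D + 1) → M.K) × M.K → M.K → Prop := fun e t =>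
    ∀ i : Fin (D + 1), evalDeriv e.1 i e.2.2 = 0 →
      evalDeriv e.2.1 i e.2.2 + evalDeriv e.1 (i + 1) e.2.2 * t = 0
  obtain ⟨G, hG, h⟩ := Def.exists_defMap (R := R) (Def.forall_finite fun i => Def.imp
    (Def.eq_fun (DefMap.evalDeriv (by fun_prop) (by fun_prop) _) DefMap.zero)
    (Def.eq_fun (DefMap.add (DefMap.evalDeriv (by fun_prop) (by fun_prop) _)
      (DefMap.mul (DefMap.evalDeriv (by fun_prop) (by fun_prop) _) (by fun_prop))) DefMap.zero))
  refine ⟨G, hG, fun c y hc hy => (h _ _ (fun i hi => ?_) fun t ht => ?_).symm⟩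
  · rw [← der_evalDeriv, hi, map_zero]
  · obtain ⟨i, h0, h1⟩ := exists_evalDeriv_eq_zero_ne_zero hc hy
    have e1 := ht i h0
    have e2 := der_evalDeriv δ c i y
    rw [h0, map_zero] at e2
    exact mul_left_cancel₀ h1 (add_left_cancel (e1.trans e2))

end FieldStruc

end MS

namespace MS

open Topology Filter

namespace FieldStruc

variable {L : FieldLang.{u}} {M : FieldStruc L}
variable {E F W : Type u} [Ctx M E] [Ctx M F] [Ctx M W]
variable (δ : Derivation ℤ M.K M.K)

/-! ### Derivatives of definable functions -/

theorem exists_coeff_of_ncard_le {K : Type*} [Field K] {D : ℕ} {S : Set K} (hS : S.Finite)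
    (hD : S.ncard ≤ D) :
    ∃ c : Fin (D + 1) → K, c ≠ 0 ∧ ∀ y ∈ S, ∑ j, c j * y ^ (j : ℕ) = 0 := by
  classical
  let P : Polynomial K := ∏ s ∈ hS.toFinset, (Polynomial.X - Polynomial.C s)
  have hP : P.Monic := Polynomial.monic_prod_of_monic _ _ fun s _ => Polynomial.monic_X_sub_C s
  have hdeg : P.natDegree ≤ D := by
    rw [Polynomial.natDegree_prod_of_monic _ _ fun s _ => Polynomial.monic_X_sub_C s]
    simpa [← Set.ncard_eq_toFinset_card S hS] using hD
  refine ⟨fun j => P.coeff j, fun h => ?_, fun y hy => ?_⟩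
  · have := congrFun h ⟨P.natDegree, Nat.lt_succ_of_le hdeg⟩
    simp [hP.coeff_natDegree] at this
  · rw [Fin.sum_univ_eq_sum_range (fun j => P.coeff j * y ^ j) (D + 1),
      ← Polynomial.eval_eq_sum_range' (Nat.lt_succ_of_le hdeg), Polynomial.eval_prod]
    exact Finset.prod_eq_zero (hS.mem_toFinset.2 hy) (by simp)

variable [TopologicalSpace M.K] [M.IsTame]

/-- The polynomials of degree at most `D` vanishing on a finite member form a nonzero definable
space. A definable choice `c w` in it reduces the claim to the derivative of a root, at the price of
the derivatives of the coefficients `c w`. -/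
theorem exists_der_eq_of_finite {S : W → M.K → Prop} (hS : M.Def (fun p : W × M.K => S p.1 p.2)) :
    ∃ (κ : Type) (_ : Finite κ) (e : W → κ → M.K) (G : W × M.K × (κ → M.K) → M.K),
      M.DefMap e ∧ M.DefMap G ∧ ∀ w, {y | S w y}.Finite → ∀ y, S w y →
        δ y = G (w, y, fun k => δ (e w k)) := by
  obtain ⟨D, hD⟩ := exists_ncard_le hS
  obtain ⟨c, hc, h⟩ := exists_defMap_mem_submodule (M := M) (κ := Fin (D + 1)) (W := W)
    (G := fun w c => ∀ y, S w y → ∑ j, c j * y ^ (j : ℕ) = 0)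
    (Def.all (E := W × (Fin (D + 1) → M.K)) (F := M.K)
      (R := fun p y => S p.1 y → ∑ j, p.2 j * y ^ (j : ℕ) = 0) (Def.imp
      (hS.comp (g := fun p : (W × (Fin (D + 1) → M.K)) × M.K => (p.1.1, p.2)) (by fun_prop))
      (Def.eq_zero (by fun_prop))))
  obtain ⟨G, hG, hG'⟩ := exists_defMap_der_root δ D
  refine ⟨Fin (D + 1), inferInstance, c, fun p => G (c p.1, p.2.2, p.2.1), hc, by fun_prop,
    fun w hw y hy => ?_⟩
  obtain ⟨c₀, hc₀, hc₀'⟩ := exists_coeff_of_ncard_le hw (hD w hw)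
  obtain ⟨h1, h2⟩ := h w ⟨{
      carrier := {c | ∀ y, S w y → ∑ j, c j * y ^ (j : ℕ) = 0}
      add_mem' := fun {a b} ha hb y hy => by
        simp [add_mul, Finset.sum_add_distrib, ha y hy, hb y hy]
      zero_mem' := fun y hy => by simp
      smul_mem' := fun r a ha y hy => by
        simp [mul_assoc, ← Finset.mul_sum, ha y hy] }, fun _ => Iff.rfl⟩ ⟨c₀, hc₀, hc₀'⟩
  exact hG' (c w) y h2 (h1 y hy)

/-- The graphs of the members of a definable family of functions lie on algebraic curves of bounded
degree. -/
theorem exists_coeff_of_defMap {f : W × M.K → M.K} (hf : M.DefMap f) :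
    ∃ D : ℕ, ∀ w, ∃ c : Fin (D + 1) × Fin (D + 1) → M.K, c ≠ 0 ∧
      ∀ x, ∑ j, (∑ i, c (j, i) * x ^ (i : ℕ)) * f (w, x) ^ (j : ℕ) = 0 := by
  obtain ⟨D, hD⟩ := exists_boxEval_eq_zero_of_mem_frontier (n := 2) (M := M) (W := W)
    (X := fun w v => v 1 = f (w, v 0)) (Def.eq_fun (by fun_prop)
      (hf.comp (g := fun p : W × (Fin 2 → M.K) => (p.1, p.2 0)) (by fun_prop)))
  refine ⟨D, fun w => ?_⟩
  obtain ⟨p, hp, h⟩ := hD w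
  refine ⟨fun k => p ![k.2, k.1], fun h0 => hp (funext fun s => ?_), fun x => ?_⟩
  · have := congrFun h0 (s 1, s 0)
    have e : ![s 0, s 1] = s := by
      funext i
      fin_cases i <;> rfl
    simpa [e] using this
  · have h1 := h ![x, f (w, x)] ⟨subset_closure (by simp), fun hx => ?_⟩
    · rw [boxEval, ← (finTwoArrowEquiv (Fin (D + 1))).symm.sum_comp, Fintype.sum_prod_type,
        Finset.sum_comm] at h1
      rw [← h1]
      refine Finset.sum_congr rfl fun j _ => ?_
      rw [Finset.sum_mul]
      refine Finset.sum_congr rfl fun i _ => ?_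
      simp [finTwoArrowEquiv, Fin.prod_univ_two]
      ring
    -- A vertical line meets the graph in a single point, so the graph has no interior and lies in
    -- its frontier.
    · have h2 := mem_interior_iff_mem_nhds.1 hx
      have h3 : Tendsto (fun y : M.K => ![x, y]) (𝓝 (f (w, x))) (𝓝 ![x, f (w, x)]) :=
        Continuous.tendsto (by fun_prop) _
      have h4 := h3 h2
      have := neBot_nhdsNE (f (w, x))
      refine infinite_of_mem_nhds _ h4 ((Set.finite_singleton (f (w, x))).subset fun y hy => ?_)
      simpa using hy

/-- The value `f (w, x)` is a root of a polynomial whose coefficients `C (w, x)` are polynomials in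
`x` over the chosen `c w`. Where they do not all vanish, the formula for derivatives of roots
applies. They all vanish for only finitely many `x`, and the values of `f` there form a finite
definable set, covered by `exists_der_eq_of_finite`. -/
theorem DefMap.exists_der_eq {f : W × M.K → M.K} (hf : M.DefMap f) :
    ∃ (κ : Type) (_ : Finite κ) (e : W → κ → M.K) (G : W × M.K × M.K × (κ → M.K) → M.K),
      M.DefMap e ∧ M.DefMap G ∧ ∀ w x, δ (f (w, x)) = G (w, x, δ x, fun k => δ (e w k)) := by
  classical
  obtain ⟨D, hD⟩ := exists_coeff_of_defMap hf
  obtain ⟨c, hc, h⟩ := exists_defMap_mem_submodule (M := M) (κ := Fin (D + 1) × Fin (D + 1))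
    (W := W) (G := fun w c => ∀ x, ∑ j, (∑ i, c (j, i) * x ^ (i : ℕ)) * f (w, x) ^ (j : ℕ) = 0)
    (Def.all (E := W × (Fin (D + 1) × Fin (D + 1) → M.K)) (F := M.K)
      (R := fun p x => ∑ j, (∑ i, p.2 (j, i) * x ^ (i : ℕ)) * f (p.1, x) ^ (j : ℕ) = 0)
      (Def.eq_zero (by
        have := hf.comp (g := fun p : (W × (Fin (D + 1) × Fin (D + 1) → M.K)) × M.K =>
          (p.1.1, p.2)) (by fun_prop)
        fun_prop)))
  have h : ∀ w, (∀ x, ∑ j, (∑ i, c w (j, i) * x ^ (i : ℕ)) * f (w, x) ^ (j : ℕ) = 0) ∧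
      c w ≠ 0 := by
    intro w
    refine h w ⟨{
      carrier := {c | ∀ x, ∑ j, (∑ i, c (j, i) * x ^ (i : ℕ)) * f (w, x) ^ (j : ℕ) = 0}
      add_mem' := fun {a b} ha hb x => by
        simp [add_mul, Finset.sum_add_distrib, ha x, hb x]
      zero_mem' := fun x => by simp
      smul_mem' := fun r a ha x => by
        simp [mul_assoc, ← Finset.mul_sum, ha x] }, fun _ => Iff.rfl⟩ (hD w)
  let C : W × M.K → Fin (D + 1) → M.K := fun p j => ∑ i, c p.1 (j, i) * p.2 ^ (i : ℕ)
  have hC : M.DefMap C := by fun_prop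
  obtain ⟨G, hG, hG'⟩ := exists_defMap_der_root δ D
  have hC0 : M.Def (fun p => C p = 0) :=
    (Def.forall_finite fun j => Def.eq_zero (f := fun p => C p j) (by fun_prop)).congr fun p => by
      rw [funext_iff]; rfl
  obtain ⟨κ, _, e, H, he, hH, hH'⟩ := exists_der_eq_of_finite δ (W := W)
    (S := fun w y => ∃ x, C (w, x) = 0 ∧ y = f (w, x))
    (Def.ex (E := W × M.K) (F := M.K) (R := fun p x => C (p.1, x) = 0 ∧ p.2 = f (p.1, x)) (Def.and
      (hC0.comp (g := fun p : (W × M.K) × M.K => (p.1.1, p.2)) (by fun_prop))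
      (Def.eq_fun (by fun_prop)
        (hf.comp (g := fun p : (W × M.K) × M.K => (p.1.1, p.2)) (by fun_prop)))))
  have hfin : ∀ w, {y | ∃ x, C (w, x) = 0 ∧ y = f (w, x)}.Finite := by
    intro w
    obtain ⟨⟨j, i⟩, hji⟩ := Function.ne_iff.1 (h w).2
    have h1 := (finite_of_sum_pow_eq_zero (c := fun i => c w (j, i))
      (Function.ne_iff.2 ⟨i, hji⟩)).1
    refine (h1.image fun x => f (w, x)).subset ?_
    rintro _ ⟨x, hx, rfl⟩
    exact ⟨x, congrFun hx j, rfl⟩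
  let dC : W × M.K × M.K × (Fin (D + 1) × Fin (D + 1) ⊕ κ → M.K) → Fin (D + 1) → M.K := fun p j =>
    ∑ i : Fin (D + 1), (p.2.2.2 (.inl (j, i)) * p.2.1 ^ (i : ℕ) +
      c p.1 (j, i) * (((i : ℕ) : M.K) * (p.2.1 ^ ((i : ℕ) - 1)) * p.2.2.1))
  have hdC : M.DefMap dC := by
    have := fun (n : ℕ) => natCast_mul (E := W × M.K × M.K × (Fin (D + 1) × Fin (D + 1) ⊕ κ → M.K))
      (M := M) n (f := fun p => p.2.1 ^ (n - 1)) (by fun_prop)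
    fun_prop
  refine ⟨(Fin (D + 1) × Fin (D + 1)) ⊕ κ, inferInstance, fun w => Sum.elim (c w) (e w),
    fun p => if C (p.1, p.2.1) = 0 then H (p.1, f (p.1, p.2.1), fun k => p.2.2.2 (.inr k))
      else G (C (p.1, p.2.1), dC p, f (p.1, p.2.1)), ?_, ?_, fun w x => ?_⟩
  · refine DefMap.pi fun k => ?_
    rcases k with k | k <;> simp only [Sum.elim_inl, Sum.elim_inr] <;> fun_prop
  · have h1 := hf.comp (g := fun p : W × M.K × M.K × (Fin (D + 1) × Fin (D + 1) ⊕ κ → M.K) =>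
      (p.1, p.2.1)) (by fun_prop)
    refine DefMap.ite (hC0.comp (by fun_prop)) ?_ ?_ <;> fun_prop
  · by_cases h0 : C (w, x) = 0
    · simp only [h0, if_true]
      exact hH' w (hfin w) _ ⟨x, h0, rfl⟩
    · simp only [h0, if_false]
      rw [hG' (C (w, x)) (f (w, x)) h0 ((h w).1 x)]
      congr 3
      funext j
      simp only [C, dC, map_sum]
      refine Finset.sum_congr rfl fun i _ => ?_
      rw [Derivation.leibniz, Derivation.leibniz_pow]
      simp only [smul_eq_mul, nsmul_eq_mul, Sum.elim_inl]
      ring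

/-- One field variable is treated at a time. The functions `e₁` that arise depend on the remaining
variables and are differentiated by induction. Elements of `W` may belong to auxiliary sorts and
have no derivatives themselves, which is why derivatives of definable functions of `w` enter. -/
theorem DefMap.exists_der_eq_pi {κ : Type} [Finite κ] {f : W × (κ → M.K) → M.K}
    (hf : M.DefMap f) :
    ∃ (κ' : Type) (_ : Finite κ') (e : W → κ' → M.K)
      (G : W × (κ → M.K) × (κ → M.K) × (κ' → M.K) → M.K),
      M.DefMap e ∧ M.DefMap G ∧
        ∀ w x, δ (f (w, x)) = G (w, x, fun k => δ (x k), fun k => δ (e w k)) := by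
  suffices H : ∀ (κ : Type) [Finite κ], ∀ [Finite κ] {W : Type u} [Ctx M W]
      {f : W × (κ → M.K) → M.K}, M.DefMap f → ∃ (κ' : Type) (_ : Finite κ') (e : W → κ' → M.K)
        (G : W × (κ → M.K) × (κ → M.K) × (κ' → M.K) → M.K), M.DefMap e ∧ M.DefMap G ∧
          ∀ w x, δ (f (w, x)) = G (w, x, fun k => δ (x k), fun k => δ (e w k)) from H κ hf
  clear hf f
  intro κ _
  induction κ using Finite.induction_empty_option with
  | @of_equiv α β eq ih =>
    intro _ W _ f hf
    have := Finite.of_equiv β eq.symm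
    obtain ⟨κ', _, e, G, he, hG, h⟩ := ih (f := fun p => f (p.1, fun k => p.2 (eq.symm k)))
      (hf.comp (by fun_prop))
    refine ⟨κ', inferInstance, e, fun p => G (p.1, fun k => p.2.1 (eq k), fun k => p.2.2.1 (eq k),
      p.2.2.2), he, by fun_prop, fun w x => ?_⟩
    have := h w (fun k => x (eq k))
    simp only [Equiv.apply_symm_apply] at this
    exact this
  | h_empty =>
    intro _ W _ f hf
    refine ⟨PUnit, inferInstance, fun w _ => f (w, fun k => k.elim), fun p => p.2.2.2 PUnit.unit,
      ?_, by fun_prop, fun w x => ?_⟩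
    · exact DefMap.pi fun _ => hf.comp (DefMap.prodMk (by fun_prop) (DefMap.pi fun k => k.elim))
    · rw [Subsingleton.elim x fun k => k.elim]
  | @h_option α _ ih =>
    intro _ W _ f hf
    let g : (W × (α → M.K)) × M.K → M.K := fun p =>
      f (p.1.1, fun o => o.elim p.2 p.1.2)
    have hg : M.DefMap g := by
      refine hf.comp (DefMap.prodMk (by fun_prop) (DefMap.pi fun o => ?_))
      rcases o with _ | k <;> simp only [Option.elim] <;> fun_prop
    obtain ⟨κ₁, _, e₁, G₁, he₁, hG₁, h₁⟩ := hg.exists_der_eq δ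
    choose κ₂ hκ₂ e₂ G₂ he₂ hG₂ h₂ using fun k : κ₁ =>
      ih (W := W) (f := fun p => e₁ p k) (by fun_prop)
    refine ⟨Σ k, κ₂ k, inferInstance, fun w q => e₂ q.1 w q.2, fun p =>
      G₁ ((p.1, fun k => p.2.1 (some k)), p.2.1 none, p.2.2.1 none, fun k =>
        G₂ k (p.1, fun j => p.2.1 (some j), fun j => p.2.2.1 (some j), fun q => p.2.2.2 ⟨k, q⟩)),
      ?_, ?_, fun w x => ?_⟩
    · exact DefMap.pi fun q => by have := he₂ q.1; fun_prop
    · refine hG₁.comp (DefMap.prodMk (by fun_prop) (DefMap.prodMk (by fun_prop)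
        (DefMap.prodMk (by fun_prop) (DefMap.pi fun k => (hG₂ k).comp (by fun_prop)))))
    · have := h₁ (w, fun k => x (some k)) (x none)
      simp only [h₂] at this
      refine Eq.trans ?_ this
      simp only [g]
      congr 3
      funext o
      cases o <;> rfl

end FieldStruc

end MS

namespace MS

open Topology Filter

namespace FieldStruc

variable {L : FieldLang.{u}} {M : FieldStruc L}
variable {E F W : Type u} [Ctx M E] [Ctx M F] [Ctx M W]
variable (δ : Derivation ℤ M.K M.K)

/-! ### Functions generated by definable functions -/

/-- Functions on `P` which are definable functions of a map `π` to a context and of finitely many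
functions from `A`. -/
def Gen {P : Type*} (π : P → E) (A : Set (P → M.K)) (T : P → M.K) : Prop :=
  ∃ (κ : Type) (_ : Finite κ) (t : κ → P → M.K) (G : E × (κ → M.K) → M.K),
    (∀ k, t k ∈ A) ∧ M.DefMap G ∧ ∀ p, T p = G (π p, fun k => t k p)

namespace Gen

variable {P : Type*} {π : P → E} {A B : Set (P → M.K)}

theorem of_mem {T : P → M.K} (hT : T ∈ A) : Gen π A T :=
  ⟨Unit, inferInstance, fun _ => T, fun q => q.2 (), fun _ => hT, by fun_prop, fun _ => rfl⟩

theorem comp {κ : Type} [Finite κ] {t : κ → P → M.K} (ht : ∀ k, Gen π A (t k))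
    {G : E × (κ → M.K) → M.K} (hG : M.DefMap G) : Gen π A (fun p => G (π p, fun k => t k p)) := by
  choose κ' hκ' t' G' ht' hG' h using ht
  refine ⟨Σ k, κ' k, inferInstance, fun q => t' q.1 q.2,
    fun q => G (q.1, fun k => G' k (q.1, fun j => q.2 ⟨k, j⟩)), fun q => ht' q.1 q.2, ?_,
    fun p => ?_⟩
  · exact hG.comp (DefMap.prodMk (by fun_prop) (DefMap.pi fun k => (hG' k).comp (by fun_prop)))
  · simp only [h]

variable [TopologicalSpace M.K] [M.IsTame]

/-- The chain rule `DefMap.exists_der_eq_pi` reduces the derivative of a generated function to the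
derivatives of its generators and of definable functions of `π`, and both are generated by
assumption. -/
theorem der {T : P → M.K} (hT : Gen π A T) (hAB : A ⊆ B)
    (hA : ∀ t ∈ A, Gen π B (fun p => δ (t p)))
    (hE : ∀ f : E → M.K, M.DefMap f → Gen π B (fun p => δ (f (π p)))) :
    Gen π B (fun p => δ (T p)) := by
  obtain ⟨κ, _, t, G, ht, hG, hT⟩ := hT
  obtain ⟨κ', _, e, H, he, hH, h⟩ := hG.exists_der_eq_pi δ
  have : ∀ p, δ (T p) = H (π p, fun k => t k p, fun k => δ (t k p), fun k => δ (e (π p) k)) :=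
    fun p => by rw [hT, h]
  rw [show (fun p => δ (T p)) = _ from funext this]
  refine comp (κ := κ ⊕ κ ⊕ κ') (t := Sum.elim t (Sum.elim (fun k p => δ (t k p))
    (fun k p => δ (e (π p) k)))) ?_ (G := fun q => H (q.1, fun k => q.2 (.inl k),
      fun k => q.2 (.inr (.inl k)), fun k => q.2 (.inr (.inr k)))) (by fun_prop)
  rintro (k | k | k)
  · exact of_mem (hAB (ht k))
  · exact hA _ (ht k)
  · exact hE (fun w => e w k) (by fun_prop)

theorem iterate_der {T : P → M.K} (hT : Gen π A T) (hA : ∀ t ∈ A, Gen π A (fun p => δ (t p)))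
    (hE : ∀ f : E → M.K, M.DefMap f → Gen π A (fun p => δ (f (π p)))) (n : ℕ) :
    Gen π A (fun p => δ^[n] (T p)) := by
  induction n with
  | zero => exact hT
  | succ n ih =>
    simp only [Function.iterate_succ', Function.comp]
    exact ih.der δ subset_rfl hA hE

end Gen

/-- The functions `δ^[n] ∘ c` with `c` definable. -/
def basic (W : Type u) [Ctx M W] : Set (W → M.K) :=
  {T | ∃ (n : ℕ) (c : W → M.K), M.DefMap c ∧ T = fun w => δ^[n] (c w)}

/-- The relations which are definable in terms of functions `δ^[n] ∘ c` with `c` definable. -/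
def Good (R : W → Prop) : Prop :=
  ∃ (κ : Type) (_ : Finite κ) (t : κ → W → M.K) (ψ : W × (κ → M.K) → Prop),
    (∀ k, t k ∈ basic δ W) ∧ M.Def ψ ∧ ∀ w, R w ↔ ψ (w, fun k => t k w)

variable {δ}

theorem iterate_mem_basic {c : W → M.K} (hc : M.DefMap c) (n : ℕ) :
    (fun w => δ^[n] (c w)) ∈ basic δ W := ⟨n, c, hc, rfl⟩

theorem der_mem_basic {T : W → M.K} (hT : T ∈ basic δ W) : (fun w => δ (T w)) ∈ basic δ W := by
  obtain ⟨n, c, hc, rfl⟩ := hT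
  exact ⟨n + 1, c, hc, by simp only [Function.iterate_succ', Function.comp]⟩

theorem comp_mem_basic {T : W → M.K} (hT : T ∈ basic δ W) {g : E → W} (hg : M.DefMap g) :
    (fun e => T (g e)) ∈ basic δ E := by
  obtain ⟨n, c, hc, rfl⟩ := hT
  exact ⟨n, fun e => c (g e), hc.comp hg, rfl⟩

theorem gen_iterate_basic [TopologicalSpace M.K] [M.IsTame] {T : W → M.K}
    (hT : Gen (fun w : W => w) (basic δ W) T) (n : ℕ) :
    Gen (fun w : W => w) (basic δ W) (fun w => δ^[n] (T w)) :=
  hT.iterate_der δ (fun _ ht => Gen.of_mem (der_mem_basic ht))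
    (fun _ hf => Gen.of_mem (iterate_mem_basic hf 1)) n

namespace Good

theorem congr {R R' : W → Prop} (h : Good δ R) (hR : ∀ w, R' w ↔ R w) : Good δ R' := by
  obtain ⟨κ, _, t, ψ, ht, hψ, h⟩ := h
  exact ⟨κ, inferInstance, t, ψ, ht, hψ, fun w => (hR w).trans (h w)⟩

theorem of_gen {κ : Type} [Finite κ] {t : κ → W → M.K}
    (ht : ∀ k, Gen (fun w : W => w) (basic δ W) (t k)) {ψ : W × (κ → M.K) → Prop} (hψ : M.Def ψ) :
    Good δ (fun w => ψ (w, fun k => t k w)) := by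
  choose κ' hκ' t' G' ht' hG' h using ht
  refine ⟨Σ k, κ' k, inferInstance, fun q => t' q.1 q.2,
    fun q => ψ (q.1, fun k => G' k (q.1, fun j => q.2 ⟨k, j⟩)), fun q => ht' q.1 q.2, ?_,
    fun p => ?_⟩
  · exact hψ.comp (DefMap.prodMk (by fun_prop) (DefMap.pi fun k => (hG' k).comp (by fun_prop)))
  · simp only [h]

theorem of_def {R : W → Prop} (hR : M.Def R) : Good δ R :=
  ⟨Empty, inferInstance, fun k => k.elim, fun q => R q.1, fun k => k.elim, hR.comp_fst,
    fun _ => Iff.rfl⟩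

theorem imp {R R' : W → Prop} (h : Good δ R) (h' : Good δ R') : Good δ (fun w => R w → R' w) := by
  obtain ⟨κ, _, t, ψ, ht, hψ, h⟩ := h
  obtain ⟨κ', _, t', ψ', ht', hψ', h'⟩ := h'
  refine ⟨κ ⊕ κ', inferInstance, Sum.elim t t', fun q => ψ (q.1, fun k => q.2 (.inl k)) →
    ψ' (q.1, fun k => q.2 (.inr k)), ?_, ?_, fun w => imp_congr (h w) (h' w)⟩
  · rintro (k | k)
    exacts [ht k, ht' k]
  · exact (hψ.comp (g := fun q : W × (κ ⊕ κ' → M.K) => (q.1, fun k => q.2 (.inl k)))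
      (by fun_prop)).imp (hψ'.comp (g := fun q : W × (κ ⊕ κ' → M.K) =>
        (q.1, fun k => q.2 (.inr k))) (by fun_prop))

theorem not {R : W → Prop} (h : Good δ R) : Good δ (fun w => ¬ R w) := h.imp (of_def (Def.const _))

theorem and {R R' : W → Prop} (h : Good δ R) (h' : Good δ R') : Good δ (fun w => R w ∧ R' w) :=
  (h.imp h'.not).not.congr fun w => by tauto

theorem or {R R' : W → Prop} (h : Good δ R) (h' : Good δ R') : Good δ (fun w => R w ∨ R' w) :=
  (h.not.imp h').congr fun w => by tauto

theorem comp {R : W → Prop} (h : Good δ R) {g : E → W} (hg : M.DefMap g) :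
    Good δ (fun e => R (g e)) := by
  obtain ⟨κ, _, t, ψ, ht, hψ, h⟩ := h
  exact ⟨κ, inferInstance, fun k e => t k (g e), fun q => ψ (g q.1, q.2),
    fun k => comp_mem_basic (ht k) hg, hψ.comp (by fun_prop), fun e => h _⟩

variable [TopologicalSpace M.K] [M.IsTame]

/-- Substitution turns a term $\delta^n(c(w,s))$ into an iterated derivative of a generated
function, and generated functions over `basic` are closed under $\delta$. -/
theorem subst {κ : Type} [Finite κ] {R : W × (κ → M.K) → Prop} (h : Good δ R) {s : κ → W → M.K}
    (hs : ∀ k, Gen (fun w : W => w) (basic δ W) (s k)) : Good δ (fun w => R (w, fun k => s k w)) :=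
        by
  obtain ⟨κ', _, t, ψ, ht, hψ, h⟩ := h
  refine (of_gen (κ := κ ⊕ κ') (t := Sum.elim s fun k w => t k (w, fun k => s k w)) ?_
    (ψ := fun q => ψ ((q.1, fun k => q.2 (.inl k)), fun k => q.2 (.inr k))) ?_).congr
      fun w => h _
  · rintro (k | k)
    · exact hs k
    · obtain ⟨n, c, hc, hT⟩ := ht k
      simp only [Sum.elim_inr, hT]
      exact gen_iterate_basic (Gen.comp hs hc) n
  · exact hψ.comp (by fun_prop)

/-- If derivatives of finitely many elements of the field are substituted into a relation, it can be
expressed by derivatives of these elements and by terms in the remaining variables. -/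
theorem exists_separated {κ₀ κ : Type} [Finite κ₀] [Finite κ] {R : W × (κ₀ → M.K) → Prop}
    (h : Good δ R) (o₀ : κ₀ → κ) (n₀ : κ₀ → ℕ) :
    ∃ (κ' : Type) (_ : Finite κ') (t : κ' → W → M.K) (m : ℕ)
      (ψ : W × (κ' → M.K) × (κ → Fin m → M.K) → Prop), (∀ k, t k ∈ basic δ W) ∧ M.Def ψ ∧
      ∀ w (x : κ → M.K), R (w, fun k => δ^[n₀ k] (x (o₀ k)))
        ↔ ψ (w, fun k => t k w, fun k i => δ^[i] (x k)) := by
  obtain ⟨κ₁, _, t₁, ψ₁, ht₁, hψ₁, h⟩ := h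
  let A : Set (W × (κ → M.K) → M.K) := {T | ∃ t ∈ basic δ W, T = fun p => t p.1} ∪
    {T | ∃ (k : κ) (n : ℕ), T = fun p => δ^[n] (p.2 k)}
  have hA : ∀ t ∈ A, Gen (M := M) Prod.fst A (fun p => δ (t p)) := by
    rintro _ (⟨t, ht, rfl⟩ | ⟨k, n, rfl⟩)
    · exact Gen.of_mem (Or.inl ⟨_, der_mem_basic ht, rfl⟩)
    · exact Gen.of_mem (Or.inr ⟨k, n + 1, by simp only [Function.iterate_succ', Function.comp]⟩)
  have hE : ∀ f : W → M.K, M.DefMap f →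
      Gen (M := M) Prod.fst A (fun p : W × (κ → M.K) => δ (f p.1)) := fun f hf =>
    Gen.of_mem (Or.inl ⟨_, iterate_mem_basic hf 1, rfl⟩)
  have h1 : ∀ k, Gen (M := M) Prod.fst A
      (fun p : W × (κ → M.K) => t₁ k (p.1, fun k => δ^[n₀ k] (p.2 (o₀ k)))) := by
    intro k
    obtain ⟨n, c, hc, hT⟩ := ht₁ k
    rw [hT]
    refine Gen.iterate_der δ ?_ hA hE n
    exact Gen.comp (t := fun k (p : W × (κ → M.K)) => δ^[n₀ k] (p.2 (o₀ k)))
      (fun k => Gen.of_mem (Or.inr ⟨_, _, rfl⟩)) hc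
  choose κ₂ hκ₂ t₂ G₂ ht₂ hG₂ h₂ using h1
  have hsplit : ∀ q : Σ k, κ₂ k, ∃ (t : W → M.K) (k : Option κ) (n : ℕ), t ∈ basic δ W ∧
      ∀ w x, t₂ q.1 q.2 (w, x) = k.elim (t w) fun k => δ^[n] (x k) := by
    intro q
    rcases ht₂ q.1 q.2 with ⟨t, ht, h⟩ | ⟨k, n, h⟩
    · exact ⟨t, none, 0, ht, fun w x => by rw [h]; rfl⟩
    · exact ⟨fun _ => 0, some k, n, ⟨0, _, DefMap.zero, rfl⟩, fun w x => by rw [h]; rfl⟩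
  choose t o n ht hto using hsplit
  obtain ⟨m, hm0, hm⟩ : ∃ m, (∀ k, n₀ k < m) ∧ ∀ q, n q < m := by
    obtain ⟨b, hb⟩ := (Set.finite_range n).bddAbove
    obtain ⟨b', hb'⟩ := (Set.finite_range n₀).bddAbove
    exact ⟨b + b' + 1, fun k => by have : n₀ k ≤ b' := hb' ⟨k, rfl⟩; omega,
      fun q => by have : n q ≤ b := hb ⟨q, rfl⟩; omega⟩
  let N : W × ((Σ k, κ₂ k) → M.K) × (κ → Fin m → M.K) → (Σ k, κ₂ k) → M.K := fun p q =>
    (o q).elim (p.2.1 q) fun i => p.2.2 i ⟨n q, hm q⟩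
  have hN : M.DefMap N := by
    refine DefMap.pi fun q => ?_
    simp only [N]
    rcases o q with _ | i <;> simp only [Option.elim] <;> fun_prop
  refine ⟨Σ k, κ₂ k, inferInstance, t, m, fun p : W × ((Σ k, κ₂ k) → M.K) × (κ → Fin m → M.K) =>
    ψ₁ ((p.1, fun k => p.2.2 (o₀ k) ⟨n₀ k, hm0 k⟩), fun k => G₂ k (p.1, fun j => N p ⟨k, j⟩)), ht,
    ?_, fun w x => ?_⟩
  · exact hψ₁.comp (DefMap.prodMk (by fun_prop) (DefMap.pi fun k => (hG₂ k).comp (by fun_prop)))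
  · rw [h]
    refine iff_of_eq (congrArg ψ₁ (Prod.ext rfl (funext fun k => ?_)))
    refine (h₂ k (w, x)).trans ?_
    refine congrArg (G₂ k) (Prod.ext rfl (funext fun j => ?_))
    simp only [N]
    rw [hto ⟨k, j⟩ w x]

end Good

end FieldStruc

end MS

namespace MS

open Topology Filter

namespace FieldStruc

variable {L : FieldLang.{u}} {M : FieldStruc L}
variable {E F W : Type u} [Ctx M E] [Ctx M F] [Ctx M W]

/-! ### Generic points of definable sets -/

section

variable {K : Type*} [Field K] {m D : ℕ}

/-- The value at `x` of the `i`-th derivative with respect to the last variable of the polynomial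
with coefficients `p`. -/
def boxEvalDeriv (p : (Fin (m + 1) → Fin (D + 1)) → K) (i : ℕ) (x : Fin (m + 1) → K) : K :=
  evalDeriv (fun j => boxEval (fun s => p (Fin.snoc s j)) (Fin.init x)) i (x (Fin.last m))

/-- The `i`-th derivative with respect to the last variable of the polynomial with coefficients
`p`. -/
noncomputable def boxPoly (p : (Fin (m + 1) → Fin (D + 1)) → K) (i : ℕ) :
    MvPolynomial (Fin (m + 1)) K :=
  ∑ s : Fin (m + 1) → Fin (D + 1), MvPolynomial.monomial
    (Finsupp.equivFunOnFinite.symm (Fin.snoc (fun k => (s k.castSucc : ℕ)) ((s (Fin.last m) :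
        ℕ) - i) :
      Fin (m + 1) → ℕ)) (p s * ((s (Fin.last m) : ℕ).descFactorial i : ℕ))

theorem eval_boxPoly (p : (Fin (m + 1) → Fin (D + 1)) → K) (i : ℕ) (x : Fin (m + 1) → K) :
    MvPolynomial.eval x (boxPoly p i) = boxEvalDeriv p i x := by
  rw [boxPoly, map_sum, ← (Fin.snocEquiv (fun _ : Fin (m + 1) => Fin (D + 1))).sum_comp,
    Fintype.sum_prod_type]
  simp only [boxEvalDeriv, evalDeriv, boxEval, Finset.sum_mul]
  refine Finset.sum_congr rfl fun j _ => Finset.sum_congr rfl fun s _ => ?_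
  rw [MvPolynomial.eval_monomial, Finsupp.prod_fintype _ _ (fun _ => pow_zero _),
    Fin.prod_univ_castSucc]
  simp [Fin.snocEquiv, Fin.init]
  ring

theorem pderiv_boxPoly (p : (Fin (m + 1) → Fin (D + 1)) → K) (i : ℕ) :
    MvPolynomial.pderiv (Fin.last m) (boxPoly p i) = boxPoly p (i + 1) := by
  classical
  rw [boxPoly, boxPoly, map_sum]
  refine Finset.sum_congr rfl fun s _ => ?_
  rw [MvPolynomial.pderiv_monomial]
  congr 1
  · congr 1
    ext k
    refine Fin.lastCases ?_ (fun k => ?_) k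
    · simp [Nat.sub_sub]
    · simp
  · simp [Nat.descFactorial_succ]
    ring

end

theorem DefMap.boxEval {n D : ℕ} {p : E → (Fin n → Fin (D + 1)) → M.K} {x : E → Fin n → M.K}
    (hp : M.DefMap p) (hx : M.DefMap x) : M.DefMap (fun e => MS.boxEval (p e) (x e)) := by
  unfold MS.boxEval
  fun_prop

theorem DefMap.boxEvalDeriv {n D : ℕ} {p : E → (Fin (n + 1) → Fin (D + 1)) → M.K}
    {x : E → Fin (n + 1) → M.K} (hp : M.DefMap p) (hx : M.DefMap x) (i : ℕ) :
    M.DefMap (fun e => FieldStruc.boxEvalDeriv (p e) i (x e)) := by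
  unfold FieldStruc.boxEvalDeriv
  refine DefMap.evalDeriv (DefMap.pi fun j => DefMap.boxEval (by fun_prop) ?_) (by fun_prop) i
  unfold Fin.init
  fun_prop

variable [TopologicalSpace M.K] [M.IsTame]

/-- Vertical fibres of `V` over points of `A` are finite, so each point of `A` is alone in its fibre
within some basic neighbourhood. By directedness this neighbourhood may be fixed. Thicken the
resulting part of `A` vertically: if its projection were not small, the thickening would have an
interior point above some base point. But near a point of `A` there are points of `V` outside `A`,
and isolation in the fibre excludes them from lying over the projection of the thickened part. -/
theorem small_of_not_eventually {n : ℕ} {A V : W → (Fin (n + 1) → M.K) → Prop}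
    (hA : M.Def (fun p : W × (Fin (n + 1) → M.K) => A p.1 p.2))
    (hV : M.Def (fun p : W × (Fin (n + 1) → M.K) => V p.1 p.2)) {w : W}
    (hfin : ∀ x y, A w (Fin.snoc x y) → {t | V w (Fin.snoc x t)}.Finite)
    (hne : ∀ x, A w x → ¬ ∀ᶠ y in 𝓝 x, V w y → A w y) :
    Small {x | ∃ y, A w (Fin.snoc x y)} := by
  obtain ⟨Z, _, B, hB, hb, hb1, -⟩ := exists_basis M
  have hBdir : ∀ z₁ z₂, ∃ z, B z ⊆ B z₁ ∩ B z₂ := fun z₁ z₂ => by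
    obtain ⟨z, -, hz⟩ := hb.mem_iff.1 (inter_mem (hb.mem_of_mem (i := z₁) trivial)
      (hb.mem_of_mem (i := z₂) trivial))
    exact ⟨z, hz⟩
  have hZ : Nonempty Z := by
    obtain ⟨z, -⟩ := hb.ex_mem
    exact ⟨z⟩
  let A' : W × Z → (Fin n → M.K) × M.K → Prop := fun q p =>
    A q.1 (Fin.snoc p.1 p.2) ∧ ∀ t, V q.1 (Fin.snoc p.1 t) → t - p.2 ∈ B q.2 → t = p.2
  have hA' : M.Def (fun r : (W × Z) × (Fin n → M.K) × M.K => A' r.1 r.2) := by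
    refine (hA.comp (g := fun r : (W × Z) × (Fin n → M.K) × M.K =>
      (r.1.1, (Fin.snoc r.2.1 r.2.2 : Fin (n + 1) → M.K))) (by fun_prop)).and (Def.all ?_)
    refine (hV.comp (g := fun r : ((W × Z) × (Fin n → M.K) × M.K) × M.K =>
      (r.1.1.1, (Fin.snoc r.1.2.1 r.2 : Fin (n + 1) → M.K))) (by fun_prop)).imp
      ((hB.comp (g := fun r : ((W × Z) × (Fin n → M.K) × M.K) × M.K =>
        (r.2 - r.1.2.2, r.1.1.2)) (by fun_prop)).imp (Def.eq_fun (by fun_prop) (by fun_prop)))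
  have hcover : {x | ∃ y, A w (Fin.snoc x y)} ⊆ {x | ∃ z, ∃ y, A' (w, z) (x, y)} := by
    rintro x ⟨y, hy⟩
    have h1 : {t | V w (Fin.snoc x t)} \ {y} ∈ {s : Set M.K | s.Finite} := (hfin x y hy).sdiff
    have h2 : ({t | V w (Fin.snoc x t)} \ {y})ᶜ ∈ 𝓝 y :=
      (Set.Finite.isClosed h1).isOpen_compl.mem_nhds (by simp)
    obtain ⟨z, -, hz⟩ := (hb1 y).mem_iff.1 h2
    refine ⟨z, y, hy, fun t ht htz => ?_⟩
    by_contra hty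
    exact hz htz ⟨ht, hty⟩
  refine Small.mono ?_ hcover
  refine small_iUnion_of_directed (W := W × Z) (X := fun q x => ∃ y, A' q (x, y)) ?_
    (g := fun z => (w, z)) ?_ ?_
  · exact Def.ex (hA'.comp (g := fun r : ((W × Z) × (Fin n → M.K)) × M.K =>
      (r.1.1, (r.1.2, r.2))) (by fun_prop))
  · intro z₁ z₂
    obtain ⟨z, hz⟩ := hBdir z₁ z₂
    exact ⟨z, fun x ⟨y, hy⟩ => ⟨y, hy.1, fun t ht h => hy.2 t ht (hz h).1⟩,
      fun x ⟨y, hy⟩ => ⟨y, hy.1, fun t ht h => hy.2 t ht (hz h).2⟩⟩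
  intro z
  obtain ⟨z₂, hz₂⟩ : ∃ z₂, ∀ a ∈ B z₂, ∀ b ∈ B z₂, a - b ∈ B z := by
    have h1 : Tendsto (fun q : M.K × M.K => q.1 - q.2) (𝓝 0 ×ˢ 𝓝 0) (𝓝 0) := by
      rw [← nhds_prod_eq]
      simpa using (Continuous.tendsto (by fun_prop : Continuous fun q : M.K × M.K => q.1 - q.2)
        (0, 0))
    obtain ⟨z₂, -, h2⟩ := (hb.prod_self.tendsto_iff hb).1 h1 z trivial
    exact ⟨z₂, fun a ha b hb' => h2 (a, b) ⟨ha, hb'⟩⟩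
  -- The vertical thickening. The part of `Y` outside its interior has empty interior and is small;
  -- it will be shown to have infinite fibres over the projection of `A'`.
  let Y : (W × Z) × Z → (Fin (n + 1) → M.K) → Prop := fun q x =>
    ∃ y, y - x (Fin.last n) ∈ B q.2 ∧ A' q.1 (fun i => x i.castSucc, y)
  have hY : M.Def (fun r : ((W × Z) × Z) × (Fin (n + 1) → M.K) => Y r.1 r.2) := by
    refine Def.ex ((hB.comp (g := fun r : (((W × Z) × Z) × (Fin (n + 1) → M.K)) × M.K =>
      (r.2 - r.1.2 (Fin.last n), r.1.1.2)) (by fun_prop)).and (hA'.comp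
      (g := fun r : (((W × Z) × Z) × (Fin (n + 1) → M.K)) × M.K =>
        (r.1.1.1, (fun i => r.1.2 i.castSucc, r.2))) (by fun_prop)))
  have hYb : Small {x | Y ((w, z), z₂) x ∧ ¬ ∀ᶠ x' in 𝓝 x, Y ((w, z), z₂) x'} := by
    refine small_of_interior_eq_empty (W := (W × Z) × Z)
      (X := fun q x => Y q x ∧ ¬ ∀ᶠ x' in 𝓝 x, Y q x') ?_ fun x hx => ?_
    · refine hY.and (Def.not (Def.eventually_pi (E := ((W × Z) × Z) × (Fin (n + 1) → M.K))
        (R := fun p x => Y p.1 x) (g := fun p => p.2) ?_ (by fun_prop)))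
      exact hY.comp (g := fun p : (((W × Z) × Z) × (Fin (n + 1) → M.K)) × (Fin (n + 1) → M.K) =>
        (p.1.1, p.2)) (by fun_prop)
    · exact hx.self_of_nhds.2 (hx.mono fun _ h => h.1)
  refine (small_succ.1 hYb).mono ?_
  rintro x ⟨y, hy⟩
  have h1 : ∀ᶠ t in 𝓝 y, y - t ∈ interior (B z₂) := by
    have : Tendsto (fun t : M.K => y - t) (𝓝 y) (𝓝 (y - y)) := Continuous.tendsto (by fun_prop) y
    rw [sub_self] at this
    exact this.eventually (isOpen_interior.mem_nhds
      (mem_interior_iff_mem_nhds.2 (hb.mem_of_mem trivial)))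
  have := neBot_nhdsNE y
  refine Set.Infinite.mono ?_ (infinite_of_mem_nhds y h1)
  intro t ht
  refine ⟨⟨y, by simpa using interior_subset ht, by simpa using hy⟩, fun hint => ?_⟩
  have h2 : Tendsto (fun x' : Fin (n + 1) → M.K => (Fin.snoc (Fin.init x') t : Fin (n + 1) → M.K))
      (𝓝 (Fin.snoc x y)) (𝓝 (Fin.snoc x t)) := by
    have : Continuous (fun x' : Fin (n + 1) → M.K =>
        (Fin.snoc (Fin.init x') t : Fin (n + 1) → M.K)) := by
      unfold Fin.init
      fun_prop
    simpa using this.tendsto (Fin.snoc x y)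
  have h3 : ∀ᶠ x' in 𝓝 (Fin.snoc x y : Fin (n + 1) → M.K),
      x' (Fin.last n) - t ∈ interior (B z₂) := by
    have : Tendsto (fun x' : Fin (n + 1) → M.K => x' (Fin.last n) - t) (𝓝 (Fin.snoc x y))
        (𝓝 (y - t)) := by
      simpa using (Continuous.tendsto (by fun_prop :
        Continuous fun x' : Fin (n + 1) → M.K => x' (Fin.last n) - t) (Fin.snoc x y))
    exact this.eventually (isOpen_interior.mem_nhds ht)
  -- Here `x'` lies in `V` but not in `A`. If the thickening were a neighbourhood of the point at
  -- height `t`, there would be a point of `A'` over the same base as `x'`. Both have last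
  -- coordinates close to `t`, so isolation makes them equal and puts `x'` into `A`.
  have h4 := (Filter.not_eventually.1 (hne _ hy.1)).and_eventually ((h2.eventually hint).and h3)
  obtain ⟨x', hx', ⟨y'', hy''t, hy''⟩, hx't⟩ := h4.exists
  push Not at hx'
  simp only [Fin.snoc_last, Fin.snoc_castSucc, Fin.init] at hy''t hy''
  have e : (Fin.snoc (fun i => x' (Fin.castSucc i)) (x' (Fin.last n)) : Fin (n + 1) → M.K) = x' :=
    Fin.snoc_init_self x'
  have h5 := hy''.2 (x' (Fin.last n)) (by rw [e]; exact hx'.1) (by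
    have := hz₂ _ (interior_subset hx't) _ hy''t
    simpa using this)
  refine hx'.2 ?_
  have h6 := hy''.1
  rwa [← show x' (Fin.last n) = y'' from h5, e] at h6

/-- If a member of a definable family has no interior and is nowhere locally a smooth algebraic
hypersurface transversal to the last axis, then its projection is small. -/
theorem exists_small_proj {n : ℕ} {X : W → (Fin (n + 1) → M.K) → Prop}
    (hX : M.Def (fun p : W × (Fin (n + 1) → M.K) => X p.1 p.2)) :
    ∃ D : ℕ, ∀ w, (∀ x, ¬ ∀ᶠ y in 𝓝 x, X w y) →
      (∀ (i : Fin (D + 1)) (p : (Fin (n + 1) → Fin (D + 1)) → M.K) (x : Fin (n + 1) → M.K),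
        boxEvalDeriv p i x = 0 → boxEvalDeriv p (i + 1) x ≠ 0 →
        ¬ ∀ᶠ y in 𝓝 x, boxEvalDeriv p i y = 0 → X w y) →
      Small {x | ∃ y, X w (Fin.snoc x y)} := by
  obtain ⟨D, hD⟩ := exists_boxEval_eq_zero_of_mem_frontier hX
  refine ⟨D, fun w hint hnice => ?_⟩
  obtain ⟨p, hp, h⟩ := hD w
  -- Without interior, the set lies on the hypersurface `p = 0`. Apart from points whose vertical
  -- line is contained in it, each of its points is a simple root in the last variable of some
  -- derivative of `p`. These strata are handled by `small_of_not_eventually`.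
  have hXp : ∀ x, X w x → boxEval p x = 0 := fun x hx =>
    h x ⟨subset_closure hx, fun hx' => hint x (mem_interior_iff_mem_nhds.1 hx')⟩
  have hi : ∀ i : Fin (D + 1), Small {x | ∃ y, X w (Fin.snoc x y) ∧
      boxEvalDeriv p i (Fin.snoc x y) = 0 ∧ boxEvalDeriv p (i + 1) (Fin.snoc x y) ≠ 0} := by
    intro i
    refine small_of_not_eventually (W := W × ((Fin (n + 1) → Fin (D + 1)) → M.K)) (w := (w, p))
      (A := fun q x => X q.1 x ∧ boxEvalDeriv q.2 i x = 0 ∧ boxEvalDeriv q.2 (i + 1) x ≠ 0)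
      (V := fun q x => boxEvalDeriv q.2 i x = 0) ?_ ?_ ?_ ?_
    · exact (hX.comp (g := fun q : (W × ((Fin (n + 1) → Fin (D + 1)) → M.K)) ×
        (Fin (n + 1) → M.K) => (q.1.1, q.2)) (by fun_prop)).and
        ((Def.eq_zero (DefMap.boxEvalDeriv (by fun_prop) (by fun_prop) i)).and
        (Def.eq_zero (DefMap.boxEvalDeriv (by fun_prop) (by fun_prop) (i + 1))).not)
    · exact Def.eq_zero (DefMap.boxEvalDeriv (by fun_prop) (by fun_prop) i)
    · intro x y hxy
      have := hxy.2.2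
      simp only [boxEvalDeriv, Fin.init_snoc, Fin.snoc_last] at this ⊢
      exact finite_evalDeriv_eq_zero this
    · intro x hx hev
      exact hnice i p x hx.2.1 hx.2.2 (hev.mono fun y hy h0 => (hy h0).1)
  obtain ⟨s, hs⟩ := Function.ne_iff.1 hp
  have h0 : Small {x | ∀ j, boxEval (fun s => p (Fin.snoc s j)) x = 0} := by
    refine (small_boxEval_eq_zero (p := fun s' => p (Fin.snoc s' (s (Fin.last n)))) ?_).mono
      fun x hx => hx _
    refine Function.ne_iff.2 ⟨Fin.init s, ?_⟩
    rwa [Fin.snoc_init_self]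
  refine (h0.union (Small.biUnion Finset.univ fun i _ => hi i)).mono ?_
  rintro x ⟨y, hy⟩
  by_cases hc : (fun j => boxEval (fun s => p (Fin.snoc s j)) x) = 0
  · exact Or.inl fun j => congrFun hc j
  · obtain ⟨i, h1, h2⟩ := exists_evalDeriv_eq_zero_ne_zero hc (y := y) (by
      rw [← boxEval_snoc]
      exact hXp _ hy)
    refine Or.inr (Set.mem_biUnion (Finset.mem_coe.2 (Finset.mem_univ i)) ⟨y, hy, ?_, ?_⟩)
    · simpa [boxEvalDeriv, Fin.init_snoc] using h1
    · simpa [boxEvalDeriv, Fin.init_snoc] using h2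

end FieldStruc

end MS

/-! ### Elimination of quantifiers down to definable relations between iterated derivatives. -/

namespace MS

open Topology Filter

namespace FieldStruc

variable {L : FieldLang.{u}} {M : FieldStruc L}
variable {E F W : Type u} [Ctx M E] [Ctx M F] [Ctx M W]

/-- Sorts the generators of finitely many functions into those pulled back along `π` and the members
of `s`, so that one definable map computes all the functions. -/
theorem Gen.exists_separated {δ : Derivation ℤ M.K M.K} {P : Type*} {π : P → W} {ι : Type}
    [Finite ι] {s : ι → P → M.K} {J : Type} [Finite J] {T : J → P → M.K}
    (hT : ∀ j, Gen π ({T | ∃ t ∈ basic δ W, T = fun p => t (π p)} ∪ Set.range s) (T j)) :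
    ∃ (κ : Type) (_ : Finite κ) (t : κ → W → M.K) (G : W × (κ → M.K) × (ι → M.K) → J → M.K),
      (∀ k, t k ∈ basic δ W) ∧ M.DefMap G ∧
      ∀ p j, T j p = G (π p, fun k => t k (π p), fun i => s i p) j := by
  choose κ hκ t G ht hG h using hT
  have hsplit : ∀ q : Σ j, κ j, ∃ (t' : W → M.K) (i : Option ι), t' ∈ basic δ W ∧
      ∀ p, t q.1 q.2 p = i.elim (t' (π p)) fun i => s i p := by
    intro q
    rcases ht q.1 q.2 with ⟨t', ht', h⟩ | ⟨i, h⟩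
    · exact ⟨t', none, ht', fun p => by rw [h]; rfl⟩
    · exact ⟨fun _ => 0, some i, ⟨0, _, DefMap.zero, rfl⟩, fun p => by rw [← h]; rfl⟩
  choose t' o ht' hto using hsplit
  let N : W × ((Σ j, κ j) → M.K) × (ι → M.K) → (Σ j, κ j) → M.K := fun p q =>
    (o q).elim (p.2.1 q) fun i => p.2.2 i
  have hN : M.DefMap N := by
    refine DefMap.pi fun q => ?_
    simp only [N]
    rcases o q with _ | i <;> simp only [Option.elim] <;> fun_prop
  refine ⟨Σ j, κ j, inferInstance, t', fun p j => G j (p.1, fun k => N p ⟨j, k⟩), ht',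
    DefMap.pi fun j => (hG j).comp (by fun_prop), fun p j => ?_⟩
  rw [h]
  refine congrArg (G j) (Prod.ext rfl (funext fun k => ?_))
  simp only [N]
  rw [hto ⟨j, k⟩ p]

instance instCtxDerSort (d : M.K → M.K) (s : L.diff.Srt) : Ctx M ((M.withDer d).carrier s) :=
  instCtxSort M s

instance instCtxDerVal (d : M.K → M.K) {n : ℕ} (Γ : Fin n → L.diff.Srt) :
    Ctx M ((M.withDer d).Val Γ) :=
  instCtxVal M Γ

theorem DefMap.derVal_apply {d : M.K → M.K} {n : ℕ} {Γ : Fin n → L.diff.Srt} (k : Fin n) :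
    M.DefMap (fun v : (M.withDer d).Val Γ => v k) :=
  DefMap.val_apply (L := L) (Γ := (Γ : Fin n → L.base.Srt)) k

variable [TopologicalSpace M.K]

/-- The scheme (DL), with the topology in place of the formula defining it. -/
def IsGeneric (δ : Derivation ℤ M.K M.K) : Prop :=
  ∀ (m : ℕ), 1 ≤ m → ∀ (P : MvPolynomial (Fin (m + 1)) M.K) (y : Fin (m + 1) → M.K),
    MvPolynomial.eval y P = 0 → MvPolynomial.eval y (MvPolynomial.pderiv (Fin.last m) P) ≠ 0 →
    ∀ U ∈ 𝓝 y, ∃ x : M.K, MvPolynomial.eval (fun i : Fin (m + 1) => δ^[i] x) P = 0 ∧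
      (fun i : Fin (m + 1) => δ^[i] x) ∈ U

variable [M.IsTame] {δ : Derivation ℤ M.K M.K}

/-- Induction on the length `k` of the truncated jet confined to a small set. Truncated jets with
infinite fibre lie in a small set one dimension lower. Otherwise the last coordinate of the
truncated jet lies in a finite definable set over the earlier ones, so its derivative, and then
every higher derivative, is a function of the truncated jet and of terms in `w`. The condition `X`
becomes one on a jet of order less than `m`, to which `ih` applies. -/
theorem good_exists_jet_of_small {m : ℕ}
    (ih : ∀ k < m, ∀ {W : Type u} [Ctx M W] {X : W → (Fin (k + 1) → M.K) → Prop},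
      M.Def (fun p : W × (Fin (k + 1) → M.K) => X p.1 p.2) →
      Good δ (fun w => ∃ b, X w fun i => δ^[i] b)) {k : ℕ} (hk : k ≤ m)
    {X : W → (Fin (m + 1) → M.K) → Prop} (hX : M.Def (fun p : W × (Fin (m + 1) → M.K) => X p.1 p.2))
    {B : W → (Fin k → M.K) → Prop} (hB : M.Def (fun p : W × (Fin k → M.K) => B p.1 p.2))
    (hBs : ∀ w, Small {x | B w x}) (hXB : ∀ w b, (X w fun i => δ^[i] b) → B w fun i => δ^[i] b) :
    Good δ (fun w => ∃ b, X w fun i => δ^[i] b) := by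
  induction k generalizing X with
  | zero =>
    refine (Good.of_def (Def.const False)).congr fun w => ?_
    simp only [iff_false, not_exists]
    intro b hb
    exact Set.eq_empty_iff_forall_notMem.1 (show _ = ∅ from hBs w) _ (hXB w b hb)
  | succ k ihk =>
    have hS : M.Def (fun p : (W × (Fin k → M.K)) × M.K => B p.1.1 (Fin.snoc p.1.2 p.2)) :=
      hB.comp (g := fun p : (W × (Fin k → M.K)) × M.K => (p.1.1, (Fin.snoc p.1.2 p.2 :
          Fin (k + 1) → M.K)))
        (by fun_prop)
    have hSf : M.Def (fun p : W × (Fin k → M.K) => {y | B p.1 (Fin.snoc p.2 y)}.Finite) :=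
      Def.finite (W := W × (Fin k → M.K)) (X := fun p y => B p.1 (Fin.snoc p.2 y)) hS
    have hSf' : M.Def (fun p : W × (Fin (m + 1) → M.K) =>
        {y | B p.1 (Fin.snoc (fun i : Fin k => p.2 (Fin.castLE (by omega) i)) y)}.Finite) :=
      hSf.comp (g := fun p : W × (Fin (m + 1) → M.K) =>
        (p.1, fun i : Fin k => p.2 (Fin.castLE (by omega) i))) (by fun_prop)
    have h1 : Good δ (fun w => ∃ b, X w (fun i => δ^[i] b) ∧
        ¬ {y | B w (Fin.snoc (fun i : Fin k => δ^[i] b) y)}.Finite) :=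
      ihk (by omega) (B := fun w x => ¬ {y | B w (Fin.snoc x y)}.Finite)
        (X := fun w x => X w x ∧
          ¬ {y | B w (Fin.snoc (fun i : Fin k => x (Fin.castLE (by omega) i)) y)}.Finite)
        (hX.and hSf'.not) hSf.not (fun w => small_succ.1 (hBs w)) fun w b h => h.2
    obtain ⟨κ, _, e, G, he, hG, hFV⟩ := exists_der_eq_of_finite δ (W := W × (Fin k → M.K))
      (S := fun p y => B p.1 (Fin.snoc p.2 y)) hS
    -- The formula for $\delta^{k+1}b$ is valid only where the fibre is finite and contains
    -- $\delta^k b$, so the functions to be generated live on this subtype. On it the generators `A`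
    -- are closed under $\delta$ up to definable functions.
    let P := {q : W × M.K // {y | B q.1 (Fin.snoc (fun i : Fin k => δ^[i] q.2) y)}.Finite ∧
      B q.1 (Fin.snoc (fun i : Fin k => δ^[i] q.2) (δ^[k] q.2))}
    let π : P → W := fun q => q.1.1
    let A : Set (P → M.K) := {T | ∃ t ∈ basic δ W, T = fun p => t (π p)} ∪
      Set.range fun (i : Fin (k + 1)) (q : P) => δ^[i] q.1.2
    let A' : Set (P → M.K) := Set.range fun (i : Fin k) (q : P) => δ^[i] q.1.2
    have hbas : ∀ t ∈ basic δ W, Gen (M := M) π A (fun p => t (π p)) := fun t ht =>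
      Gen.of_mem (Or.inl ⟨t, ht, rfl⟩)
    have hE : ∀ f : W → M.K, M.DefMap f → Gen π A (fun p => δ (f (π p))) := fun f hf =>
      hbas (fun w => δ (f w)) (iterate_mem_basic hf 1)
    have hjet : ∀ i : ℕ, i ≤ k → Gen (M := M) π A (fun q : P => δ^[i] q.1.2) := fun i hi =>
      Gen.of_mem (Or.inr ⟨(⟨i, by omega⟩ : Fin (k + 1)), rfl⟩)
    have hA' : A' ⊆ A := by
      rintro _ ⟨i, rfl⟩
      exact Or.inr (Set.mem_range_self (f := fun (i : Fin (k + 1)) (q :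
          P) => δ^[i] q.1.2) i.castSucc)
    have hder : ∀ j, Gen (M := M) π A (fun q : P => δ (e (q.1.1, fun i :
        Fin k => δ^[i] q.1.2) j)) := by
      intro j
      refine Gen.der (A := A') δ (Gen.comp (A := A') (t := fun (i : Fin k) (q : P) => δ^[i] q.1.2)
        (fun i => Gen.of_mem ⟨i, rfl⟩) (G := fun p => e p j) (by fun_prop)) hA' ?_ hE
      rintro _ ⟨i, rfl⟩
      have := hjet (i + 1) (by omega)
      simpa only [Function.iterate_succ', Function.comp] using this
    have hA : ∀ t ∈ A, Gen (M := M) π A (fun p => δ (t p)) := by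
      rintro _ (⟨t, ht, rfl⟩ | ⟨i, rfl⟩)
      · exact hbas _ (der_mem_basic ht)
      · rcases Nat.lt_or_ge i k with hi | hi
        · have := hjet (i + 1) (by omega)
          simpa only [Function.iterate_succ', Function.comp] using this
        · obtain rfl : i = Fin.last k := Fin.ext (by simp; omega)
          have h2 : ∀ q : P, δ (δ^[k] q.1.2) = G ((q.1.1, fun i : Fin k => δ^[i] q.1.2),
              δ^[k] q.1.2, fun j => δ (e (q.1.1, fun i : Fin k => δ^[i] q.1.2) j)) := fun q =>
            hFV (q.1.1, fun i : Fin k => δ^[i] q.1.2) q.2.1 _ q.2.2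
          simp only [Fin.val_last, h2]
          refine Gen.comp (κ := Fin k ⊕ Unit ⊕ κ) (t := Sum.elim (fun i (q : P) => δ^[i] q.1.2)
            (Sum.elim (fun _ (q : P) => δ^[k] q.1.2)
              (fun j (q : P) => δ (e (q.1.1, fun i : Fin k => δ^[i] q.1.2) j)))) ?_
            (G := fun p => G ((p.1, fun i => p.2 (.inl i)), p.2 (.inr (.inl ())),
              fun j => p.2 (.inr (.inr j)))) (by fun_prop)
          rintro (i | _ | j)
          · exact hjet i (by omega)
          · exact hjet k le_rfl
          · exact hder j
    obtain ⟨κ', _, t, H, ht, hH, hsep⟩ := Gen.exists_separated (δ := δ)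
      (T := fun (i : Fin (m + 1)) (q : P) => δ^[i] q.1.2) fun i =>
        Gen.iterate_der δ (hjet 0 (Nat.zero_le _)) hA hE i
    have h2 : Good δ (fun q : W × (κ' → M.K) => ∃ b,
        {y | B q.1 (Fin.snoc (fun i : Fin k => δ^[i] b) y)}.Finite ∧
          B q.1 (fun i : Fin (k + 1) => δ^[i] b) ∧ X q.1 (H (q.1, q.2, fun i => δ^[i] b))) := by
      refine ih k (by omega) (W := W × (κ' → M.K)) (X := fun q x =>
        {y | B q.1 (Fin.snoc (fun i : Fin k => x i.castSucc) y)}.Finite ∧ B q.1 x ∧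
          X q.1 (H (q.1, q.2, x))) (Def.and ?_ (Def.and ?_ ?_))
      · exact hSf.comp (g := fun p : (W × (κ' → M.K)) × (Fin (k + 1) → M.K) =>
          (p.1.1, fun i : Fin k => p.2 i.castSucc)) (by fun_prop)
      · exact hB.comp (g := fun p : (W × (κ' → M.K)) × (Fin (k + 1) → M.K) => (p.1.1, p.2))
          (by fun_prop)
      · exact hX.comp (g := fun p : (W × (κ' → M.K)) × (Fin (k + 1) → M.K) =>
          (p.1.1, H (p.1.1, p.1.2, p.2))) (by fun_prop)
    refine (h1.or (h2.subst fun j => Gen.of_mem (ht j))).congr fun w => ?_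
    have esnoc : ∀ b : M.K, (Fin.snoc (fun i : Fin k => δ^[i] b) (δ^[k] b) : Fin (k + 1) → M.K)
        = fun i : Fin (k + 1) => δ^[i] b := by
      intro b
      funext i
      refine Fin.lastCases ?_ (fun i => ?_) i <;> simp
    constructor
    · rintro ⟨b, hb⟩
      by_cases hf : {y | B w (Fin.snoc (fun i : Fin k => δ^[i] b) y)}.Finite
      · have hBb := hXB w b hb
        refine Or.inr ⟨b, hf, hBb, ?_⟩
        convert hb using 1
        funext i
        exact (hsep ⟨(w, b), hf, by rw [esnoc]; exact hBb⟩ i).symm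
      · exact Or.inl ⟨b, hb, hf⟩
    · rintro (⟨b, hb, -⟩ | ⟨b, hf, hBb, hb⟩)
      · exact ⟨b, hb⟩
      · refine ⟨b, ?_⟩
        convert hb using 1
        funext i
        exact hsep ⟨(w, b), hf, by rw [esnoc]; exact hBb⟩ i

/-- The definable condition `N w` says that `X` contains locally an open set or a hypersurface
transversal to the last axis; then genericity yields a solution and nothing else has to be tested.
If `N w` fails, `exists_small_proj` makes the projection small, and `good_exists_jet_of_small`
lowers the order. -/
theorem IsGeneric.good_exists_jet (hδ : IsGeneric δ) (m : ℕ) : ∀ {W : Type u} [Ctx M W]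
    {X : W → (Fin (m + 1) → M.K) → Prop}, M.Def (fun p : W × (Fin (m + 1) → M.K) => X p.1 p.2) →
      Good δ (fun w => ∃ b, X w fun i => δ^[i] b) := by
  induction m using Nat.strong_induction_on with
  | _ m ih =>
    intro W _ X hX
    rcases Nat.eq_zero_or_pos m with rfl | hm
    · refine Good.of_def ((Def.ex (E := W) (F := M.K) (R := fun w b => X w fun _ => b)
        (hX.comp (g := fun p : W × M.K => (p.1, fun _ => p.2)) (by fun_prop))).congr fun w =>
            exists_congr fun b => ?_)
      refine iff_of_eq (congrArg _ (funext fun i => ?_))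
      rw [show (i : ℕ) = 0 from by omega]
      rfl
    obtain ⟨D, hD⟩ := exists_small_proj hX
    let N : W → Prop := fun w => (∃ x, ∀ᶠ y in 𝓝 x, X w y) ∨ ∃ (i : Fin (D + 1))
      (p : (Fin (m + 1) → Fin (D + 1)) → M.K) (x : Fin (m + 1) → M.K),
        boxEvalDeriv p i x = 0 ∧ ¬ boxEvalDeriv p (i + 1) x = 0 ∧
        ∀ᶠ y in 𝓝 x, boxEvalDeriv p i y = 0 → X w y
    have hN : M.Def N := by
      refine Def.or (Def.ex (Def.eventually_pi (E := W × (Fin (m + 1) → M.K))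
        (R := fun p y => X p.1 y) (g := fun p => p.2) ?_ (by fun_prop)))
        (Def.exists_finite fun i => Def.ex (Def.ex (Def.and ?_ (Def.and ?_ ?_))))
      · exact hX.comp (g := fun p : (W × (Fin (m + 1) → M.K)) × (Fin (m + 1) → M.K) => (p.1.1, p.2))
          (by fun_prop)
      · exact Def.eq_zero (DefMap.boxEvalDeriv (by fun_prop) (by fun_prop) i)
      · exact (Def.eq_zero (DefMap.boxEvalDeriv (by fun_prop) (by fun_prop) (i + 1))).not
      · refine Def.eventually_pi
          (E := (W × ((Fin (m + 1) → Fin (D + 1)) → M.K)) × (Fin (m + 1) → M.K))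
          (R := fun p y => boxEvalDeriv p.1.2 i y = 0 → X p.1.1 y) (g := fun p => p.2)
          (Def.imp (Def.eq_zero (DefMap.boxEvalDeriv (by fun_prop) (by fun_prop) i)) ?_)
          (by fun_prop)
        exact hX.comp (g := fun p : ((W × ((Fin (m + 1) → Fin (D + 1)) → M.K)) ×
          (Fin (m + 1) → M.K)) × (Fin (m + 1) → M.K) => (p.1.1.1, p.2)) (by fun_prop)
    have hNb : ∀ w, N w → ∃ b, X w fun i => δ^[i] b := by
      rintro w (⟨x, hx⟩ | ⟨i, p, x, h0, h1, hx⟩)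
      -- For an interior point any polynomial with nonvanishing separant through it will do; this
      -- one has separant `1`.
      · obtain ⟨b, -, hb⟩ := hδ m hm (MvPolynomial.X (Fin.last m) - MvPolynomial.C (x (Fin.last m)))
          x (by simp) (by simp) _ hx
        exact ⟨b, hb⟩
      · obtain ⟨b, hb, hb'⟩ := hδ m hm (boxPoly p i) x (by rw [eval_boxPoly, h0])
          (by rw [pderiv_boxPoly, eval_boxPoly]; exact h1) _ hx
        exact ⟨b, hb' (by rw [← eval_boxPoly, hb])⟩
    have hX' : M.Def (fun p : W × (Fin (m + 1) → M.K) => X p.1 p.2 ∧ ¬ N p.1) :=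
      hX.and hN.not.comp_fst
    have h1 : Good δ (fun w => ∃ b, X w (fun i => δ^[i] b) ∧ ¬ N w) := by
      refine good_exists_jet_of_small (m := m) ih le_rfl (X := fun w x => X w x ∧ ¬ N w) hX'
        (B := fun w x => ∃ y, X w (Fin.snoc x y) ∧ ¬ N w) (Def.ex ?_) (fun w => ?_) ?_
      · exact hX'.comp (g := fun p : (W × (Fin m → M.K)) × M.K =>
          (p.1.1, (Fin.snoc p.1.2 p.2 : Fin (m + 1) → M.K))) (by fun_prop)
      · by_cases h : N w
        · simpa [h] using small_empty
        · refine (hD w ?_ ?_).mono fun x ⟨y, hy⟩ => ⟨y, hy.1⟩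
          · intro x hx
            exact h (Or.inl ⟨x, hx⟩)
          · intro i p x h0 h1 hx
            exact h (Or.inr ⟨i, p, x, h0, h1, hx⟩)
      · rintro w b ⟨hb, hw⟩
        refine ⟨δ^[m] b, ?_, hw⟩
        convert hb using 1
        funext i
        refine Fin.lastCases ?_ (fun i => ?_) i <;> simp
    refine ((Good.of_def hN).or h1).congr fun w => ⟨?_, ?_⟩
    · rintro ⟨b, hb⟩
      by_cases h : N w
      · exact Or.inl h
      · exact Or.inr ⟨b, hb, h⟩
    · rintro (h | ⟨b, hb, -⟩)
      · exact hNb w h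
      · exact ⟨b, hb⟩

/-- Existential quantification over finitely many elements of the field, in terms of their
derivatives. -/
theorem IsGeneric.good_exists_jets (hδ : IsGeneric δ) (l m : ℕ) : ∀ {W : Type u} [Ctx M W]
    {X : W → (Fin l → Fin m → M.K) → Prop}, M.Def (fun p : W × (Fin l → Fin m → M.K) => X p.1 p.2) →
      Good δ (fun w => ∃ u : Fin l → M.K, X w fun k i => δ^[i] (u k)) := by
  induction l generalizing m with
  | zero =>
    intro W _ X hX
    refine Good.of_def ((hX.comp (g := fun w => (w, fun k : Fin 0 => k.elim0))
      (DefMap.prodMk (by fun_prop) (DefMap.pi fun k => k.elim0))).congr fun w => ?_)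
    constructor
    · rintro ⟨u, hu⟩
      rwa [Subsingleton.elim (fun (k : Fin 0) (i : Fin m) => δ^[i] (u k)) fun k => k.elim0] at hu
    · intro h
      refine ⟨fun k => k.elim0, ?_⟩
      rwa [Subsingleton.elim (fun (k : Fin 0) (i : Fin m) => _) fun k : Fin 0 => k.elim0]
  | succ l ih =>
    intro W _ X hX
    have h1 : Good δ (fun p : W × (Fin l × Fin m → M.K) =>
        ∃ b, X p.1 (Fin.snoc (fun k i => p.2 (k, i)) fun i : Fin m => δ^[i] b)) := by
      refine hδ.good_exists_jet m (W := W × (Fin l × Fin m → M.K))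
        (X := fun p x => X p.1 (Fin.snoc (fun k i => p.2 (k, i)) fun i : Fin m => x i.castSucc)) ?_
      exact hX.comp (g := fun p : (W × (Fin l × Fin m → M.K)) × (Fin (m + 1) → M.K) =>
        (p.1.1, (Fin.snoc (fun k i => p.1.2 (k, i)) fun i : Fin m => p.2 i.castSucc :
          Fin (l + 1) → Fin m → M.K))) (by fun_prop)
    -- Eliminating the last element leaves derivatives of definable functions of the jets of the
    -- others. Expanding them may raise the order from `m` to `m'`, which is why the induction
    -- quantifies over the order.
    obtain ⟨κ', _, t, m', ψ, ht, hψ, h⟩ := h1.exists_separated Prod.fst fun k => (k.2 : ℕ)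
    have h2 := ih m' (W := W × (κ' → M.K)) (X := fun p y => ψ (p.1, p.2, y))
      (hψ.comp (g := fun p : (W × (κ' → M.K)) × (Fin l → Fin m' → M.K) => (p.1.1, p.1.2, p.2))
        (by fun_prop))
    refine (h2.subst fun k => Gen.of_mem (ht k)).congr fun w => ?_
    simp only [← h]
    have e : ∀ (u : Fin l → M.K) b, (Fin.snoc (fun (k : Fin l) (i : Fin m) => δ^[i] (u k))
        fun i : Fin m => δ^[i] b : Fin (l + 1) → Fin m → M.K)
        = fun (k : Fin (l + 1)) (i : Fin m) => δ^[i] ((Fin.snoc u b : Fin (l + 1) → M.K) k) := by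
      intro u b
      funext k
      refine Fin.lastCases ?_ (fun k => ?_) k <;> simp
    simp only [e]
    constructor
    · rintro ⟨u, hu⟩
      exact ⟨Fin.init u, u (Fin.last l), by rwa [Fin.snoc_init_self]⟩
    · rintro ⟨u, b, h⟩
      exact ⟨_, h⟩

/-- The quantified `a` may have coordinates in auxiliary sorts. The values $c_k(w,a)$ are named by
new field elements: the existence of `a` with these values is definable without $\delta$, and only a
quantifier over field elements through their jets remains. -/
theorem Good.ex (hδ : IsGeneric δ) {R : W → F → Prop} (h : Good δ (fun p : W × F => R p.1 p.2)) :
    Good δ (fun w => ∃ a, R w a) := by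
  obtain ⟨κ, _, t, ψ, ht, hψ, h⟩ := h
  choose n c hc hT using ht
  obtain ⟨l, ⟨o⟩⟩ := Finite.exists_equiv_fin κ
  obtain ⟨m, hm0, hm⟩ : ∃ m, 0 < m ∧ ∀ k, n k < m := by
    obtain ⟨b, hb⟩ := (Set.finite_range n).bddAbove
    exact ⟨b + 1, Nat.succ_pos b, fun q => Nat.lt_succ_of_le (hb ⟨q, rfl⟩)⟩
  refine (hδ.good_exists_jets l m (X := fun w y => ∃ a, (∀ k, c k (w, a) = y (o k) ⟨0, hm0⟩) ∧
    ψ ((w, a), fun k => y (o k) ⟨n k, hm k⟩)) (Def.ex (Def.and (Def.forall_finite fun k =>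
      Def.eq_fun ?_ (by fun_prop)) ?_))).congr fun w => ?_
  · exact (hc k).comp (g := fun p : (W × (Fin l → Fin m → M.K)) × F => (p.1.1, p.2)) (by fun_prop)
  · exact hψ.comp (g := fun p : (W × (Fin l → Fin m → M.K)) × F =>
      ((p.1.1, p.2), fun k => p.1.2 (o k) ⟨n k, hm k⟩)) (by fun_prop)
  · constructor
    · rintro ⟨a, ha⟩
      refine ⟨fun k => c (o.symm k) (w, a), a, fun k => by simp, ?_⟩
      have := (h (w, a)).1 ha
      simpa [hT] using this
    · rintro ⟨u, a, ha, h'⟩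
      refine ⟨a, (h (w, a)).2 ?_⟩
      simp only [hT, ha]
      exact h'

/-! ### Formulas of the language with a derivation -/

theorem Good.exists_val (hδ : IsGeneric δ) {n k : ℕ} {Γ : Fin n → L.diff.Srt}
    {Δ : Fin k → L.diff.Srt} {R : ∀ i, (M.withDer δ).Val Γ → (M.withDer δ).carrier (Δ i) → Prop}
    (hR : ∀ i, Good δ fun p : (M.withDer δ).Val Γ × (M.withDer δ).carrier (Δ i) => R i p.1 p.2)
    {Q : E → (M.withDer δ).Val Δ → Prop} (hQ : M.Def fun p : E × (M.withDer δ).Val Δ => Q p.1 p.2)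
    {g : E → (M.withDer δ).Val Γ} (hg : M.DefMap g) :
    Good δ (fun e => ∃ v, (∀ i, R i (g e) (v i)) ∧ Q e v) := by
  have hall : ∀ (s : Finset (Fin k)), Good δ (fun p : E × (M.withDer δ).Val Δ =>
      ∀ i ∈ s, R i (g p.1) (p.2 i)) := by
    intro s
    induction s using Finset.induction_on with
    | empty => exact (Good.of_def (Def.const True)).congr fun p => by simp
    | insert a s ha ih =>
      refine (Good.and ((hR a).comp (g := fun p : E × (M.withDer δ).Val Δ => (g p.1, p.2 a)) ?_)
        ih).congr fun p => by simp
      exact (hg.comp DefMap.fst').prodMk ((DefMap.derVal_apply a).comp DefMap.snd')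
  refine Good.ex hδ (R := fun e v => (∀ i, R i (g e) (v i)) ∧ Q e v)
    (((hall Finset.univ).congr fun p => by simp).and (Good.of_def hQ))

/-- Terms are flattened: the value of a subterm is an existentially quantified variable. Working
with graphs treats field and auxiliary sorts alike. -/
theorem good_term_val (hδ : IsGeneric δ) {n : ℕ} {Γ : Fin n → L.diff.Srt} {s : L.diff.Srt}
    (t : L.diff.Term Γ s) :
    Good δ (fun p : (M.withDer δ).Val Γ × (M.withDer δ).carrier s =>
      t.val (M.withDer δ) p.1 = p.2) := by
  induction t with
  | var i => exact Good.of_def (Def.eq_fun ((DefMap.derVal_apply i).comp DefMap.fst') DefMap.snd')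
  | app f ts ih =>
    rcases f with _ | f
    · have h1 : Good δ (fun q : ((M.withDer δ).Val Γ × M.K) × M.K =>
          (ts (0 : Fin 1)).val (M.withDer δ) q.1.1 = q.2 ∧ δ q.2 = q.1.2) := by
        refine Good.and ((ih (0 : Fin 1)).comp (E := ((M.withDer δ).Val Γ × M.K) × M.K)
          (g := fun q => (q.1.1, q.2)) (by fun_prop)) ?_
        exact Good.of_gen (κ := Unit) (t := fun _ (q : ((M.withDer δ).Val Γ × M.K) × M.K) => δ q.2)
          (ψ := fun r => r.2 () = r.1.1.2)
          (fun _ => Gen.of_mem (iterate_mem_basic DefMap.snd' 1))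
          (Def.eq_fun (by fun_prop) (by fun_prop))
      refine (Good.ex (W := (M.withDer δ).Val Γ × M.K) (F := M.K) hδ
        (R := fun p y => (ts (0 : Fin 1)).val (M.withDer δ) p.1 = y ∧ δ y = p.2) h1).congr
        fun p => ?_
      constructor
      · intro h
        exact ⟨_, rfl, h⟩
      · rintro ⟨y, h, h'⟩
        exact (congrArg δ h).trans h'
    · refine (Good.exists_val hδ (Δ := L.diff.dom (some f))
        (R := fun i v y => (ts i).val (M.withDer δ) v = y) ih
        (Q := fun p v => (M.withDer δ).fn (some f) v = p.2)
        (E := (M.withDer δ).Val Γ × (M.withDer δ).carrier (L.diff.cod (some f))) ?_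
        DefMap.fst').congr fun p => ?_
      · exact Def.eq_fun ((DefMap.fn (M := M) f).comp DefMap.snd') (DefMap.snd'.comp DefMap.fst')
      · constructor
        · intro h
          exact ⟨_, fun i => rfl, h⟩
        · rintro ⟨v, h, h'⟩
          exact (congrArg ((M.withDer δ).fn (some f)) (funext h)).trans h'

theorem good_formula (hδ : IsGeneric δ) {n : ℕ} {Γ : Fin n → L.diff.Srt}
    (φ : L.diff.Formula Γ) :
    Good δ (fun v : (M.withDer δ).Val Γ => φ.Holds (M.withDer δ) v) := by
  induction φ with
  | falsum => exact Good.of_def (Def.const False)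
  | @eq n Γ s t t' =>
    refine (Good.ex (F := (M.withDer δ).carrier s) hδ (R := fun v y => t.val (M.withDer δ) v = y ∧
      t'.val (M.withDer δ) v = y) ((good_term_val hδ t).and (good_term_val hδ t'))).congr fun v =>
          ?_
    constructor
    · intro h
      exact ⟨_, h, rfl⟩
    · rintro ⟨y, h, h'⟩
      exact h.trans h'.symm
  | rel r ts =>
    refine (Good.exists_val hδ (R := fun i v y => (ts i).val (M.withDer δ) v = y)
      (fun i => good_term_val hδ (ts i))
      (Q := fun _ v => (M.withDer δ).rel r v) ((DefMap.rel (M := M) r).comp DefMap.snd')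
      DefMap.id).congr fun v => ?_
    constructor
    · intro h
      exact ⟨_, fun i => rfl, h⟩
    · rintro ⟨v', h, h'⟩
      rw [Lang.Formula.Holds]
      convert h' using 1
      exact funext h
  | imp φ ψ ih ih' => exact ih.imp ih'
  | @all n Γ s φ ih =>
    refine (Good.not (Good.ex (W := (M.withDer δ).Val Γ) (F := (M.withDer δ).carrier s) hδ
      (R := fun v a => ¬ φ.Holds (M.withDer δ) (Lang.Struc.Val.cons a v)) (Good.not
        (ih.comp (g := fun p : (M.withDer δ).Val Γ × (M.withDer δ).carrier s =>
          Lang.Struc.Val.cons p.2 p.1) ?_)))).congr fun v => ?_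
    · exact DefMap.val_cons (E := (M.withDer δ).Val Γ × (M.withDer δ).carrier s) (M := M)
        (s := (s : L.base.Srt)) (Γ := (Γ : Fin _ → L.base.Srt)) (f := fun p => p.2)
        (g := fun p => p.1)
        (DefMap.snd' (E := (M.withDer δ).Val Γ) (F := (M.withDer δ).carrier s))
        (DefMap.fst' (E := (M.withDer δ).Val Γ) (F := (M.withDer δ).carrier s))
    · push Not
      rfl

end FieldStruc

end MS

namespace MS

/-! ### Parametrising algebraic relations near a smooth point -/

section Algebra

open Polynomial in
/-- Simple roots of polynomials lift uniquely. -/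
theorem eq_of_eval_eq_zero_of_isUnit {B K : Type*} [CommRing B] [Field K] (st : B →+* K)
    (hst : ∀ a, st a ≠ 0 → IsUnit a) {p : B[X]} {a b : B} (ha : p.eval a = 0) (hb : p.eval b = 0)
    (hab : st a = st b) (hp : st (p.derivative.eval a) ≠ 0) : a = b := by
  obtain ⟨k, hk⟩ := p.binomExpansion a (b - a)
  rw [add_sub_cancel, ha, hb, zero_add] at hk
  have hu : IsUnit (p.derivative.eval a + k * (b - a)) := hst _ (by simpa [hab] using hp)
  have h0 : (p.derivative.eval a + k * (b - a)) * (b - a) = 0 := by rw [hk]; ring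
  exact (sub_eq_zero.1 (hu.mul_right_eq_zero.1 h0)).symm

variable {K : Type u} [Field K] [CharZero K] {ι : Type*} [Finite ι]

-- A primitive element `ρ` of the extension of `F` generated by `τ` is a simple root of its minimal
-- polynomial, of which `q` is a multiple without denominators. Writing `τ` as polynomials in `ρ`
-- over `F`, one takes for `τ'` the same polynomials in `y`. Relations survive because the minimal
-- polynomial divides them, and nonzero denominators become units in `A`. A homomorphism on `K` is
-- determined at `τ` by its values on `R` and at `ρ`.
open Polynomial in
theorem exists_simple_root_presentation {R F : Type u} [CommRing R] [IsDomain R] [Field F]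
    [Algebra R F] [IsFractionRing R F] [Algebra R K] [Algebra F K] [IsScalarTower R F K]
    (τ : ι → K) (hτ : ∀ i, IsAlgebraic F (τ i)) :
    ∃ (ρ : K) (q : R[X]), ρ ≠ 0 ∧ aeval ρ q = 0 ∧ aeval ρ (derivative q) ≠ 0 ∧
      ∀ (A : Type u) [CommRing A] (st : A →+* K) (_ : ∀ a, st a ≠ 0 → IsUnit a) (φ : R →+* A)
        (_ : st.comp φ = algebraMap R K) (y : A), q.eval₂ φ y = 0 →
        ∃ τ' : ι → A, (∀ P : MvPolynomial ι R, MvPolynomial.aeval τ P = 0 → P.eval₂ φ τ' = 0) ∧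
          ∀ (B : Type u) [CommRing B] (g : A →+* B) (θ : K →+* B),
            θ.comp (algebraMap R K) = g.comp φ → θ ρ = g y → ∀ i, θ (τ i) = g (τ' i) := by
  have : CharZero F := (algebraMap F K).charZero_iff (algebraMap F K).injective |>.2 inferInstance
  have hint : ∀ x ∈ Set.range τ, IsIntegral F x := by
    rintro _ ⟨i, rfl⟩
    exact (hτ i).isIntegral
  obtain ⟨ρ, hρ0, hρ, p, hp⟩ : ∃ ρ : K, ρ ≠ 0 ∧ IsIntegral F ρ ∧ ∃ p : ι → F[X], ∀ i,
      aeval ρ (p i) = τ i := by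
    have : FiniteDimensional F (IntermediateField.adjoin F (Set.range τ)) :=
      IntermediateField.finiteDimensional_adjoin hint
    obtain ⟨α, hα⟩ := Field.exists_primitive_element F (IntermediateField.adjoin F (Set.range τ))
    have h : ∀ i, ∃ p : F[X], aeval (α : K) p = τ i := by
      intro i
      have h1 : (⟨τ i, IntermediateField.subset_adjoin _ _ ⟨i, rfl⟩⟩ :
          IntermediateField.adjoin F (Set.range τ)) ∈ IntermediateField.adjoin F {α} := by
        rw [hα]; trivial
      have h2 := (IntermediateField.adjoin_simple_toSubalgebra_of_isAlgebraic
        (Algebra.IsAlgebraic.isAlgebraic (R := F) α)).le h1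
      rw [Algebra.adjoin_singleton_eq_range_aeval] at h2
      obtain ⟨p, hp⟩ := h2
      refine ⟨p, ?_⟩
      have := congrArg (algebraMap (IntermediateField.adjoin F (Set.range τ)) K) hp
      exact (aeval_algebraMap_apply _ _ _).trans this
    choose p hp using h
    -- If the primitive element is `0`, all `τ i` come from `F` and `1` serves as well. That `ρ` is
    -- nonzero later prevents the parameter of the Taylor expansion from vanishing.
    by_cases h0 : (α : K) = 0
    · refine ⟨1, one_ne_zero, isIntegral_one, fun i => C ((p i).eval 0), fun i => ?_⟩
      rw [← hp i, h0]
      simp [aeval_def, eval₂_at_zero, coeff_zero_eq_eval_zero]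
    · exact ⟨α, h0, (Algebra.IsIntegral.isIntegral (R := F) α).map
        (IntermediateField.val _), p, hp⟩
  obtain ⟨b, hb, hq⟩ := IsLocalization.integerNormalization_spec (nonZeroDivisors R) (minpoly F ρ)
  set q := IsLocalization.integerNormalization (nonZeroDivisors R) (minpoly F ρ)
  have hb0 : algebraMap R F b ≠ 0 := by
    simp [nonZeroDivisors.ne_zero hb]
  have hq' : q.map (algebraMap R F) = C (algebraMap R F b) * minpoly F ρ := by
    rw [hq, Algebra.smul_def]; rfl
  refine ⟨ρ, q, hρ0, ?_, ?_, ?_⟩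
  · rw [← aeval_map_algebraMap F, hq']
    simp
  · rw [← aeval_map_algebraMap F, ← derivative_map, hq', derivative_C_mul, map_mul, aeval_C]
    refine mul_ne_zero (by simpa using hb0) ?_
    exact (minpoly.irreducible hρ).separable.aeval_derivative_ne_zero (minpoly.aeval F ρ)
  · intro A _ st hst φ hφ y hy
    have hu : ∀ r : nonZeroDivisors R, IsUnit (φ r) := by
      refine fun r => hst _ ?_
      have : st (φ r) = algebraMap R K r := RingHom.congr_fun hφ r
      rw [this, IsScalarTower.algebraMap_apply R F K]
      simp [nonZeroDivisors.ne_zero r.2]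
    let ψ : F →+* A := IsLocalization.lift (M := nonZeroDivisors R) hu
    have hψ : ψ.comp (algebraMap R F) = φ := IsLocalization.lift_comp hu
    have hmin : (minpoly F ρ).eval₂ ψ y = 0 := by
      have h1 : (q.map (algebraMap R F)).eval₂ ψ y = 0 := by rw [eval₂_map, hψ, hy]
      rw [hq', eval₂_mul, eval₂_C] at h1
      exact ((IsUnit.mk0 _ hb0).map ψ).mul_right_eq_zero.1 h1
    refine ⟨fun i => (p i).eval₂ ψ y, fun P hP => ?_, fun B _ g θ h1 h2 i => ?_⟩
    · have h1 : minpoly F ρ ∣ P.eval₂ (C.comp (algebraMap R F)) p := by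
        refine minpoly.dvd F ρ ?_
        rw [← hP, MvPolynomial.aeval_def]
        have := MvPolynomial.eval₂_comp_left (aeval ρ : F[X] →ₐ[F] K).toRingHom
          (C.comp (algebraMap R F)) p P
        refine this.trans ?_
        congr 1
        · ext r; simp [← IsScalarTower.algebraMap_apply]
        · ext i; simpa using hp i
      obtain ⟨c, hc⟩ := h1
      have h2 := MvPolynomial.eval₂_comp_left (eval₂RingHom ψ y) (C.comp (algebraMap R F)) p P
      rw [hc] at h2
      have h3 : (eval₂RingHom ψ y).comp (C.comp (algebraMap R F)) = φ := by
        rw [← hψ]; ext r; simp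
      rw [h3] at h2
      refine Eq.trans ?_ (h2.symm.trans ?_)
      · rfl
      · simp [hmin]
    · have h3 : θ.comp (algebraMap F K) = g.comp ψ := by
        refine IsLocalization.ringHom_ext (nonZeroDivisors R) ?_
        rw [RingHom.comp_assoc, ← IsScalarTower.algebraMap_eq, h1, RingHom.comp_assoc, hψ]
      rw [← hp i, aeval_def, hom_eval₂, hom_eval₂, h3, h2]

/-- The set `s` is a transcendence basis of `τ` over `C`, so the coefficient ring is a polynomial
ring and a homomorphism from it may be prescribed freely on `s`. This freedom permits moving the
basis along its Taylor polynomials. -/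
theorem exists_simple_root_presentation_of_subfield (C : Subfield K) (τ : ι → K) :
    ∃ (s : Set K) (ρ : K) (q : Polynomial (MvPolynomial s C)), ρ ≠ 0 ∧
      q.eval₂ (MvPolynomial.aeval (Subtype.val : s → K) : MvPolynomial s C →ₐ[C] K).toRingHom ρ =
          0 ∧
      q.derivative.eval₂
        (MvPolynomial.aeval (Subtype.val : s → K) : MvPolynomial s C →ₐ[C] K).toRingHom ρ ≠ 0 ∧
      ∀ (A : Type u) [CommRing A] (st : A →+* K) (_ : ∀ a, st a ≠ 0 → IsUnit a)
        (φ : MvPolynomial s C →+* A)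
        (_ : st.comp φ =
          (MvPolynomial.aeval (Subtype.val : s → K) : MvPolynomial s C →ₐ[C] K).toRingHom)
        (y : A), q.eval₂ φ y = 0 →
        ∃ τ' : ι → A, (∀ P : MvPolynomial ι C, MvPolynomial.aeval τ P = 0 →
            P.eval₂ (φ.comp MvPolynomial.C) τ' = 0) ∧
          ∀ (B : Type u) [CommRing B] (g : A →+* B) (θ : K →+* B),
            θ.comp (MvPolynomial.aeval (Subtype.val : s → K) : MvPolynomial s C →ₐ[C] K).toRingHom =
              g.comp φ → θ ρ = g y → ∀ i, θ (τ i) = g (τ' i) := by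
  obtain ⟨s, hs⟩ := (AlgebraicIndependent.matroid C K).exists_isBasis (Set.range τ)
  rw [AlgebraicIndependent.matroid_isBasis_iff] at hs
  obtain ⟨hs, -, hτ⟩ := hs
  replace hs : AlgebraicIndependent C (Subtype.val : s → K) := hs
  have hinj : Function.Injective
      (MvPolynomial.aeval (Subtype.val : s → K) : MvPolynomial s C →ₐ[C] K) := hs
  let : Algebra (MvPolynomial s C) K :=
    (MvPolynomial.aeval (Subtype.val : s → K) : MvPolynomial s C →ₐ[C] K).toRingHom.toAlgebra
  have : FaithfulSMul (MvPolynomial s C) K := (faithfulSMul_iff_algebraMap_injective _ _).2 hinj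
  let : Algebra (FractionRing (MvPolynomial s C)) K := FractionRing.liftAlgebra _ _
  have : IsScalarTower (MvPolynomial s C) (FractionRing (MvPolynomial s C)) K :=
    FractionRing.isScalarTower_liftAlgebra _ _
  have halg : ∀ i, IsAlgebraic (FractionRing (MvPolynomial s C)) (τ i) := by
    intro i
    have h : IsAlgebraic (Algebra.adjoin C (Set.range (Subtype.val : s → K))) (τ i) := by
      rw [Subtype.range_val]
      exact hτ (τ i) ⟨i, rfl⟩
    have h' : IsAlgebraic (MvPolynomial s C) (τ i) :=
      IsAlgebraic.of_ringHom_of_comp_eq (g := RingHom.id K) hs.aevalEquiv.toRingHom h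
        hs.aevalEquiv.surjective Function.injective_id
        (RingHom.ext fun P => hs.algebraMap_aevalEquiv P)
    exact h'.extendScalars (IsFractionRing.injective _ _)
  obtain ⟨ρ, q, hρ, h1, h2, h3⟩ := exists_simple_root_presentation
    (R := MvPolynomial s C) (F := FractionRing (MvPolynomial s C)) τ halg
  refine ⟨s, ρ, q, hρ, h1, h2, fun A _ st hst φ hφ y hy => ?_⟩
  obtain ⟨τ', h4, h5⟩ := h3 A st hst φ hφ y hy
  refine ⟨τ', fun P hP => ?_, h5⟩
  have := h4 (MvPolynomial.map MvPolynomial.C P) ?_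
  · rwa [MvPolynomial.eval₂_map] at this
  · rw [← hP, MvPolynomial.aeval_def, MvPolynomial.eval₂_map, MvPolynomial.aeval_def]
    congr 1
    exact RingHom.ext fun c => (MvPolynomial.aeval_C _ c)

end Algebra

end MS

namespace MS

/-! ### Taylor expansion along a derivation -/

section Taylor

variable {K : Type u} [Field K] (δ : Derivation ℤ K K)

/-- The formal derivative of the Taylor series of `z` is the Taylor series of `δ z`. Comparing
derivatives, the coefficient in degree `n + 1` follows from the Leibniz rule and the case `n` for
the products of `x` with `δ y` and of `y` with `δ x`. -/
theorem taylorSeries_mul [CharZero K] (n : ℕ) (x y : K) :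
    PowerSeries.coeff n (PowerSeries.mk fun j => δ^[j] (x * y) / j.factorial) =
      PowerSeries.coeff n ((PowerSeries.mk fun j => δ^[j] x / j.factorial) *
        PowerSeries.mk fun j => δ^[j] y / j.factorial) := by
  induction n generalizing x y with
  | zero => simp [PowerSeries.coeff_zero_eq_constantCoeff]
  | succ n ih =>
    have hd : ∀ z : K, PowerSeries.derivative K (PowerSeries.mk fun j => δ^[j] z / j.factorial) =
        PowerSeries.mk fun j => δ^[j] (δ z) / j.factorial := by
      intro z
      ext j
      rw [PowerSeries.coeff_derivative, PowerSeries.coeff_mk, PowerSeries.coeff_mk,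
        Function.iterate_succ_apply, Nat.factorial_succ]
      have : ((j.factorial : ℕ) : K) ≠ 0 := by exact_mod_cast j.factorial_ne_zero
      push_cast
      field_simp
    have hn : ((n : K) + 1) ≠ 0 := by exact_mod_cast n.succ_ne_zero
    refine mul_right_cancel₀ hn ?_
    rw [← PowerSeries.coeff_derivative, ← PowerSeries.coeff_derivative, hd,
        (PowerSeries.derivative K).leibniz, hd, hd]
    have hadd : (PowerSeries.mk fun j => δ^[j] (δ (x * y)) / (j.factorial : K)) =
        (PowerSeries.mk fun j => δ^[j] (x * δ y) / (j.factorial : K)) +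
          PowerSeries.mk fun j => δ^[j] (y * δ x) / (j.factorial : K) := by
      ext j
      simp only [PowerSeries.coeff_mk, map_add]
      rw [Derivation.leibniz, iterate_map_add, smul_eq_mul, smul_eq_mul, add_div]
    rw [hadd, map_add, ih, ih, map_add, smul_eq_mul, smul_eq_mul]

variable {A : Type*} [CommRing A] [Algebra K A]

/-- The Taylor polynomial of degree `m`. -/
noncomputable def taylorSum (m : ℕ) (e : A) (x : K) : A :=
  ∑ j ∈ Finset.range (m + 1), algebraMap K A (δ^[j] x / j.factorial) * e ^ j

theorem aeval_trunc_taylorSeries (m : ℕ) (e : A) (x : K) :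
    Polynomial.aeval e (PowerSeries.trunc (m + 1) (PowerSeries.mk fun j => δ^[j] x / j.factorial)) =
      taylorSum δ m e x := by
  rw [Polynomial.aeval_def, PowerSeries.eval₂_trunc_eq_sum_range]
  simp [taylorSum]

/-- The Taylor polynomial is a ring homomorphism modulo the next power. -/
noncomputable def taylorHom [CharZero K] (m : ℕ) (e : A) : K →+* A ⧸ Ideal.span {e ^ (m + 1)} where
  toFun x := Ideal.Quotient.mk _ (taylorSum δ m e x)
  map_one' := by
    rw [taylorSum, Finset.sum_range_succ', Finset.sum_eq_zero]
    · simp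
    · intro j _
      simp [Function.iterate_succ_apply, iterate_map_zero]
  map_zero' := by simp [taylorSum, iterate_map_zero]
  map_add' x y := by
    simp [taylorSum, iterate_map_add, add_div, add_mul, Finset.sum_add_distrib]
  map_mul' x y := by
    rw [← map_mul, Ideal.Quotient.eq, Ideal.mem_span_singleton]
    simp only [← aeval_trunc_taylorSeries]
    rw [← map_mul, ← map_sub]
    have h : (Polynomial.X : Polynomial K) ^ (m + 1) ∣
        PowerSeries.trunc (m + 1) (PowerSeries.mk fun j => δ^[j] (x * y) / (j.factorial : K)) -
          PowerSeries.trunc (m + 1) (PowerSeries.mk fun j => δ^[j] x / (j.factorial : K)) *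
            PowerSeries.trunc (m + 1) (PowerSeries.mk fun j => δ^[j] y / (j.factorial : K)) := by
      refine Polynomial.X_pow_dvd_iff.2 fun d hd => ?_
      rw [Polynomial.coeff_sub, ← Polynomial.coeff_coe (_ * _), Polynomial.coe_mul,
        ← PowerSeries.coeff_mul_eq_coeff_trunc_mul_trunc _ _ hd,
        PowerSeries.coeff_trunc, if_pos hd, taylorSeries_mul, sub_self]
    simpa using map_dvd (Polynomial.aeval e) h

end Taylor

/-! ### Germs with a limit -/

open Topology Filter

section Germs

variable {α K : Type u} [Field K] [TopologicalSpace K] [IsTopologicalDivisionRing K]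

/-- The ring of germs of functions along a filter, together with a limit. -/
def convGerms (K : Type u) [Field K] [TopologicalSpace K] [IsTopologicalDivisionRing K]
    (l : Filter α) : Subring (Germ l K × K) where
  carrier := {p | p.1.Tendsto (𝓝 p.2)}
  zero_mem' := tendsto_const_nhds (f := l) (x := (0 : K))
  one_mem' := tendsto_const_nhds (f := l) (x := (1 : K))
  add_mem' := by
    rintro ⟨f, a⟩ ⟨g, b⟩
    induction f using Germ.inductionOn
    induction g using Germ.inductionOn
    exact fun hf hg => Tendsto.add hf hg
  mul_mem' := by
    rintro ⟨f, a⟩ ⟨g, b⟩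
    induction f using Germ.inductionOn
    induction g using Germ.inductionOn
    exact fun hf hg => Tendsto.mul hf hg
  neg_mem' := by
    rintro ⟨f, a⟩
    induction f using Germ.inductionOn
    exact fun hf => Tendsto.neg hf

namespace convGerms

variable {l : Filter α}

/-- The germ of a convergent function. -/
def of (f : α → K) (a : K) (h : Tendsto f l (𝓝 a)) : convGerms K l := ⟨(f, a), h⟩

theorem exists_eq_of (x : convGerms K l) : ∃ f a h, x = of f a h := by
  obtain ⟨⟨f, a⟩, h⟩ := x
  induction f using Germ.inductionOn with
  | _ f => exact ⟨f, a, h, rfl⟩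

variable (l) in
/-- The limit. -/
def lim : convGerms K l →+* K := (RingHom.snd _ _).comp (convGerms K l).subtype

variable (l) in
/-- The underlying germ. -/
def germ : convGerms K l →+* Germ l K := (RingHom.fst _ _).comp (convGerms K l).subtype

theorem ext_iff_germ_lim {x y : convGerms K l} : x = y ↔ germ l x = germ l y ∧ lim l x = lim l y :=
  Subtype.ext_iff.trans Prod.ext_iff

@[simp] theorem lim_of (f : α → K) (a : K) (h : Tendsto f l (𝓝 a)) : lim l (of f a h) = a := rfl

@[simp] theorem germ_of (f : α → K) (a : K) (h : Tendsto f l (𝓝 a)) :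
    germ l (of f a h) = (f : Germ l K) := rfl

/-- A function with nonzero limit is eventually nonzero. Thus the limit map has the property that
the algebraic lifting lemmas demand of `st`. -/
theorem isUnit_of_lim_ne_zero [T1Space K] (x : convGerms K l) (hx : lim l x ≠ 0) : IsUnit x := by
  obtain ⟨f, a, h, rfl⟩ := exists_eq_of x
  refine IsUnit.of_mul_eq_one (of (fun z => (f z)⁻¹) a⁻¹ (h.inv₀ hx)) ?_
  rw [ext_iff_germ_lim, map_mul, map_mul, map_one, map_one]
  refine ⟨Germ.coe_eq.2 ?_, mul_inv_cancel₀ hx⟩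
  filter_upwards [h.eventually_ne hx] with z hz using mul_inv_cancel₀ hz

noncomputable instance : Algebra K (convGerms K l) :=
  RingHom.toAlgebra
    { toFun := fun a => of (fun _ => a) a tendsto_const_nhds
      map_one' := rfl
      map_zero' := rfl
      map_add' := fun _ _ => rfl
      map_mul' := fun _ _ => rfl }

@[simp] theorem lim_algebraMap (a : K) : lim l (algebraMap K (convGerms K l) a) = a := rfl

@[simp] theorem germ_algebraMap (a : K) :
    germ l (algebraMap K (convGerms K l) a) = ((fun _ => a : α → K) : Germ l K) := rfl

theorem germ_taylorSum (δ : Derivation ℤ K K) (m : ℕ) (f : α → K) (a : K) (h : Tendsto f l (𝓝 a))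
    (x : K) : germ l (taylorSum δ m (of f a h) x) =
      ((fun z => taylorSum δ m (f z) x : α → K) : Germ l K) := by
  simp only [taylorSum, map_sum, map_mul, map_pow]
  have := map_sum (Germ.coeRingHom l) (fun j z => δ^[j] x / (j.factorial : K) * f z ^ j)
    (Finset.range (m + 1))
  simp only [germ_algebraMap, germ_of]
  refine Eq.trans this.symm (congrArg _ (funext fun z => ?_))
  simp

theorem lim_taylorSum (δ : Derivation ℤ K K) (m : ℕ) (f : α → K) (h : Tendsto f l (𝓝 0))
    (x : K) : lim l (taylorSum δ m (of f 0 h) x) = x := by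
  rw [taylorSum, Finset.sum_range_succ', map_add, map_sum, Finset.sum_eq_zero]
  · simp
  · simp

end convGerms

end Germs

end MS

/-! ### Moving tuples along their Taylor polynomials while preserving relations over the constants.
-/

namespace MS

open Topology Filter

theorem pderiv_eval₂_of_pderiv_eq_zero {σ R K : Type*} [CommRing R] [CommRing K] (i : σ)
    (φ : R →+* MvPolynomial σ K) (hφ : ∀ r, MvPolynomial.pderiv i (φ r) = 0) (q : Polynomial R) :
    MvPolynomial.pderiv i (q.eval₂ φ (MvPolynomial.X i)) =
      q.derivative.eval₂ φ (MvPolynomial.X i) := by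
  induction q using Polynomial.induction_on' with
  | add p q hp hq => simp [Polynomial.eval₂_add, hp, hq]
  | monomial n a =>
    rw [Polynomial.eval₂_monomial, Derivation.leibniz, hφ, smul_zero, add_zero,
      Derivation.leibniz_pow, MvPolynomial.pderiv_X_self, Polynomial.derivative_monomial,
      Polynomial.eval₂_monomial]
    simp
    ring

namespace FieldStruc

variable {L : FieldLang.{u}} {M : FieldStruc L} {δ : Derivation ℤ M.K M.K}

variable (δ) in
/-- The field of constants. -/
def constants : Subfield M.K where
  carrier := {x | δ x = 0}
  zero_mem' := map_zero δ
  one_mem' := δ.map_one_eq_zero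
  add_mem' := fun {a b} ha hb => by
    rw [Set.mem_ofPred_eq] at *
    rw [map_add, ha, hb, add_zero]
  mul_mem' := fun {a b} ha hb => by
    rw [Set.mem_ofPred_eq] at *
    rw [Derivation.leibniz, ha, hb, smul_zero, smul_zero, add_zero]
  neg_mem' := fun {a} ha => by
    rw [Set.mem_ofPred_eq] at *
    rw [map_neg, ha, neg_zero]
  inv_mem' := fun a ha => by
    rw [Set.mem_ofPred_eq] at *
    rw [Derivation.leibniz_inv, ha, smul_zero]

theorem mem_constants {x : M.K} : x ∈ constants δ ↔ δ x = 0 := Iff.rfl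

theorem aeval_const_mem_constants (hc : ∀ c, δ (M.const c) = 0) (P : MvPolynomial L.Const ℤ) :
    MvPolynomial.aeval M.const P ∈ constants δ := by
  induction P using MvPolynomial.induction_on with
  | C a => rw [MvPolynomial.aeval_C]; exact intCast_mem _ a
  | add p q hp hq => rw [map_add]; exact add_mem hp hq
  | mul_X p i hp => rw [map_mul, MvPolynomial.aeval_X]; exact mul_mem hp (hc i)

theorem taylorSum_of_mem_constants {A : Type*} [CommRing A] [Algebra M.K A] (m : ℕ) (e : A)
    {x : M.K} (hx : x ∈ constants δ) : taylorSum δ m e x = algebraMap M.K A x := by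
  rw [taylorSum, Finset.sum_range_succ', Finset.sum_eq_zero]
  · simp
  · intro j _
    rw [Function.iterate_succ_apply, mem_constants.1 hx, iterate_map_zero]
    simp

variable [TopologicalSpace M.K] [M.IsTame]

/-- Close to every tuple there are tuples, satisfying the same algebraic relations over the
constants, that are a Taylor polynomial up to a small error. -/
theorem IsGeneric.exists_taylor (hδ : IsGeneric δ) (hc : ∀ c, δ (M.const c) = 0) {ι : Type}
    [Finite ι] (τ : ι → M.K) {A : Finset (MvPolynomial ι M.K)}
    (hA : ∀ P ∈ A, P ∈ Set.range (MvPolynomial.map (σ := ι)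
      (MvPolynomial.aeval M.const : MvPolynomial L.Const ℤ →ₐ[ℤ] M.K).toRingHom))
    (m : ℕ) {U : Set M.K} (hU : U ∈ 𝓝 0) :
    ∃ (ε : M.K) (τ' : ι → M.K), ε ≠ 0 ∧ ε ∈ U ∧
      (∀ P ∈ A, MvPolynomial.eval τ P = 0 → MvPolynomial.eval τ' P = 0) ∧
      (∀ i, τ' i - τ i ∈ U) ∧ ∀ i, (τ' i - taylorSum δ m ε (τ i)) / ε ^ m ∈ U := by
  obtain ⟨s, ρ, q, hρ, hq, hq', hlift⟩ :=
    exists_simple_root_presentation_of_subfield (constants δ) τ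
  -- The variable `0` plays the role of $\varepsilon$ and the last variable that of the moved `ρ`.
  -- Basis elements become their Taylor polynomials in $\varepsilon$, while coefficients in the
  -- field of constants stay fixed.
  let φ₀ : MvPolynomial s (constants δ) →+* MvPolynomial (Fin (1 + 1)) M.K :=
    MvPolynomial.eval₂Hom (MvPolynomial.C.comp (algebraMap (constants δ) M.K))
      fun i => taylorSum δ m (MvPolynomial.X 0) (i : M.K)
  have hφ₀ : ∀ r, MvPolynomial.pderiv (Fin.last 1) (φ₀ r) = 0 := by
    intro r
    induction r using MvPolynomial.induction_on with
    | C a => simp [φ₀]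
    | add p q hp hq => rw [map_add, map_add, hp, hq, add_zero]
    | mul_X p i hp =>
      rw [map_mul, Derivation.leibniz, hp, smul_zero, add_zero]
      simp only [φ₀, MvPolynomial.eval₂Hom_X', taylorSum, map_sum]
      rw [Finset.sum_eq_zero, smul_zero]
      intro j _
      rw [MvPolynomial.algebraMap_eq, MvPolynomial.pderiv_C_mul, MvPolynomial.pderiv_pow,
        MvPolynomial.pderiv_X_of_ne (by decide)]
      simp
  let Q : MvPolynomial (Fin (1 + 1)) M.K := q.eval₂ φ₀ (MvPolynomial.X (Fin.last 1))
  let z₀ : Fin (1 + 1) → M.K := ![0, ρ]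
  have hev : (MvPolynomial.eval z₀).comp φ₀ = (MvPolynomial.aeval (Subtype.val : s → M.K) :
      MvPolynomial s (constants δ) →ₐ[constants δ] M.K).toRingHom := by
    refine MvPolynomial.ringHom_ext (fun a => ?_) fun i => ?_
    · simp [φ₀]
    · simp only [φ₀, RingHom.comp_apply, MvPolynomial.eval₂Hom_X', taylorSum, map_sum]
      rw [Finset.sum_range_succ', Finset.sum_eq_zero]
      · simp
      · simp [z₀]
  -- Points of the curve `Q = 0` approaching `(0, ρ)` with $\varepsilon \neq 0$. Working with germs
  -- along this filter makes the lifting a statement about one ring.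
  let l : Filter (Fin (1 + 1) → M.K) := 𝓝 z₀ ⊓ 𝓟 {z | MvPolynomial.eval z Q = 0 ∧ z 0 ≠ 0}
  have hl : l.NeBot := by
    rw [inf_principal_neBot_iff]
    intro V hV
    have hV' : V ∩ {z | z (Fin.last 1) ≠ 0} ∈ 𝓝 z₀ := inter_mem hV <|
      (continuous_apply (Fin.last 1)).continuousAt.eventually_ne
        (show z₀ (Fin.last 1) ≠ 0 from hρ)
    have h1 : MvPolynomial.eval z₀ Q = 0 := by
      rw [Polynomial.hom_eval₂, hev, MvPolynomial.eval_X]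
      exact hq
    have h2 : MvPolynomial.eval z₀ (MvPolynomial.pderiv (Fin.last 1) Q) ≠ 0 := by
      rw [pderiv_eval₂_of_pderiv_eq_zero _ _ hφ₀, Polynomial.hom_eval₂, hev, MvPolynomial.eval_X]
      exact hq'
    -- Genericity in order one finds a point `(b, δ b)` of the curve. Near `ρ`, which is nonzero, `δ
    -- b` is nonzero, and therefore so is `b`.
    obtain ⟨b, hb, hbV⟩ := hδ 1 le_rfl Q z₀ h1 h2 _ hV'
    refine ⟨_, hbV.1, hb, fun h0 => hbV.2 ?_⟩
    have h0 : b = 0 := h0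
    simp [h0]
  have hlt : ∀ i, Tendsto (fun z : Fin (1 + 1) → M.K => z i) l (𝓝 (z₀ i)) := fun i =>
    ((continuous_apply i).tendsto z₀).mono_left inf_le_left
  have hl0 : Tendsto (fun z : Fin (1 + 1) → M.K => z 0) l (𝓝 0) := hlt 0
  have hlQ : ∀ᶠ z in l, MvPolynomial.eval z Q = 0 ∧ z 0 ≠ 0 :=
    (eventually_principal.2 fun z hz => hz).filter_mono inf_le_right
  let e : convGerms M.K l := convGerms.of (fun z => z 0) 0 hl0
  let y : convGerms M.K l := convGerms.of (fun z => z (Fin.last 1)) ρ (hlt (Fin.last 1))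
  let φ : MvPolynomial s (constants δ) →+* convGerms M.K l :=
    MvPolynomial.eval₂Hom ((algebraMap M.K (convGerms M.K l)).comp (algebraMap (constants δ) M.K))
      fun i => taylorSum δ m e (i : M.K)
  have hφ : (convGerms.lim l).comp φ = (MvPolynomial.aeval (Subtype.val : s → M.K) :
      MvPolynomial s (constants δ) →ₐ[constants δ] M.K).toRingHom := by
    refine MvPolynomial.ringHom_ext (fun a => ?_) fun i => ?_
    · simp [φ]
    · simp only [φ, RingHom.comp_apply, MvPolynomial.eval₂Hom_X']
      exact (convGerms.lim_taylorSum δ m _ hl0 _).trans (MvPolynomial.aeval_X _ i).symm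
  have hy : q.eval₂ φ y = 0 := by
    rw [convGerms.ext_iff_germ_lim, map_zero, map_zero]
    refine ⟨?_, ?_⟩
    · let ev : MvPolynomial (Fin (1 + 1)) M.K →+* ((Fin (1 + 1) → M.K) → M.K) :=
        RingHom.pi fun z => MvPolynomial.eval z
      have h1 : (convGerms.germ l).comp φ = ((Germ.coeRingHom l).comp ev).comp φ₀ := by
        refine MvPolynomial.ringHom_ext (fun a => ?_) fun i => ?_
        · simp only [φ, φ₀, RingHom.comp_apply, MvPolynomial.eval₂Hom_C, convGerms.germ_algebraMap]
          refine congrArg (Germ.ofFun (l := l)) (funext fun z => ?_)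
          simp [ev]
        · simp only [φ, φ₀, RingHom.comp_apply, MvPolynomial.eval₂Hom_X', e,
            convGerms.germ_taylorSum]
          refine congrArg (Germ.ofFun (l := l)) (funext fun z => ?_)
          simp [ev, taylorSum]
      rw [Polynomial.hom_eval₂, h1]
      have h2 := Polynomial.hom_eval₂ q φ₀ ((Germ.coeRingHom l).comp ev)
        (MvPolynomial.X (Fin.last 1))
      have h3 : ((Germ.coeRingHom l).comp ev) (MvPolynomial.X (Fin.last 1)) =
          convGerms.germ l y := by
        refine congrArg (Germ.ofFun (l := l)) (funext fun z => ?_)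
        simp [ev]
      rw [h3] at h2
      rw [← h2]
      refine Germ.coe_eq.2 ?_
      filter_upwards [hlQ] with z hz using hz.1
    · rw [Polynomial.hom_eval₂, hφ]
      exact hq
  -- The germs `τ'` move `τ` along the curve: their limits are `τ`, and they satisfy all algebraic
  -- relations of `τ` over the constants.
  obtain ⟨τ', hτP, hτ⟩ := hlift (convGerms M.K l) (convGerms.lim l)
    convGerms.isUnit_of_lim_ne_zero φ hφ y hy
  have hlimτ : ∀ i, convGerms.lim l (τ' i) = τ i := fun i =>
    (hτ M.K (convGerms.lim l) (RingHom.id _) (by rw [hφ]; rfl) rfl i).symm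
  have hspan : ∀ a ∈ Ideal.span {e ^ (m + 1)}, convGerms.lim l a = 0 := by
    intro a ha
    obtain ⟨c, rfl⟩ := Ideal.mem_span_singleton.1 ha
    simp [e]
  -- Modulo `e ^ (m + 1)` Taylor expansion is a homomorphism. It agrees with `φ` on the coefficient
  -- ring by construction, and it sends `ρ` to the class of `y` because both are roots of the same
  -- polynomial with the same limit, where that root is simple.
  have htay : ∀ i, taylorHom δ m e (τ i) = Ideal.Quotient.mk _ (τ' i) := by
    have h1 : (taylorHom δ m e).comp (MvPolynomial.aeval (Subtype.val : s → M.K) :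
        MvPolynomial s (constants δ) →ₐ[constants δ] M.K).toRingHom =
          (Ideal.Quotient.mk (Ideal.span {e ^ (m + 1)})).comp φ := by
      refine MvPolynomial.ringHom_ext (fun a => ?_) fun i => ?_
      · simp only [φ, RingHom.comp_apply, MvPolynomial.eval₂Hom_C]
        have : (MvPolynomial.aeval (Subtype.val : s → M.K) :
          MvPolynomial s (constants δ) →ₐ[constants δ] M.K).toRingHom (MvPolynomial.C a) = a :=
            MvPolynomial.aeval_C _ a
        rw [this]
        exact congrArg _ (taylorSum_of_mem_constants m e a.2)
      · simp only [φ, RingHom.comp_apply, MvPolynomial.eval₂Hom_X']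
        have : (MvPolynomial.aeval (Subtype.val : s → M.K) :
          MvPolynomial s (constants δ) →ₐ[constants δ] M.K).toRingHom (MvPolynomial.X i) = i :=
            MvPolynomial.aeval_X _ i
        rw [this]
        rfl
    refine hτ _ (Ideal.Quotient.mk _) (taylorHom δ m e) h1 ?_
    let st : convGerms M.K l ⧸ Ideal.span {e ^ (m + 1)} →+* M.K :=
      Ideal.Quotient.lift _ (convGerms.lim l) hspan
    refine eq_of_eval_eq_zero_of_isUnit st ?_
      (p := q.map ((Ideal.Quotient.mk (Ideal.span {e ^ (m + 1)})).comp φ)) ?_ ?_ ?_ ?_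
    · intro a ha
      obtain ⟨a, rfl⟩ := Ideal.Quotient.mk_surjective a
      exact (convGerms.isUnit_of_lim_ne_zero a ha).map _
    · rw [Polynomial.eval_map, ← h1, ← Polynomial.hom_eval₂, hq, map_zero]
    · rw [Polynomial.eval_map, ← Polynomial.hom_eval₂, hy, map_zero]
    · exact convGerms.lim_taylorSum _ _ _ _ _
    · rw [Polynomial.derivative_map, Polynomial.eval_map, Polynomial.hom_eval₂,
          ← RingHom.comp_assoc]
      have h2 : st.comp (Ideal.Quotient.mk (Ideal.span {e ^ (m + 1)})) = convGerms.lim l := rfl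
      have h3 : st (taylorHom δ m e ρ) = ρ := convGerms.lim_taylorSum _ _ _ _ _
      rw [h2, hφ, h3]
      exact hq'
  choose f t hf hft using fun i => convGerms.exists_eq_of (τ' i)
  have hft' : ∀ i, Tendsto (f i) l (𝓝 (τ i)) := by
    intro i
    have := hlimτ i
    rw [hft, convGerms.lim_of] at this
    rw [← this]
    exact hf i
  have h1 : ∀ᶠ z in l, ∀ P ∈ A, MvPolynomial.eval τ P = 0 →
      MvPolynomial.eval (fun i => f i z) P = 0 := by
    rw [Filter.eventually_all_finset]
    intro P hP
    by_cases h0 : MvPolynomial.eval τ P = 0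
    swap
    · simp [h0]
    obtain ⟨P₀, hP₀⟩ := hA P hP
    let P₁ : MvPolynomial ι (constants δ) := MvPolynomial.map
      ((MvPolynomial.aeval M.const : MvPolynomial L.Const ℤ →ₐ[ℤ] M.K).toRingHom.codRestrict
        (constants δ) (aeval_const_mem_constants hc)) P₀
    have hP₁ : MvPolynomial.map (algebraMap (constants δ) M.K) P₁ = P := by
      rw [MvPolynomial.map_map, ← hP₀]
      rfl
    have h2 := hτP P₁ (by
      rw [← h0, ← hP₁, MvPolynomial.aeval_def, MvPolynomial.eval_map])
    have h3 := congrArg (convGerms.germ l) h2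
    have h4 : P₁.eval₂ (φ.comp MvPolynomial.C) τ' =
        P.eval₂ (algebraMap M.K (convGerms M.K l)) τ' := by
      have h : φ.comp MvPolynomial.C =
          (algebraMap M.K (convGerms M.K l)).comp (algebraMap (constants δ) M.K) :=
        RingHom.ext fun a => by simp [φ]
      rw [h, ← MvPolynomial.eval₂_map, hP₁]
    let ev : MvPolynomial ι M.K →+* ((Fin (1 + 1) → M.K) → M.K) :=
      RingHom.pi fun z => MvPolynomial.eval fun i => f i z
    have h5 : (convGerms.germ l).comp (MvPolynomial.eval₂Hom (algebraMap M.K (convGerms M.K l)) τ')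
        =
        (Germ.coeRingHom l).comp ev := by
      refine MvPolynomial.ringHom_ext (fun a => ?_) fun i => ?_
      · simp only [RingHom.comp_apply, MvPolynomial.eval₂Hom_C, convGerms.germ_algebraMap]
        refine congrArg (Germ.ofFun (l := l)) (funext fun z => ?_)
        simp [ev]
      · simp only [RingHom.comp_apply, MvPolynomial.eval₂Hom_X', hft]
        refine congrArg (Germ.ofFun (l := l)) (funext fun z => ?_)
        simp [ev]
    rw [h4, map_zero] at h3
    have h6 := (RingHom.congr_fun h5 P).symm.trans h3
    filter_upwards [Germ.coe_eq.1 h6] with z hz _ using hz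
  have h2 : ∀ᶠ z in l, ∀ i, f i z - τ i ∈ U := by
    rw [eventually_all]
    intro i
    have := (hft' i).sub_const (τ i)
    rw [sub_self] at this
    exact this hU
  have h3 : ∀ᶠ z in l, ∀ i, (f i z - taylorSum δ m (z 0) (τ i)) / z 0 ^ m ∈ U := by
    rw [eventually_all]
    -- The error is a multiple of `e ^ (m + 1)` in the ring of convergent germs. After division by
    -- `e ^ m` a factor `e`, tending to zero, remains in front of a convergent germ.
    intro i
    have h4 : τ' i - taylorSum δ m e (τ i) ∈ Ideal.span {e ^ (m + 1)} :=
      Ideal.Quotient.eq.1 (htay i).symm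
    obtain ⟨c, hc⟩ := Ideal.mem_span_singleton.1 h4
    obtain ⟨g, a, hg, rfl⟩ := convGerms.exists_eq_of c
    have h5 := congrArg (convGerms.germ l) hc
    rw [map_sub, hft, convGerms.germ_taylorSum] at h5
    have h6 : ∀ᶠ z in l, f i z - taylorSum δ m (z 0) (τ i) = z 0 ^ (m + 1) * g z := Germ.coe_eq.1 h5
    have h7 : Tendsto (fun z : Fin (1 + 1) → M.K => z 0 * g z) l (𝓝 0) := by
      simpa using hl0.mul hg
    filter_upwards [h6, h7 hU, hlQ] with z hz hz' hz0
    have : (f i z - taylorSum δ m (z 0) (τ i)) / z 0 ^ m = z 0 * g z := by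
      rw [hz, pow_succ]
      field_simp [hz0.2]
    rw [this]
    exact hz'
  obtain ⟨z, hz1, hz2, hz3, hz4, hz5⟩ :=
    (h1.and <| h2.and <| h3.and <| hlQ.and <| hl0 hU).exists
  exact ⟨z 0, fun i => f i z, hz4.2, hz5, hz1, hz2, hz3⟩

end FieldStruc

end MS

namespace MS

open Topology Filter

namespace FieldStruc

variable {L : FieldLang.{u}} {M : FieldStruc L}
variable {E F W : Type u} [Ctx M E] [Ctx M F] [Ctx M W]
variable [TopologicalSpace M.K] [M.IsTame] {δ : Derivation ℤ M.K M.K}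

/-! ### Approximating derivatives by definable functions -/

/-- A family of values of a definable function can be moved along its Taylor polynomial. -/
theorem IsGeneric.exists_taylor_of_defMap (hδ : IsGeneric δ) (hc : ∀ c, δ (M.const c) = 0)
    {c : E × F → M.K} (hcd : M.DefMap c) {ι₁ ι₂ : Type} [Finite ι₁] [Finite ι₂] (a : ι₁ → E)
    (b : ι₂ → F) (m : ℕ) {U : Set M.K} (hU : U ∈ 𝓝 0) :
    ∃ (a' : ι₁ → E) (b' : ι₂ → F) (ε : M.K), ε ≠ 0 ∧ ∀ i j,
      (c (a' i, b' j) - taylorSum δ m ε (c (a i, b j))) / ε ^ m ∈ U := by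
  -- Being an array of values of `c` is definable without parameters, so it persists near the given
  -- array as long as finitely many equations over the constants are preserved. This keeps the
  -- dependence on `i` and on `j` separate.
  have hR : M.Def (fun x : ι₁ × ι₂ → M.K => ∃ (a : ι₁ → E) (b : ι₂ → F), ∀ p, x p = c (a p.1,
      b p.2)) := by
    refine Def.ex (F := ι₁ → E) (R := fun (x : ι₁ × ι₂ → M.K) (a : ι₁ → E) => ∃ b : ι₂ → F, ∀ p,
        x p = c (a p.1, b p.2))
      (Def.ex (F := ι₂ → F) (Def.forall_finite fun p => Def.eq_fun (F := M.K)
        (f := fun q : ((ι₁ × ι₂ → M.K) × (ι₁ → E)) × (ι₂ → F) => q.1.1 p)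
        (g := fun q => c (q.1.2 p.1, q.2 p.2)) ?_ ?_))
    · fun_prop
    · exact hcd.comp (g := fun q : ((ι₁ × ι₂ → M.K) × (ι₁ → E)) × (ι₂ → F) => (q.1.2 p.1, q.2 p.2))
        (by fun_prop)
  obtain ⟨A, hA, h⟩ := exists_polynomials hR
  obtain ⟨Z, _, B, -, hb0, -, hb⟩ := exists_basis M
  obtain ⟨z, -, hz⟩ := (hb _).eventually_iff.1 (h (fun p => c (a p.1, b p.2)) ⟨a, b, fun _ => rfl⟩)
  obtain ⟨ε, τ, h1, -, h2, h3, h4⟩ := hδ.exists_taylor hc (fun p : ι₁ × ι₂ => c (a p.1, b p.2))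
    (A := A) (fun P hP => (hA P hP).2) m (inter_mem hU (hb0.mem_of_mem (i := z) trivial))
  obtain ⟨a', b', h5⟩ := hz (fun p => (h3 p).2) h2
  exact ⟨a', b', ε, h1, fun i j => by rw [← h5 (i, j)]; exact (h4 (i, j)).1⟩

/-- Solving the Taylor expansion for its top coefficient expresses a derivative through a moved
value of `c`, the lower derivatives and $\varepsilon$. The lower derivatives are replaced by
definable approximations through induction. Rows and columns get separate new coordinates, with
$\varepsilon$ stored on the column side, so the approximations can be used in a partitioned formula.
-/
theorem IsGeneric.exists_approx (hδ : IsGeneric δ) (hc : ∀ c, δ (M.const c) = 0)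
    {c : E × F → M.K} (hcd : M.DefMap c) (m : ℕ) :
    ∃ (E' F' : Type u) (_ : Ctx M E') (_ : Ctx M F') (π₁ : E' → E) (π₂ : F' → F)
      (α : Fin (m + 1) → E' × F' → M.K), M.DefMap π₁ ∧ M.DefMap π₂ ∧ (∀ k, M.DefMap (α k)) ∧
      ∀ {ι₁ ι₂ : Type} [Finite ι₁] [Finite ι₂] (a : ι₁ → E) (b : ι₂ → F), ∀ U ∈ 𝓝 (0 : M.K),
        ∃ (a' : ι₁ → E') (b' : ι₂ → F'), (∀ i, π₁ (a' i) = a i) ∧ (∀ j, π₂ (b' j) = b j) ∧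
          ∀ k i j, α k (a' i, b' j) - δ^[k] (c (a i, b j)) ∈ U := by
  induction m with
  | zero =>
    refine ⟨E, F, inferInstance, inferInstance, fun x => x, fun x => x, fun _ => c, DefMap.id,
      DefMap.id, fun _ => hcd, fun a b U hU => ⟨a, b, fun _ => rfl, fun _ => rfl, fun k i j => ?_⟩⟩
    rw [Fin.val_eq_zero k]
    simpa using mem_of_mem_nhds hU
  | succ m ih =>
    obtain ⟨E', F', _, _, π₁, π₂, α, hπ₁, hπ₂, hα, H⟩ := ih
    let β : (E' × E) × F' × F × M.K → M.K := fun p => (m + 1).factorial * ((c (p.1.2, p.2.2.1) -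
      ∑ k : Fin (m + 1), α k (p.1.1, p.2.1) / (k : ℕ).factorial * p.2.2.2 ^ (k : ℕ)) /
        p.2.2.2 ^ (m + 1))
    have hβ : M.DefMap β := by
      refine DefMap.natCast_mul _ (DefMap.div (DefMap.sub ?_ (DefMap.sum _ fun k => DefMap.mul
        (DefMap.div ?_ (DefMap.natCast _)) (DefMap.pow ?_ _))) (DefMap.pow ?_ _))
      · exact hcd.comp (g := fun p : (E' × E) × F' × F × M.K => (p.1.2, p.2.2.1)) (by fun_prop)
      · exact (hα k).comp (g := fun p : (E' × E) × F' × F × M.K => (p.1.1, p.2.1)) (by fun_prop)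
      · fun_prop
      · fun_prop
    refine ⟨E' × E, F' × F × M.K, inferInstance, inferInstance, fun p => π₁ p.1, fun p => π₂ p.1,
      Fin.snoc (α := fun _ => (E' × E) × F' × F × M.K → M.K) (fun k p => α k (p.1.1, p.2.1)) β,
      hπ₁.comp DefMap.fst', hπ₂.comp DefMap.fst', fun k => ?_, fun {ι₁ ι₂} _ _ a b U hU => ?_⟩
    · induction k using Fin.lastCases with
      | last => simpa using hβ
      | cast k =>
        simp only [Fin.snoc_castSucc]
        exact (hα k).comp (g := fun p : (E' × E) × F' × F × M.K => (p.1.1, p.2.1)) (by fun_prop)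
    · have hf : Tendsto (fun u : M.K => ((m + 1).factorial : M.K) * u) (𝓝 0) (𝓝 0) := by
        have : Tendsto (fun u : M.K => ((m + 1).factorial : M.K) * u) (𝓝 0)
          (𝓝 (((m + 1).factorial : M.K) * 0)) := Continuous.tendsto (by fun_prop) 0
        rwa [mul_zero] at this
      obtain ⟨a₁, b₁, ε, hε, h1⟩ := hδ.exists_taylor_of_defMap hc hcd a b (m + 1)
        (hf (interior_mem_nhds.2 hU))
      -- The order of choices matters: division by `ε ^ (m + 1)` magnifies errors in the lower
      -- derivatives, so `ε` is fixed first and the lower derivatives are approximated afterwards,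
      -- using continuity of `Θ` in them.
      let Θ : ι₁ → ι₂ → (Fin (m + 1) → M.K) → M.K := fun i j x => (m + 1).factorial *
        ((c (a₁ i, b₁ j) - ∑ k : Fin (m + 1), x k / (k : ℕ).factorial * ε ^ (k :
            ℕ)) / ε ^ (m + 1)) -
          δ^[m + 1] (c (a i, b j))
      have hΘ : ∀ i j, ∀ᶠ x in 𝓝 (fun k : Fin (m + 1) => δ^[k] (c (a i, b j))), Θ i j x ∈ U := by
        intro i j
        have hcont : Continuous (Θ i j) := by fun_prop
        refine hcont.continuousAt.eventually_mem (mem_interior_iff_mem_nhds.1 ?_)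
        have := h1 i j
        rw [Set.mem_preimage] at this
        convert this using 1
        simp only [Θ]
        rw [taylorSum, Finset.sum_range_succ, ← Fin.sum_univ_eq_sum_range
          (fun k => algebraMap M.K M.K (δ^[k] (c (a i, b j)) / k.factorial) * ε ^ k) (m + 1)]
        simp only [Algebra.algebraMap_self, RingHom.id_apply]
        have : (((m + 1).factorial : ℕ) : M.K) ≠ 0 := by exact_mod_cast (m + 1).factorial_ne_zero
        have hε' := pow_ne_zero (m + 1) hε
        generalize ((m + 1).factorial : M.K) = q at *
        generalize ε ^ (m + 1) = e at *
        field_simp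
        ring
      obtain ⟨Z, _, B, -, hb0, -, hb⟩ := exists_basis M
      choose z hz using fun i j => ((hb _).eventually_iff.1 (hΘ i j))
      have hV : (⋂ i, ⋂ j, B (z i j)) ∈ 𝓝 (0 : M.K) :=
        Filter.iInter_mem.2 fun i => Filter.iInter_mem.2 fun j => hb0.mem_of_mem trivial
      obtain ⟨a₂, b₂, ha₂, hb₂, h2⟩ := H a b _ (inter_mem hU hV)
      refine ⟨fun i => (a₂ i, a₁ i), fun j => (b₂ j, b₁ j, ε), ha₂, hb₂, fun k i j => ?_⟩
      induction k using Fin.lastCases with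
      | last =>
        simp only [Fin.snoc_last, Fin.val_last]
        refine (hz i j).2 (x := fun k => α k (a₂ i, b₂ j)) fun k => ?_
        exact Set.mem_iInter.1 (Set.mem_iInter.1 (h2 k i j).2 i) j
      | cast k =>
        simp only [Fin.snoc_castSucc]
        exact (h2 k i j).1

/-! ### The independence property -/

/-- Membership in a set with finite frontier can be read off from an approximation. -/
theorem exists_nhds_iff_of_finite_frontier {X : Set M.K} (hX : (frontier X).Finite) (s : M.K) :
    ∃ V ∈ 𝓝 (0 : M.K), ∀ B ⊆ V, ∀ r, s - r ∈ B →
      (((∀ y, y - r ∈ B → y ∈ X) ∨ ∃ y, y - r ∈ B ∧ y ∈ X ∧ ¬ ∀ᶠ y' in 𝓝 y, y' ∈ X) ↔ s ∈ X) := by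
  have h : ∀ᶠ y in 𝓝 s, ((∀ᶠ y' in 𝓝 s, y' ∈ X) → y ∈ X) ∧
      (s ∉ X → y ∈ X → ∀ᶠ y' in 𝓝 y, y' ∈ X) := by
    refine Filter.Eventually.and ?_ ?_
    · by_cases h : ∀ᶠ y' in 𝓝 s, y' ∈ X
      · filter_upwards [h] with y hy _ using hy
      · exact Eventually.of_forall fun y h' => (h h').elim
    · have : (frontier X \ {s})ᶜ ∈ 𝓝 s :=
        (hX.sdiff).isClosed.isOpen_compl.mem_nhds (by simp)
      filter_upwards [this] with y hy hs hyX
      by_contra hy'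
      refine hy ⟨⟨subset_closure hyX, fun h => hy' (mem_interior_iff_mem_nhds.1 h)⟩, ?_⟩
      rintro rfl
      exact hs hyX
  have hcont : Tendsto (fun p : M.K × M.K => s + (p.1 - p.2)) (𝓝 0 ×ˢ 𝓝 0) (𝓝 s) := by
    rw [← nhds_prod_eq]
    exact (Continuous.tendsto (by fun_prop) (0, 0)).trans (by simp)
  obtain ⟨V, hV, hVs⟩ := Filter.mem_prod_same_iff.1 (hcont.eventually h)
  refine ⟨V, hV, fun B hB r hr => ?_⟩
  have hy : ∀ y, y - r ∈ B → ((∀ᶠ y' in 𝓝 s, y' ∈ X) → y ∈ X) ∧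
      (s ∉ X → y ∈ X → ∀ᶠ y' in 𝓝 y, y' ∈ X) := by
    intro y hy
    have := hVs (Set.mk_mem_prod (hB hy) (hB hr))
    simpa using this
  constructor
  · rintro (h1 | ⟨y, h1, h2, h3⟩)
    · exact h1 s hr
    · by_contra hs
      exact h3 ((hy y h1).2 hs h2)
  · intro hs
    by_cases h1 : ∀ᶠ y' in 𝓝 s, y' ∈ X
    · exact Or.inl fun y h2 => (hy y h2).1 h1
    · exact Or.inr ⟨s, hr, hs, h1⟩

/-- Induction on the number of derivative terms. The last one enters through membership in a
definable set of field elements with finite frontier, and this can be tested on a definable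
approximation. Enlarging the tuples on both sides gives a shattered configuration with one term
fewer; without such terms NIP of the model applies. -/
theorem IsGeneric.exists_not_shatter_of_jets (hδ : IsGeneric δ) (hc : ∀ c, δ (M.const c) = 0)
    {n : ℕ} : ∀ {E F : Type u} [Ctx M E] [Ctx M F] {ψ : (E × F) × (Fin n → M.K) → Prop}
    (_ : M.Def ψ) {t : Fin n → E × F → M.K} (_ : ∀ k, t k ∈ basic δ (E × F)),
    ∃ N, ¬ ∃ (a : Fin N → E) (b : Set (Fin N) → F), ∀ i J,
      ψ ((a i, b J), fun k => t k (a i, b J)) ↔ i ∈ J := by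
  induction n with
  | zero =>
    intro E F _ _ ψ hψ t _
    obtain ⟨N, hN⟩ := IsTame.nip (M := M) (R := fun (a : E) (b : F) => ψ ((a, b), fun k => k.elim0))
      (hψ.comp (g := fun p : E × F => (p, fun k : Fin 0 => k.elim0))
        (DefMap.id.prodMk (DefMap.pi fun k => k.elim0)))
    refine ⟨N, fun ⟨a, b, h⟩ => hN ⟨a, b, fun i J => ?_⟩⟩
    rw [← h i J]
    exact iff_of_eq (congrArg ψ (Prod.ext rfl (Subsingleton.elim _ _)))
  | succ n ih =>
    intro E F _ _ ψ hψ t ht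
    obtain ⟨m, c, hcd, htc⟩ := ht (Fin.last n)
    obtain ⟨E', F', _, _, π₁, π₂, α, hπ₁, hπ₂, hα, H⟩ := hδ.exists_approx hc hcd m
    obtain ⟨Z, _, B, hB, hb0, hb, -⟩ := exists_basis M
    let X : (E × F) × (Fin n → M.K) → M.K → Prop := fun w y => ψ (w.1, Fin.snoc w.2 y)
    have hX : M.Def (fun p : ((E × F) × (Fin n → M.K)) × M.K => X p.1 p.2) :=
      hψ.comp (g := fun p : ((E × F) × (Fin n → M.K)) × M.K =>
        (p.1.1, (Fin.snoc p.1.2 p.2 : Fin (n + 1) → M.K))) (by fun_prop)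
    obtain ⟨_, hfin⟩ := exists_ncard_frontier_le hX
    let w : (E' × (F' × Z)) × (Fin n → M.K) → (E × F) × (Fin n → M.K) := fun q =>
      ((π₁ q.1.1, π₂ q.1.2.1), q.2)
    have hw : M.DefMap w := by
      refine DefMap.prodMk (DefMap.prodMk (hπ₁.comp ?_) (hπ₂.comp ?_)) ?_ <;> fun_prop
    let β : (E' × (F' × Z)) × (Fin n → M.K) → M.K := fun q => α (Fin.last m) (q.1.1, q.1.2.1)
    have hβ : M.DefMap β := (hα (Fin.last m)).comp
      (g := fun q : (E' × (F' × Z)) × (Fin n → M.K) => (q.1.1, q.1.2.1)) (by fun_prop)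
    let Ψ : (E' × (F' × Z)) × (Fin n → M.K) → Prop := fun q =>
      (∀ y, y - β q ∈ B q.1.2.2 → X (w q) y) ∨
        ∃ y, y - β q ∈ B q.1.2.2 ∧ X (w q) y ∧ ¬ ∀ᶠ y' in 𝓝 y, X (w q) y'
    have hΨ : M.Def Ψ := by
      have h1 : M.Def (fun p : ((E' × (F' × Z)) × (Fin n → M.K)) × M.K =>
          p.2 - β p.1 ∈ B p.1.1.2.2) := by
        have := hβ.comp (g := fun p : ((E' × (F' × Z)) × (Fin n → M.K)) × M.K => p.1) (by fun_prop)
        exact hB.comp (g := fun p : ((E' × (F' × Z)) × (Fin n → M.K)) × M.K =>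
          (p.2 - β p.1, p.1.1.2.2)) (by fun_prop)
      have h2 : M.Def (fun p : ((E' × (F' × Z)) × (Fin n → M.K)) × M.K => X (w p.1) p.2) := by
        have := hw.comp (g := fun p : ((E' × (F' × Z)) × (Fin n → M.K)) × M.K => p.1) (by fun_prop)
        exact hX.comp (g := fun p : ((E' × (F' × Z)) × (Fin n → M.K)) × M.K =>
          (w p.1, p.2)) (by fun_prop)
      refine Def.or (Def.all (h1.imp h2)) (Def.ex (h1.and (h2.and (Def.not ?_))))
      exact Def.eventually (E := ((E' × (F' × Z)) × (Fin n → M.K)) × M.K)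
        (R := fun p y => X (w p.1) y) (g := fun p => p.2)
        (h2.comp (g := fun p : (((E' × (F' × Z)) × (Fin n → M.K)) × M.K) × M.K => (p.1.1, p.2))
          (by fun_prop)) (by fun_prop)
    obtain ⟨N, hN⟩ := ih hΨ (t := fun k p => t k.castSucc (π₁ p.1, π₂ p.2.1)) fun k =>
      comp_mem_basic (ht k.castSucc) (g := fun p : E' × (F' × Z) => (π₁ p.1, π₂ p.2.1))
        ((hπ₁.comp DefMap.fst').prodMk (hπ₂.comp (DefMap.fst'.comp DefMap.snd')))
    refine ⟨N, fun ⟨a, b, hab⟩ => hN ?_⟩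
    let v : Fin N → Set (Fin N) → (E × F) × (Fin n → M.K) := fun i J =>
      ((a i, b J), fun k => t k.castSucc (a i, b J))
    let s : Fin N → Set (Fin N) → M.K := fun i J => t (Fin.last n) (a i, b J)
    have hs : ∀ i J, X (v i J) (s i J) ↔ i ∈ J := by
      intro i J
      rw [← hab i J]
      exact iff_of_eq (congrArg ψ (Prod.ext rfl (Fin.snoc_init_self
        (fun k => t k (a i, b J)))))
    have hz : ∀ i J, ∃ V ∈ 𝓝 (0 : M.K), ∀ z, B z ⊆ V → ∀ r, s i J - r ∈ B z →
        (((∀ y, y - r ∈ B z → X (v i J) y) ∨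
          ∃ y, y - r ∈ B z ∧ X (v i J) y ∧ ¬ ∀ᶠ y' in 𝓝 y, X (v i J) y') ↔ i ∈ J) := by
      intro i J
      obtain ⟨V, hV, h⟩ := exists_nhds_iff_of_finite_frontier (hfin (v i J)).1 (s i J)
      exact ⟨V, hV, fun z hz r hr => (h _ hz r hr).trans (hs i J)⟩
    choose V hV hVs using hz
    -- There are finitely many pairs of an index and a subset, so one neighbourhood `z` serves them
    -- all and can be made part of the parameters on the column side.
    obtain ⟨z, -, hz⟩ := hb0.mem_iff.1
      (Filter.iInter_mem.2 fun i => Filter.iInter_mem.2 fun J => hV i J : (⋂ i, ⋂ J, V i J) ∈ 𝓝 0)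
    have hz0 : {u | -u ∈ B z} ∈ 𝓝 (0 : M.K) := by
      have : Tendsto (fun u : M.K => -u) (𝓝 0) (𝓝 (-0)) := Continuous.tendsto (by fun_prop) 0
      rw [neg_zero] at this
      exact this (hb0.mem_of_mem trivial)
    obtain ⟨a', b', ha', hb', hab'⟩ := H a b _ hz0
    refine ⟨a', fun J => (b' J, z), fun i J => ?_⟩
    have hwv : w ((a' i, (b' J, z)), fun k => t k.castSucc (π₁ (a' i), π₂ (b' J))) = v i J := by
      simp only [w, v, ha', hb']
    have h1 := hVs i J z (hz.trans (Set.iInter_subset_of_subset i (Set.iInter_subset _ J)))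
      (β ((a' i, (b' J, z)), fun k => t k.castSucc (π₁ (a' i), π₂ (b' J)))) (by
        have := hab' (Fin.last m) i J
        rw [Set.mem_ofPred_eq, neg_sub] at this
        simp only [s, htc]
        exact this)
    rw [← hwv] at h1
    exact h1

theorem IsGeneric.exists_not_shatter (hδ : IsGeneric δ) (hc : ∀ c, δ (M.const c) = 0)
    {R : E × F → Prop} (hR : Good δ R) :
    ∃ N, ¬ ∃ (a : Fin N → E) (b : Set (Fin N) → F), ∀ i J, R (a i, b J) ↔ i ∈ J := by
  obtain ⟨κ, _, t, ψ, ht, hψ, h⟩ := hR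
  obtain ⟨n, ⟨e⟩⟩ := Finite.exists_equiv_fin κ
  obtain ⟨N, hN⟩ := hδ.exists_not_shatter_of_jets hc
    (ψ := fun q => ψ (q.1, fun k => q.2 (e k)))
    (hψ.comp (g := fun q : (E × F) × (Fin n → M.K) => (q.1, fun k => q.2 (e k))) (by fun_prop))
    (t := fun k => t (e.symm k)) fun k => ht _
  refine ⟨N, fun ⟨a, b, hab⟩ => hN ⟨a, b, fun i J => ?_⟩⟩
  rw [← hab i J, h]
  simp

/-- Generic derivations preserve NIP. -/
theorem IsGeneric.isNIP (hδ : IsGeneric δ) (hc : ∀ c, δ (M.const c) = 0) :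
    (M.withDer δ).IsNIP := by
  intro n Γ φ X h
  obtain ⟨N, hN⟩ := hδ.exists_not_shatter hc (E := (M.withDer δ).Val Γ) (F := (M.withDer δ).Val Γ)
    ((good_formula hδ φ).comp (E := (M.withDer δ).Val Γ × (M.withDer δ).Val Γ)
      (g := fun p j => if j ∈ X then p.1 j else p.2 j) (by
        refine DefMap.val_pi (Γ := (Γ : Fin n → L.base.Srt)) fun j => ?_
        by_cases hj : j ∈ X
        · simp only [hj, if_true]
          exact (DefMap.derVal_apply j).comp DefMap.fst'
        · simp only [hj, if_false]
          exact (DefMap.derVal_apply j).comp DefMap.snd'))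
  exact hN (h N)

end FieldStruc

end MS

/-! ### From the axioms of the generic theory to NIP. -/

namespace MS

open Topology Filter

namespace FieldStruc

variable {L : FieldLang.{u}} {M : FieldStruc L}

/-- A derivation of a model as an element of `Derivation ℤ M.K M.K`. -/
def IsDer.toDerivation {δ : M.K → M.K} (h : M.IsDer δ) : Derivation ℤ M.K M.K :=
  Derivation.mk' (AddMonoidHom.mk' δ h.map_add).toIntLinearMap fun a b => by
    change δ (a * b) = a • δ b + b • δ a
    rw [h.map_mul, smul_eq_mul, smul_eq_mul]
    ring

theorem SatisfiesDL.isGeneric {δ : M.K → M.K} {r : ℕ} {Γ : Fin r → FSort L.Aux}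
    {χ : L.base.Formula (extend FSort.field Γ)} (h : M.SatisfiesDL δ χ) (hδ : M.IsDer δ)
    [TopologicalSpace M.K] [M.IsTame] (hb : (𝓝 (0 : M.K)).HasBasis (fun _ => True) (M.fiber χ)) :
    IsGeneric hδ.toDerivation := by
  intro m hm P y hy hy' U hU
  have h0 : (𝓝 (0 : Fin (m + 1) → M.K)).HasBasis (fun _ => True)
      fun z => {x | ∀ i, x i ∈ M.fiber χ z} := by
    rw [nhds_pi]
    refine hb.pi_self.to_hasBasis (fun I _ => ⟨I.2, trivial, fun y hy i _ => hy i⟩)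
      (fun z _ => ⟨(Set.univ, z), ⟨Set.finite_univ, trivial⟩, fun y hy i => hy i trivial⟩)
  have h1 : (𝓝 y).HasBasis (fun _ => True) fun z => {x | ∀ i, x i - y i ∈ M.fiber χ z} := by
    rw [← nhds_translation_sub y]
    exact h0.comap _
  obtain ⟨z, -, hz⟩ := h1.mem_iff.1 hU
  -- The axiom scheme requires the last variable to occur; this is automatic because the separant
  -- does not vanish at `y`.
  have hP : Fin.last m ∈ P.vars := by
    by_contra hP
    rw [MvPolynomial.pderiv_eq_zero_of_notMem_vars hP, map_zero] at hy'
    exact hy' rfl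
  obtain ⟨x, h2, -, h3⟩ := h m hm P hP z y hy hy'
  exact ⟨x, h2, hz h3⟩

theorem IsOpenTheory.genericIsNIP {K₀ : FieldStruc L} [CharZero K₀.K] {r : ℕ}
    {Γ : Fin r → FSort L.Aux} {χ : L.base.Formula (extend FSort.field Γ)}
    (hχ : K₀.DefinesFieldTopology χ) (hA : IsOpenTheory K₀.toStruc.theory χ)
    (h : Lang.IsNIPTheory K₀.toStruc.theory) : GenericIsNIP K₀.toStruc.theory χ := by
  intro M δ hM
  obtain ⟨_, _, hb⟩ := isTame_of_models hχ hA hM.models (h _ hM.models)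
  exact (hM.dl.isGeneric hM.isDer hb).isNIP hM.isDer.map_const

end FieldStruc

/-! ### Passing to the reduct, and NIP as a property of the complete theory. -/

namespace Lang

variable {L : Lang.{u}}

theorem Term.exists_addUnary (s : L.Srt) {n : ℕ} {Γ : Fin n → L.Srt} {s' : L.Srt}
    (t : L.Term Γ s') : ∃ t' : (L.addUnary s).Term (n := n) Γ s', ∀ (M : L.Struc)
      (d : M.carrier s → M.carrier s) (v : M.Val Γ), t'.val (M.addUnary s d) v = t.val M v := by
  induction t with
  | var i => exact ⟨.var i, fun _ _ _ => rfl⟩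
  | app f ts ih =>
    choose ts' h using ih
    exact ⟨.app (L := L.addUnary s) (some f) ts', fun M d v =>
      congrArg (M.fn f) (funext fun i => h i M d v)⟩

theorem Formula.exists_addUnary (s : L.Srt) {n : ℕ} {Γ : Fin n → L.Srt} (φ : L.Formula Γ) :
    ∃ φ' : (L.addUnary s).Formula (n := n) Γ, ∀ (M : L.Struc)
      (d : M.carrier s → M.carrier s) (v : M.Val Γ), φ'.Holds (M.addUnary s d) v ↔ φ.Holds M v := by
  induction φ with
  | falsum => exact ⟨.falsum, fun _ _ _ => Iff.rfl⟩
  | eq t t' =>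
    obtain ⟨t₁, h₁⟩ := t.exists_addUnary s
    obtain ⟨t₂, h₂⟩ := t'.exists_addUnary s
    exact ⟨.eq t₁ t₂, fun M d v => iff_of_eq (congrArg₂ _ (h₁ M d v) (h₂ M d v))⟩
  | rel r ts =>
    choose ts' h using fun i => (ts i).exists_addUnary s
    exact ⟨.rel (L := L.addUnary s) r ts', fun M d v =>
      iff_of_eq (congrArg (M.rel r) (funext fun i => h i M d v))⟩
  | imp φ ψ ih ih' =>
    obtain ⟨φ', h⟩ := ih
    obtain ⟨ψ', h'⟩ := ih'
    exact ⟨.imp φ' ψ', fun M d v => imp_congr (h M d v) (h' M d v)⟩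
  | all s' φ ih =>
    obtain ⟨φ', h⟩ := ih
    exact ⟨.all (L := L.addUnary s) s' φ', fun M d v => forall_congr' fun a => h M d _⟩

theorem Struc.IsNIP.of_addUnary {M : L.Struc} {s : L.Srt} {d : M.carrier s → M.carrier s}
    (h : (M.addUnary s d).IsNIP) : M.IsNIP := by
  intro n Γ φ X hs
  obtain ⟨φ', hφ⟩ := φ.exists_addUnary s
  refine h (n := n) Γ φ' X fun k => ?_
  obtain ⟨a, b, hab⟩ := hs k
  exact ⟨a, b, fun i J => (hφ M d _).trans (hab i J)⟩

/-- Shattering a finite set is a first-order property. -/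
theorem Formula.uDef_shatters {n : ℕ} {Γ : Fin n → L.Srt} (φ : L.Formula Γ) (X : Finset (Fin n))
    (k : ℕ) : UDef (fun i : PEmpty.{1} => (i.elim : L.Srt)) (fun M _ => φ.Shatters X M k) := by
  let Γ' : (Fin k × Fin n) ⊕ (Set (Fin k) × Fin n) → L.Srt :=
    Sum.elim (fun p => Γ p.2) (fun p => Γ p.2)
  refine (UDef.exists_block _ Γ' (R := fun M _ v => ∀ p : Fin k × Set (Fin k),
    φ.Holds M (fun j => if j ∈ X then v (.inl (p.1, j)) else v (.inr (p.2, j))) ↔ p.1 ∈ p.2)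
    (UDef.forall_finite fun p => ?_)).congr fun M v => ?_
  · let f : Fin n → PEmpty.{1} ⊕ ((Fin k × Fin n) ⊕ (Set (Fin k) × Fin n)) := fun j =>
      if j ∈ X then .inr (.inl (p.1, j)) else .inr (.inr (p.2, j))
    have hf : ∀ j, Sum.elim (fun i : PEmpty.{1} => (i.elim : L.Srt)) Γ' (f j) = Γ j := by
      intro j
      simp only [f]
      split_ifs <;> rfl
    have h := ((UDef.of_formula φ).rename f hf)
    have h' := (h.imp (UDef.const (p.1 ∈ p.2))).and ((UDef.const (p.1 ∈ p.2)).imp h)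
    refine h'.congr fun M v => ?_
    rw [← iff_iff_implies_and_implies]
    refine iff_congr (iff_of_eq (congrArg _ (funext fun j => ?_))) Iff.rfl
    have hcast : ∀ x (_ : f j = x) (e : M.carrier _ = M.carrier (Γ j)) (e' : M.carrier _ = _),
        cast e (v (f j)) = cast e' (v x) := by
      rintro x rfl e e'
      rfl
    by_cases hj : j ∈ X
    · exact (if_pos hj).trans (hcast (.inr (.inl (p.1, j))) (if_pos hj) _ rfl).symm
    · exact (if_neg hj).trans (hcast (.inr (.inr (p.2, j))) (if_neg hj) _ rfl).symm
  · constructor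
    · rintro ⟨a, b, h⟩
      refine ⟨fun i => match i with
        | .inl p => a p.1 p.2
        | .inr p => b p.1 p.2, fun p => h p.1 p.2⟩
    · rintro ⟨v', h⟩
      exact ⟨fun i j => v' (.inl (i, j)), fun J j => v' (.inr (J, j)), fun i J => h (i, J)⟩

/-- NIP is a property of the complete theory of a structure. -/
theorem Struc.IsNIP.isNIPTheory {M N : L.Struc} (hM : M.Models N.theory) (h : M.IsNIP) :
    IsNIPTheory N.theory := by
  intro M' hM' n Γ φ X hs
  exact h Γ φ X fun k => ((φ.uDef_shatters X k).iff_of_models hM).2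
    (((φ.uDef_shatters X k).iff_of_models hM').1 (hs k))

end Lang

end MS

theorem theoremA3 (L : MS.FieldLang.{u}) (K₀ : MS.FieldStruc L) (hchar : CharZero K₀.K)
    {r : ℕ} (Γ : Fin r → MS.FSort L.Aux)
    (χ : L.base.Formula (MS.extend MS.FSort.field Γ))
    (hχ : K₀.DefinesFieldTopology χ)
    (hA : MS.IsOpenTheory K₀.toStruc.theory χ)
    (hcons : MS.GenericConsistent K₀.toStruc.theory χ) :
    MS.Lang.IsNIPTheory K₀.toStruc.theory ↔ MS.GenericIsNIP K₀.toStruc.theory χ := by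
  refine ⟨MS.FieldStruc.IsOpenTheory.genericIsNIP hχ hA, fun h => ?_⟩
  -- Consistency enters in this direction: without a model of the generic theory its being NIP would
  -- be vacuous.
  obtain ⟨M, δ, hM⟩ := hcons
  have hM' : M.toStruc.IsNIP := MS.Lang.Struc.IsNIP.of_addUnary
    (M := M.toStruc) (s := (MS.FSort.field : L.base.Srt)) (d := δ) (h M δ hM)
  exact hM'.isNIPTheory hM.models
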